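/- **Setting.** Let $N\ge 1$ and let $\Omega\subset\mathbb R^N$ be a nonempty, connected, open set with $C^2$ boundary satisfying the uniform interior ball condition (for some $r_0>0$, every $x\in\partial\Omega$ lies on the boundary of an open ball of radius $r_0$ contained in $\Omega$) and the uniform exterior ball condition (the same for $\mathbb R^N\setminus\overline\Omega$). Let $n$ be the outward unit normal, $n=-Dd$ with $d$ the signed distance to $\partial\Omega$ (positive in $\Omega$). Let $\mathcal S^N$ be the symmetric $N\times N$ matrices with the operator norm, $\lambda>0$, and let $h:\partial\Omega\to\mathbb R$ be continuous and bounded. Let $f:\overline\Omega\times\mathbb R\times\mathbb R^N\times\mathcal S^N\to\mathbb R$ be continuous with, for all $x\in\overline\Omega$: 1. $f(x,z,p,\Gamma_1+\Gamma_2)\le f(x,z,p,\Gamma_1)$ whenever $\Gamma_2\ge 0$; 2. there is $\eta>0$ such that for every $K\ge0$ there is $C_K^*>0$ with $|f(x,z,p,\Gamma)|\le(\lambda-\eta)|z|+C_K^*$ for all $z$ when $\|(p,\Gamma)\|\le K$; 3. for all $K,L$ there is $C_{K,L}\ge0$ with $|f(x,z,p,\Gamma)-f(x,z,p',\Gamma')|\le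 C_{K,L}\|(p,\Gamma)-(p',\Gamma')\|$ when $\|(p,\Gamma)\|+\|(p',\Gamma')\|\le K$ and $|z|\le L$; 4. for some constants $q,r\ge1$ and every $L$ there is $C_L\ge0$ with $|f(x,z,p,\Gamma)|\le C_L(1+\|p\|^q+\|\Gamma\|^r)$ for all $p,\Gamma$ and $|z|\le L$. Consider the problem $$f(x,u,Du,D^2u)+\lambda u=0\ \text{ in }\Omega,\qquad \langle Du,n\rangle=h\ \text{ on }\partial\Omega. \tag{P}$$ An upper (resp. lower) semicontinuous $u:\overline\Omega\to\mathbb R$ is a viscosity subsolution (resp. supersolution) of (P) if, for every smooth $\phi$ and every $x_0\in\overline\Omega$ at which $u-\phi$ has a local maximum (resp. minimum) on $\overline\Omega$, with $F=f(x_0,u(x_0),D\phi(x_0),D^2\phi(x_0))+\lambda u(x_0)$ and $B=\langle D\phi(x_0),n(x_0)\rangle-h(x_0)$, one has $F\le0$ (resp. $F\ge0$) if $x_0\in\Omega$, and $\min\{F,B\}\le0$ (resp. $\max\{F,B\}\ge0$) if $x_0\in\partial\Omega$. A viscosity solution is a continuous function that is both. **The game.** Let $\alpha,\beta,\gamma>0$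 satisfy $\alpha<\tfrac13$, $\alpha+\beta<1$, $2\alpha+\gamma<2$, $\max(\beta q,\gamma r)<2$, $\gamma<1-\alpha$, $\beta(q-1)<\alpha+1$, $\gamma(r-1)<2\alpha$, $\gamma r<1+\alpha$. Let $\psi\in C_b^2(\overline\Omega)$ (that is, $\psi$ extends to a $C^2$ function on some domain containing $\overline\Omega$ with all derivatives of order at most $2$ bounded there) satisfy $\partial\psi/\partial n=\|h\|_\infty+1$ on $\partial\Omega$. For a constant $M$ put $m=M-1-2\|\psi\|_{L^\infty(\overline\Omega)}$ and $\chi=m+\|\psi\|_{L^\infty(\overline\Omega)}+\psi$. For $\varepsilon>0$ the game starts from a position $x_0\in\overline\Omega$ and a debt $z_0$ with $|z_0|<M$. In round $j$ Helen, knowing all previous moves, chooses $p_j\in\mathbb R^N$ and $\Gamma_j\in\mathcal S^N$ with $\|p_j\|\le\varepsilon^{-\beta}$, $\|\Gamma_j\|\le\varepsilon^{-\gamma}$; then Mark, knowing her choice, chooses $\Delta\hat x_j\in\mathbb R^N$ with $\|\Delta\hat x_j\|\le\varepsilon^{1-\alpha}$. With $x_{j+1}=\operatorname{proj}_{\overline\Omega}(x_j+\Delta\hat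 x_j)$ and $\Delta x_j=x_{j+1}-x_j$, Helen's loss is $$\delta_j=p_j\cdot\Delta\hat x_j+\tfrac12\langle\Gamma_j\Delta\hat x_j,\Delta\hat x_j\rangle+\varepsilon^2f(x_j,z_j,p_j,\Gamma_j)-\|\Delta\hat x_j-\Delta x_j\|\,h(x_{j+1}),$$ and her debt becomes $z_{j+1}=e^{\lambda\varepsilon^2}(z_j+\delta_j)$. The game stops at the first $K\ge1$ with $|z_K|\ge M$; the present value of Helen's income is then $e^{-(K-1)\lambda\varepsilon^2}(-z_{K-1}-\chi(x_{K-1}))$ if $z_K\ge M$ and $e^{-(K-1)\lambda\varepsilon^2}(-z_{K-1}+\chi(x_{K-1}))$ if $z_K\le-M$; it is $0$ if the game never stops. For $|z|<M$ let $U^\varepsilon(x,z)$ be the supremum over Helen's strategies of the infimum over Mark's plays of this present value from $(x,z)$; put $U^\varepsilon(x,z)=-z-\chi(x)$ for $z\ge M$ and $U^\varepsilon(x,z)=-z+\chi(x)$ for $z\le-M$. For $x\in\overline\Omega$ let $$u^\varepsilon(x)=\sup\{z:U^\varepsilon(x,z)>0\},\qquad v^\varepsilon(x)=\inf\{z:U^\varepsilon(x,z)<0\},$$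 $$\overline u(x)=\limsup_{\varepsilon\to0,\ \overline\Omega\ni y\to x}u^\varepsilon(y),\qquad \underline v(x)=\liminf_{\varepsilon\to0,\ \overline\Omega\ni y\to x}v^\varepsilon(y).$$ **Theorem.** There is $M_0>0$ such that for every $M>M_0$ one has $m>0$ and the following hold. (a) For all sufficiently small $\varepsilon>0$, $u^\varepsilon$ and $v^\varepsilon$ are well defined: the projections used in the game are unique; $U^\varepsilon$ is bounded on $\overline\Omega\times(-M,M)$ and is there the unique bounded solution of the dynamic programming principle $$U(x,z)=\sup_{p,\Gamma}\inf_{\Delta\hat x}\begin{cases}e^{-\lambda\varepsilon^2}U(x',z'),&|z'|<M,\\-z-\chi(x),&z'\ge M,\\-z+\chi(x),&z'\le-M,\end{cases}$$ where $(x',z')$ is the state after one round started from $(x,z)$; and for every $x\in\overline\Omega$ the sets defining $u^\varepsilon(x)$ and $v^\varepsilon(x)$ are nonempty and bounded above, respectively below. Moreover $|u^\varepsilon|\le\chi$ and $|v^\varepsilon|\le\chi$ on $\overline\Omega$. (b) $\overline u$ is a viscosity subsolution and $\underline v$ is a viscosity supersolution of (P). (c) Let $\mathcal C$ be a class of functions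 containing all functions bounded on $\overline\Omega$ (for example all bounded functions, or all functions). If $\underline v\le\overline u$ on $\overline\Omega$ and (P) has a comparison principle in $\mathcal C$ (every subsolution in $\mathcal C$ is $\le$ every supersolution in $\mathcal C$ on $\overline\Omega$), then (P) has exactly one viscosity solution in $\mathcal C$, and as $\varepsilon\to0$ both $u^\varepsilon$ and $v^\varepsilon$ converge to it locally uniformly in $\overline\Omega$. -/

import Mathlib

open Set Filter Topology
open scoped ContDiff

noncomputable section

/-- Euclidean space of dimension `N`. -/
abbrev Euc (N : ℕ) : Type := EuclideanSpace ℝ (Fin N)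

/-- Linear operators of `ℝ^N` with the operator norm; the space of symmetric matrices is
represented by the self-adjoint ones. -/
abbrev Op (N : ℕ) : Type := Euc N →L[ℝ] Euc N

/-! ### Domains -/

/-- The supremum norm of `g` on `S` (equal to `0` if `S` is empty). -/
def supNormOn {N : ℕ} (S : Set (Euc N)) (g : Euc N → ℝ) : ℝ := ⨆ x : S, |g x|

/-- `g` is bounded on `S`. -/
def BoundedOn {N : ℕ} (S : Set (Euc N)) (g : Euc N → ℝ) : Prop := ∃ C : ℝ, ∀ x ∈ S, |g x| ≤ C

/-- A nonempty connected open set whose boundary is of class `C²`: near each boundary point the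
set is the region where some `C²` function with nonvanishing differential is negative. -/
structure IsC2Domain {N : ℕ} (Ω : Set (Euc N)) : Prop where
  isOpen : IsOpen Ω
  isConnected : IsConnected Ω
  boundary : ∀ x ∈ frontier Ω, ∃ V : Set (Euc N), IsOpen V ∧ x ∈ V ∧
    ∃ ρ : Euc N → ℝ, ContDiffOn ℝ 2 ρ V ∧ fderiv ℝ ρ x ≠ 0 ∧ ∀ y ∈ V, (y ∈ Ω ↔ ρ y < 0)

/-- Uniform interior ball condition: at every boundary point there is an interior open ball of
a fixed radius whose boundary contains the point. -/
def UniformInteriorBall {N : ℕ} (S : Set (Euc N)) : Prop :=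
  ∃ r : ℝ, 0 < r ∧ ∀ x ∈ frontier S, ∃ c : Euc N, Metric.ball c r ⊆ S ∧ x ∈ Metric.sphere c r

/-- Uniform exterior ball condition: the uniform interior ball condition for the complement of
the closure. -/
def UniformExteriorBall {N : ℕ} (Ω : Set (Euc N)) : Prop := UniformInteriorBall (closure Ω)ᶜ

/-- Signed distance to the boundary, positive inside `Ω` and negative outside. -/
def signedBdryDist {N : ℕ} (Ω : Set (Euc N)) (x : Euc N) : ℝ :=
  Metric.infDist x Ωᶜ - Metric.infDist x Ω

/-- The outward unit normal `n = -Dd` at boundary points, `d` the signed distance. -/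
def outwardNormal {N : ℕ} (Ω : Set (Euc N)) (x : Euc N) : Euc N := -gradient (signedBdryDist Ω) x

/-- `ψ` is of class `C²_b` on the closure of `Ω`: it is `C²`, with bounded derivatives of order
at most two, on some domain `O` containing the closure of `Ω`. (Values of `ψ` off `O` are
irrelevant, and a function on the closure is identified with such an extension of it.) -/
def IsCb2 {N : ℕ} (Ω : Set (Euc N)) (ψ : Euc N → ℝ) : Prop :=
  ∃ O : Set (Euc N), IsOpen O ∧ IsConnected O ∧ closure Ω ⊆ O ∧ ContDiffOn ℝ 2 ψ O ∧
    ∃ C : ℝ, ∀ x ∈ O, ∀ k ≤ 2, ‖iteratedFDeriv ℝ k ψ x‖ ≤ C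

/-- `y` is a nearest point to `x` in `S`. -/
def IsNearest {N : ℕ} (S : Set (Euc N)) (x y : Euc N) : Prop :=
  y ∈ S ∧ dist x y = Metric.infDist x S

/-- Projection onto the closure of `Ω` (the nearest point, whenever it is unique). -/
def projClosure {N : ℕ} (Ω : Set (Euc N)) (x : Euc N) : Euc N :=
  Classical.epsilon (IsNearest (closure Ω) x)

/-! ### The equation -/

/-- The assumptions on the nonlinearity `f(x,z,p,Γ)`, for `x` in the closure of `Ω`, `z` real,
`p` a vector and `Γ` symmetric: continuity, ellipticity, bound in `z` by the discount rate,
local Lipschitz continuity and polynomial growth in `(p,Γ)`. -/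
structure NonlinearityHyp {N : ℕ} (Ω : Set (Euc N)) (f : Euc N → ℝ → Euc N → Op N → ℝ)
    (lam q r : ℝ) : Prop where
  continuous : ContinuousOn
    (fun w : Euc N × ℝ × Euc N × Op N => f w.1 w.2.1 w.2.2.1 w.2.2.2)
    {w | w.1 ∈ closure Ω ∧ IsSelfAdjoint w.2.2.2}
  elliptic : ∀ x ∈ closure Ω, ∀ (z : ℝ) (p : Euc N) (Γ₁ Γ₂ : Op N),
    IsSelfAdjoint Γ₁ → Γ₂.IsPositive → f x z p (Γ₁ + Γ₂) ≤ f x z p Γ₁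
  growth_z : ∃ η : ℝ, 0 < η ∧ ∀ K : ℝ, 0 ≤ K → ∃ C : ℝ, 0 < C ∧
    ∀ x ∈ closure Ω, ∀ (z : ℝ) (p : Euc N) (Γ : Op N), IsSelfAdjoint Γ → ‖(p, Γ)‖ ≤ K →
      |f x z p Γ| ≤ (lam - η) * |z| + C
  lipschitz : ∀ K L : ℝ, ∃ C : ℝ, 0 ≤ C ∧
    ∀ x ∈ closure Ω, ∀ (z : ℝ) (p p' : Euc N) (Γ Γ' : Op N),
      IsSelfAdjoint Γ → IsSelfAdjoint Γ' → ‖(p, Γ)‖ + ‖(p', Γ')‖ ≤ K → |z| ≤ L →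
      |f x z p Γ - f x z p' Γ'| ≤ C * ‖(p, Γ) - (p', Γ')‖
  growth : ∀ L : ℝ, ∃ C : ℝ, 0 ≤ C ∧
    ∀ x ∈ closure Ω, ∀ (z : ℝ) (p : Euc N) (Γ : Op N), IsSelfAdjoint Γ → |z| ≤ L →
      |f x z p Γ| ≤ C * (1 + ‖p‖ ^ q + ‖Γ‖ ^ r)

/-- The Hessian `D²φ(x)`, as a linear operator. -/
def hess {N : ℕ} (φ : Euc N → ℝ) (x : Euc N) : Op N := fderiv ℝ (gradient φ) x

/-- Viscosity subsolution of `f(x,u,Du,D²u) + lam u = 0` in `Ω`, `⟨Du,n⟩ = h` on the boundary. -/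
structure IsViscSub {N : ℕ} (Ω : Set (Euc N)) (f : Euc N → ℝ → Euc N → Op N → ℝ) (lam : ℝ)
    (h : Euc N → ℝ) (u : Euc N → ℝ) : Prop where
  usc : UpperSemicontinuousOn u (closure Ω)
  interior : ∀ x ∈ Ω, ∀ φ : Euc N → ℝ, ContDiff ℝ ∞ φ →
    IsLocalMaxOn (fun y => u y - φ y) (closure Ω) x →
    f x (u x) (gradient φ x) (hess φ x) + lam * u x ≤ 0
  boundary : ∀ x ∈ frontier Ω, ∀ φ : Euc N → ℝ, ContDiff ℝ ∞ φ →
    IsLocalMaxOn (fun y => u y - φ y) (closure Ω) x →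
    min (f x (u x) (gradient φ x) (hess φ x) + lam * u x)
      (inner ℝ (gradient φ x) (outwardNormal Ω x) - h x) ≤ 0

/-- Viscosity supersolution of the same boundary value problem. -/
structure IsViscSuper {N : ℕ} (Ω : Set (Euc N)) (f : Euc N → ℝ → Euc N → Op N → ℝ) (lam : ℝ)
    (h : Euc N → ℝ) (u : Euc N → ℝ) : Prop where
  lsc : LowerSemicontinuousOn u (closure Ω)
  interior : ∀ x ∈ Ω, ∀ φ : Euc N → ℝ, ContDiff ℝ ∞ φ →
    IsLocalMinOn (fun y => u y - φ y) (closure Ω) x →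
    0 ≤ f x (u x) (gradient φ x) (hess φ x) + lam * u x
  boundary : ∀ x ∈ frontier Ω, ∀ φ : Euc N → ℝ, ContDiff ℝ ∞ φ →
    IsLocalMinOn (fun y => u y - φ y) (closure Ω) x →
    0 ≤ max (f x (u x) (gradient φ x) (hess φ x) + lam * u x)
      (inner ℝ (gradient φ x) (outwardNormal Ω x) - h x)

/-- Viscosity solution: continuous, and both a sub- and a supersolution. -/
structure IsViscSol {N : ℕ} (Ω : Set (Euc N)) (f : Euc N → ℝ → Euc N → Op N → ℝ) (lam : ℝ)
    (h : Euc N → ℝ) (u : Euc N → ℝ) : Prop where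
  continuousOn : ContinuousOn u (closure Ω)
  sub : IsViscSub Ω f lam h u
  super : IsViscSuper Ω f lam h u

/-- Comparison principle in the class `𝒞`: subsolutions in `𝒞` lie below supersolutions in `𝒞`. -/
def ComparisonPrinciple {N : ℕ} (Ω : Set (Euc N)) (f : Euc N → ℝ → Euc N → Op N → ℝ) (lam : ℝ)
    (h : Euc N → ℝ) (𝒞 : Set (Euc N → ℝ)) : Prop :=
  ∀ u ∈ 𝒞, ∀ v ∈ 𝒞, IsViscSub Ω f lam h u → IsViscSuper Ω f lam h v →
    ∀ x ∈ closure Ω, u x ≤ v x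

/-! ### The game -/

/-- The function `χ = m + ‖ψ‖_∞ + ψ` fixing the payoff when the debt cap is reached. -/
def chi {N : ℕ} (Ω : Set (Euc N)) (ψ : Euc N → ℝ) (m : ℝ) (x : Euc N) : ℝ :=
  m + supNormOn (closure Ω) ψ + ψ x

/-- The data of the game: domain, nonlinearity, boundary coupon `h`, discount rate `lam`,
exponents `α`, `β`, `γ` of the constraints on the moves, debt cap `M`, and the function `χ`. -/
structure NeumannGame (N : ℕ) where
  Ω : Set (Euc N)
  f : Euc N → ℝ → Euc N → Op N → ℝ
  h : Euc N → ℝ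
  lam : ℝ
  α : ℝ
  β : ℝ
  γ : ℝ
  M : ℝ
  χ : Euc N → ℝ

namespace NeumannGame

variable {N : ℕ} (G : NeumannGame N) (ε : ℝ)

/-- Helen's choices: `(p, Γ)` with `‖p‖ ≤ ε^(-β)`, `Γ` symmetric and `‖Γ‖ ≤ ε^(-γ)`. -/
def helenMoves : Set (Euc N × Op N) :=
  {c | ‖c.1‖ ≤ ε ^ (-G.β) ∧ IsSelfAdjoint c.2 ∧ ‖c.2‖ ≤ ε ^ (-G.γ)}

/-- Mark's choices: displacements `d` with `‖d‖ ≤ ε^(1-α)`. -/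
def markMoves : Set (Euc N) := {d | ‖d‖ ≤ ε ^ (1 - G.α)}

/-- Helen's loss in one round from position `x` and debt `z`, when she chooses `c = (p, Γ)` and
Mark chooses `d`. -/
def loss (x : Euc N) (z : ℝ) (c : Euc N × Op N) (d : Euc N) : ℝ :=
  inner ℝ c.1 d + 1 / 2 * inner ℝ (c.2 d) d + ε ^ 2 * G.f x z c.1 c.2
    - ‖(x + d) - projClosure G.Ω (x + d)‖ * G.h (projClosure G.Ω (x + d))

/-- The state `(position, debt)` after one round. -/
def next (s : Euc N × ℝ) (c : Euc N × Op N) (d : Euc N) : Euc N × ℝ :=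
  (projClosure G.Ω (s.1 + d), Real.exp (G.lam * ε ^ 2) * (s.2 + G.loss ε s.1 s.2 c d))

/-- A strategy of Helen prescribes her choice as a function of Mark's previous moves. -/
abbrev Strategy : Type := List (G.markMoves ε) → G.helenMoves ε

/-- The state after `j` rounds, starting from `s`, when Helen plays `σ` and Mark's moves
are `m 0, m 1, …` (the caps being ignored). -/
def state (s : Euc N × ℝ) (σ : G.Strategy ε) (m : ℕ → G.markMoves ε) : ℕ → Euc N × ℝ
  | 0 => s
  | j + 1 => G.next ε (state s σ m j) (σ (List.ofFn fun i : Fin j => m i)).1 (m j).1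

/-- The payoff `∓χ` with the debt `z` at the last position `x`, when the debt `z'` after the
last round has reached one of the caps: `-z - χ(x)` if `z' ≥ M`, `-z + χ(x)` if `z' ≤ -M`. -/
def capped (x : Euc N) (z z' : ℝ) : ℝ := if G.M ≤ z' then -z - G.χ x else -z + G.χ x

open Classical in
/-- Present value of Helen's income. If the game ends at round `K = j + 1`, the first one after
which the debt is at least `M` in absolute value, it is `e^{-(K-1) lam ε²} (-z_{K-1} ∓ χ(x_{K-1}))`;
if the game never ends it is `0`. -/
def payoff (s : Euc N × ℝ) (σ : G.Strategy ε) (m : ℕ → G.markMoves ε) : ℝ :=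
  if H : ∃ j : ℕ, G.M ≤ |(G.state ε s σ m (j + 1)).2| then
    Real.exp (-(Nat.find H : ℝ) * G.lam * ε ^ 2) *
      G.capped (G.state ε s σ m (Nat.find H)).1 (G.state ε s σ m (Nat.find H)).2
        (G.state ε s σ m (Nat.find H + 1)).2
  else 0

/-- Helen's value function `U^ε(x,z)`: her best worst-case payoff if `|z| < M`, extended by the
capped payoff if `|z| ≥ M`. -/
def U (x : Euc N) (z : ℝ) : ℝ :=
  if |z| < G.M then ⨆ σ : G.Strategy ε, ⨅ m : ℕ → G.markMoves ε, G.payoff ε (x, z) σ m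
  else G.capped x z z

/-- `W` is a solution of the dynamic programming principle for all `x` in the closure of `Ω`
and `|z| < M`. -/
def SolvesDPP (W : Euc N → ℝ → ℝ) : Prop :=
  ∀ x ∈ closure G.Ω, ∀ z : ℝ, |z| < G.M →
    W x z = ⨆ c : G.helenMoves ε, ⨅ d : G.markMoves ε,
      if |(G.next ε (x, z) c d).2| < G.M then
        Real.exp (-G.lam * ε ^ 2) * W (G.next ε (x, z) c d).1 (G.next ε (x, z) c d).2
      else G.capped x z (G.next ε (x, z) c d).2

/-- `W` is bounded for `x` in the closure of `Ω` and `|z| < M`. -/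
def BoundedValue (W : Euc N → ℝ → ℝ) : Prop :=
  ∃ C : ℝ, ∀ x ∈ closure G.Ω, ∀ z : ℝ, |z| < G.M → |W x z| ≤ C

/-- The maximal initial debt `u^ε(x) = sup {z : U^ε(x,z) > 0}`. -/
def u (x : Euc N) : ℝ := sSup {z | 0 < G.U ε x z}

/-- The minimal initial debt `v^ε(x) = inf {z : U^ε(x,z) < 0}`. -/
def v (x : Euc N) : ℝ := sInf {z | G.U ε x z < 0}

/-- All the objects entering the definition of `u^ε` and `v^ε` make sense: the projection is
uniquely defined wherever the game uses it, `U^ε` is bounded and is the unique bounded solution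
of the dynamic programming principle, and the supremum and infimum are those of
nonempty sets that are bounded above, respectively below. -/
structure WellDefined : Prop where
  proj : ∀ x ∈ closure G.Ω, ∀ d ∈ G.markMoves ε, ∃! y, IsNearest (closure G.Ω) (x + d) y
  bounded : G.BoundedValue (G.U ε)
  dpp : G.SolvesDPP ε (G.U ε)
  unique : ∀ W : Euc N → ℝ → ℝ, G.BoundedValue W → G.SolvesDPP ε W →
    ∀ x ∈ closure G.Ω, ∀ z : ℝ, |z| < G.M → W x z = G.U ε x z
  u_nonempty : ∀ x ∈ closure G.Ω, {z | 0 < G.U ε x z}.Nonempty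
  u_bddAbove : ∀ x ∈ closure G.Ω, BddAbove {z | 0 < G.U ε x z}
  v_nonempty : ∀ x ∈ closure G.Ω, {z | G.U ε x z < 0}.Nonempty
  v_bddBelow : ∀ x ∈ closure G.Ω, BddBelow {z | G.U ε x z < 0}

/-- Upper relaxed semi-limit of `u^ε(y)` as `ε → 0⁺` and `y → x` in the closure of `Ω`. -/
def ubar (x : Euc N) : ℝ :=
  limsup (fun e : ℝ × Euc N => G.u e.1 e.2) (𝓝[>] (0 : ℝ) ×ˢ 𝓝[closure G.Ω] x)

/-- Lower relaxed semi-limit of `v^ε(y)` as `ε → 0⁺` and `y → x` in the closure of `Ω`. -/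
def vbar (x : Euc N) : ℝ :=
  liminf (fun e : ℝ × Euc N => G.v e.1 e.2) (𝓝[>] (0 : ℝ) ×ˢ 𝓝[closure G.Ω] x)

end NeumannGame

/-- The game with debt cap `M` and `m = M - 1 - 2‖ψ‖_∞`, `χ = m + ‖ψ‖_∞ + ψ`. -/
def neumannGame {N : ℕ} (Ω : Set (Euc N)) (f : Euc N → ℝ → Euc N → Op N → ℝ) (h : Euc N → ℝ)
    (lam α β γ : ℝ) (ψ : Euc N → ℝ) (M : ℝ) : NeumannGame N where
  Ω := Ω
  f := f
  h := h
  lam := lam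
  α := α
  β := β
  γ := γ
  M := M
  χ := chi Ω ψ (M - 1 - 2 * supNormOn (closure Ω) ψ)

end

/-! Let `φ` be smooth and let Mark's displacement `d` overshoot the closure of `Ω` by a distance
`t`. Up to `o(ε²) + o(t)`, the debt increment in one round minus the increment of `φ` equals `⟨p -
Dφ, d⟩ + ½⟨(Γ - D²φ)d, d⟩ + ε²(f(x,z,p,Γ) + λz) + t(⟨Dφ,n⟩ - h)`. Helen can cancel the first two
terms by playing `p = Dφ`, `Γ = D²φ` (`helen_step`). If she plays anything else, Mark does at least
as well as if she had played these values, up to a small error (`mark_response`, `mark_step`): a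
wrong slope gives him a gain of order `ε^(1-α)`, and a too large eigenvalue of `Γ` one of order
`ε^(2-2α)`. The inequalities on `α, β, γ, q, r` say that these gains dominate `ε²f` and that all
remainders are negligible. So the equation in `Ω` and the Neumann condition both come from a single
expansion, `round_expansion`. The tangent balls supply its geometry: a Lipschitz normal, a unique
projection, and an actual displacement equal to `d - t n`.

The discount `e^{-λε²}` makes the dynamic programming operator a contraction, hence the uniqueness
of `U^ε`. It also makes `χ` a barrier: the interest earned on `χ ≥ m` pays for `ε²f`, since `f`
grows in `z` with slope at most `λ - η` and `M` is large, while the slope `‖h‖ + 1` of `ψ` at the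
boundary pays for the coupon `h`. Thus `U^ε < 0` above `χ` and `U^ε > 0` below `-χ`.

By dynamic programming Helen can keep `U^ε > 0` from one round to the next, and Mark can keep `U^ε <
0`. Comparing `sup {U^ε > 0}` before and after a round near a maximum of `ubar - φ` contradicts
`mark_step` unless the subsolution inequality holds; `vbar` is treated symmetrically with
`helen_step`.

For the convergence, `U^ε` is not known to be monotone in `z`, so an upper bound on `v^ε` and a
lower bound on `u^ε` are still needed. They come from the debts `upperDebt = sup {U^ε ≥ -e^{-s}} ≥
v^ε` and `lowerDebt = inf {U^ε ≤ e^{-s}} ≤ u^ε`. Their relaxed limits as `s → ∞`, `ε → 0` are again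
a sub- and a supersolution: a round lowers `s` only by `2λε²`, and since these debts are bounded and
monotone in `s`, some level `s` exists at which this shift costs only `o(ε²)`
(`IsRelaxedUpper.exists_near_max`). Comparison then bounds the upper limit of `v^ε` by `vbar` and
the lower limit of `u^ε` by `ubar`. -/

noncomputable section

/-! ### Geometry of domains with interior and exterior balls -/

section Geometry

variable {N : ℕ}

/-- A boundary point of a `C²` domain is a boundary point of the exterior. -/
theorem frontier_subset_frontier_exterior {Ω : Set (Euc N)} (hΩ : IsC2Domain Ω) :
    frontier Ω ⊆ frontier (closure Ω)ᶜ := by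
  intro x hx
  rw [frontier_compl]
  refine ⟨subset_closure (frontier_subset_closure hx), fun hint => ?_⟩
  obtain ⟨V, hV, hxV, ρ, hρ, hd, hiff⟩ := hΩ.boundary x hx
  have hxn : x ∉ Ω := by
    rw [hΩ.isOpen.frontier_eq] at hx; exact hx.2
  have hx0 : 0 ≤ ρ x := by
    by_contra hlt
    exact hxn ((hiff x hxV).2 (not_le.1 hlt))
  -- If `x` were interior to the closure, then `ρ ≤ 0` near `x` by density of `Ω` there, whereas `ρ
  -- x ≥ 0`: a local maximum, against the nonvanishing differential.
  refine hd (IsLocalMax.fderiv_eq_zero ?_)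
  have hcl : closure Ω ∈ 𝓝 x := mem_interior_iff_mem_nhds.1 hint
  filter_upwards [hcl, hV.mem_nhds hxV] with y hy hyV
  refine le_trans ?_ hx0
  by_contra hpos
  have hc : ContinuousAt ρ y := hρ.continuousOn.continuousAt (hV.mem_nhds hyV)
  have hev : ∀ᶠ w in 𝓝 y, 0 < ρ w ∧ w ∈ V :=
    (hc.eventually (lt_mem_nhds (not_le.1 hpos))).and (hV.mem_nhds hyV)
  obtain ⟨w, hwΩ, hw⟩ := ((mem_closure_iff_frequently.1 hy).and_eventually hev).exists
  exact absurd ((hiff w hw.2).1 hwΩ) (not_lt.2 hw.1.le)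

/-- Shrinking a ball towards a point of its sphere keeps it tangent there; interior and exterior
balls can thus be given a common radius. -/
theorem exists_unit_of_ball {S : Set (Euc N)} {c x : Euc N} {r ρ : ℝ} (hρ : 0 < ρ) (hρr : ρ ≤ r)
    (hb : Metric.ball c r ⊆ S) (hx : x ∈ Metric.sphere c r) :
    ∃ ν : Euc N, ‖ν‖ = 1 ∧ Metric.ball (x - ρ • ν) ρ ⊆ S := by
  have hr : 0 < r := hρ.trans_le hρr
  have hxc : ‖x - c‖ = r := by rw [← dist_eq_norm]; exact hx
  refine ⟨(1 / r) • (x - c), ?_, (Metric.ball_subset_ball' ?_).trans hb⟩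
  · rw [norm_smul, hxc, Real.norm_of_nonneg (by positivity)]; field_simp
  · have h1 : x - ρ • (1 / r) • (x - c) - c = (1 - ρ / r) • (x - c) := by
      rw [sub_smul, one_smul, smul_smul]; simp only [div_eq_mul_inv, one_mul]; abel
    rw [dist_eq_norm, h1, norm_smul, hxc, Real.norm_of_nonneg]
    · field_simp; linarith
    · rw [sub_nonneg, div_le_one hr]; exact hρr

/-- Otherwise the point dividing the segment of centres in the ratio `r : s` lies in both balls.
This inequality is the source of the rigidity statements below. -/
theorem dist_ge_of_disjoint_ball {a b : Euc N} {r s : ℝ} (hr : 0 < r) (hs : 0 < s)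
    (h : Disjoint (Metric.ball a r) (Metric.ball b s)) : r + s ≤ ‖a - b‖ := by
  by_contra hlt
  push Not at hlt
  have hrs : 0 < r + s := by linarith
  have hmem : a + (r / (r + s)) • (b - a) ∈ Metric.ball a r ∧
      a + (r / (r + s)) • (b - a) ∈ Metric.ball b s := by
    constructor
    · rw [Metric.mem_ball, dist_eq_norm, add_sub_cancel_left, norm_smul, norm_sub_rev,
        Real.norm_of_nonneg (by positivity), div_mul_eq_mul_div, div_lt_iff₀ hrs]
      exact mul_lt_mul_of_pos_left hlt hr
    · have : a + (r / (r + s)) • (b - a) - b = (s / (r + s)) • (a - b) := by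
        have h2 : s / (r + s) = 1 - r / (r + s) := by field_simp; ring
        rw [h2]; module
      rw [Metric.mem_ball, dist_eq_norm, this, norm_smul,
        Real.norm_of_nonneg (by positivity), div_mul_eq_mul_div, div_lt_iff₀ hrs]
      exact mul_lt_mul_of_pos_left hlt hs
  exact Set.disjoint_left.1 h hmem.1 hmem.2

theorem signedBdryDist_compl (S : Set (Euc N)) (y : Euc N) :
    signedBdryDist Sᶜ y = -signedBdryDist S y := by
  simp [signedBdryDist]

theorem le_signedBdryDist {S : Set (Euc N)} {c : Euc N} {r : ℝ} (hr : 0 < r)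
    (hb : Metric.ball c r ⊆ S) (hne : Sᶜ.Nonempty) (y : Euc N) :
    r - ‖y - c‖ ≤ signedBdryDist S y := by
  unfold signedBdryDist
  by_cases hy : ‖y - c‖ < r
  · have hyS : y ∈ S := hb (by rwa [Metric.mem_ball, dist_eq_norm])
    rw [Metric.infDist_zero_of_mem hyS, sub_zero, Metric.le_infDist hne]
    intro w hw
    have hwb : ¬ dist w c < r := fun h => hw (hb h)
    have := dist_triangle_left w c y
    rw [dist_eq_norm y c] at this
    linarith
  · push Not at hy
    have hpos : 0 < ‖y - c‖ := hr.trans_le hy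
    have hz : c + (r / ‖y - c‖) • (y - c) ∈ closure S := by
      refine closure_mono hb ?_
      rw [closure_ball c hr.ne', Metric.mem_closedBall, dist_eq_norm, add_sub_cancel_left,
        norm_smul, Real.norm_of_nonneg (by positivity)]
      field_simp; exact le_refl _
    have h1 : Metric.infDist y S ≤ ‖y - c‖ - r := by
      rw [← Metric.infDist_closure]
      refine (Metric.infDist_le_dist_of_mem hz).trans (le_of_eq ?_)
      have : y - (c + (r / ‖y - c‖) • (y - c)) = (1 - r / ‖y - c‖) • (y - c) := by module
      rw [dist_eq_norm, this, norm_smul, Real.norm_of_nonneg]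
      · field_simp
      · rw [sub_nonneg, div_le_one hpos]; exact hy
    have h2 : 0 ≤ Metric.infDist y Sᶜ := Metric.infDist_nonneg
    linarith

/-- A ball in `S` puts a cone below the signed distance, and `(r - s)² ≥ 0` puts a paraboloid below
the cone. Applied to `Ω` and to its complement, it traps the signed distance between two paraboloids
touching at `x`. -/
theorem sq_lower_signedBdryDist {S : Set (Euc N)} {x ν : Euc N} {r : ℝ} (hr : 0 < r)
    (hν : ‖ν‖ = 1) (hb : Metric.ball (x - r • ν) r ⊆ S) (hne : Sᶜ.Nonempty) (y : Euc N) :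
    -inner ℝ ν (y - x) - ‖y - x‖ ^ 2 / (2 * r) ≤ signedBdryDist S y := by
  refine le_trans ?_ (le_signedBdryDist hr hb hne y)
  have h1 : y - (x - r • ν) = (y - x) + r • ν := by abel
  set s := ‖y - (x - r • ν)‖ with hs
  have h2 : s ^ 2 = ‖y - x‖ ^ 2 + 2 * r * inner ℝ ν (y - x) + r ^ 2 := by
    rw [hs, h1, norm_add_sq_real, inner_smul_right, norm_smul, hν, real_inner_comm]
    simp; ring
  have h3 : -inner ℝ ν (y - x) - ‖y - x‖ ^ 2 / (2 * r) = (r ^ 2 - s ^ 2) / (2 * r) := by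
    rw [h2]; field_simp; ring
  rw [h3, div_le_iff₀ (by positivity)]
  nlinarith [sq_nonneg (r - s)]

/-- The boundary of `Ω` has tangent interior and exterior balls of radius `ρ`, with common
unit normal `outwardNormal Ω`. -/
structure TangentBalls (Ω : Set (Euc N)) (ρ : ℝ) : Prop where
  pos : 0 < ρ
  isOpen : IsOpen Ω
  nonempty : Ω.Nonempty
  unit : ∀ b ∈ frontier Ω, ‖outwardNormal Ω b‖ = 1
  inner_ball : ∀ b ∈ frontier Ω, Metric.ball (b - ρ • outwardNormal Ω b) ρ ⊆ Ω
  outer_ball : ∀ b ∈ frontier Ω, Metric.ball (b + ρ • outwardNormal Ω b) ρ ⊆ (closure Ω)ᶜ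

/-- Two paraboloids with the same tangent plane squeeze the signed distance, so it is differentiable
at `x` with gradient `-ν`. -/
theorem outwardNormal_eq {Ω : Set (Euc N)} {x ν : Euc N} {ρ : ℝ} (hρ : 0 < ρ) (hν : ‖ν‖ = 1)
    (hne : Ω.Nonempty) (hxc : x ∉ Ω) (hi : Metric.ball (x - ρ • ν) ρ ⊆ Ω)
    (he : Metric.ball (x + ρ • ν) ρ ⊆ (closure Ω)ᶜ) : outwardNormal Ω x = ν := by
  have h1 := sq_lower_signedBdryDist hρ hν hi ⟨x, hxc⟩
  have h2 : ∀ y, signedBdryDist Ω y ≤ -inner ℝ ν (y - x) + ‖y - x‖ ^ 2 / (2 * ρ) := by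
    intro y
    have := sq_lower_signedBdryDist (S := Ωᶜ) (ν := -ν) (x := x) hρ (by simpa using hν)
      (by
        rw [smul_neg, sub_neg_eq_add]
        exact he.trans (compl_subset_compl.2 subset_closure)) (by simpa using hne) y
    rw [signedBdryDist_compl, inner_neg_left] at this
    linarith
  have h0 : signedBdryDist Ω x = 0 := by
    apply le_antisymm
    · simpa using h2 x
    · simpa using h1 x
  have hg : HasGradientAt (signedBdryDist Ω) (-ν) x := by
    rw [hasGradientAt_iff_isLittleO, h0]
    have hb : (fun y => signedBdryDist Ω y - 0 - inner ℝ (-ν) (y - x)) =O[𝓝 x]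
        fun y => ‖y - x‖ ^ 2 := by
      refine Asymptotics.IsBigO.of_bound (1 / (2 * ρ)) (Eventually.of_forall fun y => ?_)
      have e1 := h1 y
      have e2 := h2 y
      rw [inner_neg_left, Real.norm_eq_abs, Real.norm_of_nonneg (by positivity), abs_le,
        one_div_mul_eq_div]
      constructor <;> linarith
    refine hb.trans_isLittleO ?_
    have h3 : (fun y : Euc N => ‖y - x‖ ^ 2) =o[𝓝 x] fun y => ‖y - x‖ ^ 1 := by
      have ht : Tendsto (fun y : Euc N => y - x) (𝓝 x) (𝓝 0) := by
        have hc : Continuous fun y : Euc N => y - x := by fun_prop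
        simpa using hc.tendsto x
      exact (Asymptotics.isLittleO_norm_pow_norm_pow one_lt_two).comp_tendsto ht
    have h4 : (fun y : Euc N => ‖y - x‖ ^ 1) =O[𝓝 x] fun y => y - x := by
      simpa using (Asymptotics.isBigO_refl (fun y : Euc N => y - x) (𝓝 x)).norm_left
    exact h3.trans_isBigO h4
  rw [outwardNormal, hg.gradient, neg_neg]

theorem exists_tangentBalls {Ω : Set (Euc N)} (hΩ : IsC2Domain Ω)
    (hint : UniformInteriorBall Ω) (hext : UniformExteriorBall Ω) : ∃ ρ, TangentBalls Ω ρ := by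
  obtain ⟨r₁, hr₁, h₁⟩ := hint
  obtain ⟨r₂, hr₂, h₂⟩ := hext
  have hρ : 0 < min r₁ r₂ := lt_min hr₁ hr₂
  have key : ∀ b ∈ frontier Ω, ∃ ν : Euc N, ‖ν‖ = 1 ∧
      Metric.ball (b - min r₁ r₂ • ν) (min r₁ r₂) ⊆ Ω ∧
      Metric.ball (b + min r₁ r₂ • ν) (min r₁ r₂) ⊆ (closure Ω)ᶜ := by
    intro b hb
    obtain ⟨c, hc, hbc⟩ := h₁ b hb
    obtain ⟨c', hc', hbc'⟩ := h₂ b (frontier_subset_frontier_exterior hΩ hb)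
    obtain ⟨ν, hν, hνb⟩ := exists_unit_of_ball hρ (min_le_left _ _) hc hbc
    obtain ⟨ν', hν', hνb'⟩ := exists_unit_of_ball hρ (min_le_right _ _) hc' hbc'
    have hd := dist_ge_of_disjoint_ball hρ hρ
      (Set.disjoint_of_subset hνb hνb' (disjoint_compl_right.mono_left subset_closure))
    set ρ := min r₁ r₂
    have e1 : b - ρ • ν - (b - ρ • ν') = -(ρ • (ν - ν')) := by module
    rw [e1, norm_neg, norm_smul, Real.norm_of_nonneg hρ.le] at hd
    -- The two balls are disjoint, so their centres are at least `2ρ` apart; for unit vectors this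
    -- forces `ν' = -ν`, and the two balls share one normal.
    have h2 : 2 ≤ ‖ν - ν'‖ := by
      by_contra hlt
      push Not at hlt
      nlinarith
    have h3 := norm_sub_sq_real ν ν'
    have h4 := norm_add_sq_real ν ν'
    rw [hν, hν'] at h3 h4
    have h5 : ‖ν + ν'‖ ^ 2 ≤ 0 := by nlinarith
    have h6 : ν + ν' = 0 := by
      rw [← norm_eq_zero]
      exact pow_eq_zero_iff (two_ne_zero) |>.1 (le_antisymm h5 (sq_nonneg _))
    have h7 : ν' = -ν := (neg_eq_of_add_eq_zero_right h6).symm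
    refine ⟨ν, hν, hνb, ?_⟩
    rw [h7, smul_neg, sub_neg_eq_add] at hνb'
    exact hνb'
  have hn : ∀ b ∈ frontier Ω, b ∉ Ω := fun b hb => by
    rw [hΩ.isOpen.frontier_eq] at hb; exact hb.2
  refine ⟨min r₁ r₂, hρ, hΩ.isOpen, hΩ.isConnected.nonempty, ?_, ?_, ?_⟩ <;>
    intro b hb <;> obtain ⟨ν, hν, hi, he⟩ := key b hb <;>
    rw [outwardNormal_eq hρ hν hΩ.isConnected.nonempty (hn b hb) hi he] <;> assumption

theorem IsNearest.disjoint_ball {S : Set (Euc N)} {w y : Euc N} (hy : IsNearest S w y) :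
    Disjoint (Metric.ball w (dist w y)) S := by
  rw [hy.2]
  exact Metric.disjoint_ball_infDist

/-! ### Normals, nearest points and paths in a domain with tangent balls. -/

namespace TangentBalls

variable {Ω : Set (Euc N)} {ρ : ℝ} (hT : TangentBalls Ω ρ)
include hT

/-- The inner ball at each point is disjoint from the outer ball at the other. Adding the two
resulting lower bounds on distances of centres, the parallelogram law converts them into an upper
bound on the difference of the normals. -/
theorem normal_lipschitz {a b : Euc N} (ha : a ∈ frontier Ω) (hb : b ∈ frontier Ω) :
    ‖outwardNormal Ω a - outwardNormal Ω b‖ ≤ ‖a - b‖ / ρ := by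
  set n := outwardNormal Ω a with hn
  set k := outwardNormal Ω b with hk
  have hρ := hT.pos
  have hnu : ‖n‖ = 1 := hT.unit a ha
  have hku : ‖k‖ = 1 := hT.unit b hb
  have hdisj : Disjoint Ω (closure Ω)ᶜ := disjoint_compl_right.mono_left subset_closure
  have d1 := dist_ge_of_disjoint_ball hρ hρ
    (Set.disjoint_of_subset (hT.inner_ball a ha) (hT.outer_ball b hb) hdisj)
  have d2 := dist_ge_of_disjoint_ball hρ hρ
    (Set.disjoint_of_subset (hT.inner_ball b hb) (hT.outer_ball a ha) hdisj)
  have e1 : a - ρ • n - (b + ρ • k) = (a - b) - ρ • (n + k) := by module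
  have e2 : b - ρ • k - (a + ρ • n) = -((a - b) + ρ • (n + k)) := by module
  rw [e1] at d1
  rw [e2, norm_neg] at d2
  have q1 : (ρ + ρ) ^ 2 ≤ ‖(a - b) - ρ • (n + k)‖ ^ 2 := by gcongr
  have q2 : (ρ + ρ) ^ 2 ≤ ‖(a - b) + ρ • (n + k)‖ ^ 2 := by gcongr
  have p := parallelogram_law_with_norm ℝ (a - b) (ρ • (n + k))
  have p' := parallelogram_law_with_norm ℝ n k
  rw [norm_smul, Real.norm_of_nonneg hρ.le] at p
  rw [hnu, hku] at p'
  have hfin : (ρ * ‖n - k‖) ^ 2 ≤ ‖a - b‖ ^ 2 := by nlinarith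
  have := (sq_le_sq₀ (by positivity) (norm_nonneg _)).1 hfin
  rw [le_div_iff₀ hρ]; linarith

theorem continuousOn_normal : ContinuousOn (outwardNormal Ω) (frontier Ω) := by
  have : LipschitzOnWith (Real.toNNReal (1 / ρ)) (outwardNormal Ω) (frontier Ω) := by
    refine LipschitzOnWith.of_dist_le_mul fun a ha b hb => ?_
    rw [dist_eq_norm, dist_eq_norm, Real.coe_toNNReal _ (one_div_nonneg.2 hT.pos.le)]
    have := hT.normal_lipschitz ha hb
    rwa [one_div_mul_eq_div]
  exact this.continuousOn

theorem isNearest_projClosure (x : Euc N) : IsNearest (closure Ω) x (projClosure Ω x) := by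
  refine Classical.epsilon_spec (p := IsNearest (closure Ω) x) ?_
  obtain ⟨y, hy, h⟩ := isClosed_closure.exists_infDist_eq_dist hT.nonempty.closure x
  exact ⟨y, hy, h.symm⟩

theorem projClosure_mem (x : Euc N) : projClosure Ω x ∈ closure Ω := (hT.isNearest_projClosure x).1

/-- From an interior point one could step towards `w` and get closer. -/
theorem mem_frontier_of_isNearest {w y : Euc N} (hy : IsNearest (closure Ω) w y) (hwy : w ≠ y) :
    y ∈ frontier Ω := by
  rw [hT.isOpen.frontier_eq]
  refine ⟨hy.1, fun hyΩ => ?_⟩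
  have hc : Tendsto (fun s : ℝ => y + s • (w - y)) (𝓝[>] 0) (𝓝 y) := by
    have : ContinuousAt (fun s : ℝ => y + s • (w - y)) 0 := by fun_prop
    have h2 := this.tendsto
    simp only [zero_smul, add_zero] at h2
    exact h2.mono_left nhdsWithin_le_nhds
  have h1 : ∀ᶠ s : ℝ in 𝓝[>] 0, y + s • (w - y) ∈ Ω := hc.eventually (hT.isOpen.mem_nhds hyΩ)
  have h2 : ∀ᶠ s : ℝ in 𝓝[>] 0, s ∈ Ioo (0 : ℝ) 1 := Ioo_mem_nhdsGT one_pos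
  obtain ⟨s, hs, hs0, hs1⟩ := (h1.and h2).exists
  refine Set.disjoint_left.1 hy.disjoint_ball ?_ (subset_closure hs)
  have e : y + s • (w - y) - w = -((1 - s) • (w - y)) := by module
  rw [Metric.mem_ball, dist_eq_norm, dist_eq_norm, e, norm_neg, norm_smul,
    Real.norm_of_nonneg (by linarith)]
  have : 0 < ‖w - y‖ := norm_pos_iff.2 (sub_ne_zero.2 hwy)
  nlinarith

/-- The ball around `w` through `y` misses the inner ball at `y`, so the centres are at least `‖w -
y‖ + ρ` apart. This is the equality case of the triangle inequality, whence `w - y` points along the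
normal. -/
theorem sub_eq_of_isNearest {w y : Euc N} (hy : IsNearest (closure Ω) w y)
    (hyf : y ∈ frontier Ω) : w - y = ‖w - y‖ • outwardNormal Ω y := by
  by_cases hwy : w = y
  · simp [hwy]
  have ht : 0 < ‖w - y‖ := norm_pos_iff.2 (sub_ne_zero.2 hwy)
  set n := outwardNormal Ω y with hn
  have hnu : ‖n‖ = 1 := hT.unit y hyf
  have hρ := hT.pos
  have d := dist_ge_of_disjoint_ball (dist_pos.2 hwy) hρ
    (Set.disjoint_of_subset_right ((hT.inner_ball y hyf).trans subset_closure)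
      hy.disjoint_ball)
  rw [dist_eq_norm] at d
  set t := ‖w - y‖ with htdef
  have e1 : w - (y - ρ • n) = (w - y) + ρ • n := by module
  rw [e1] at d
  have q : (t + ρ) ^ 2 ≤ ‖(w - y) + ρ • n‖ ^ 2 := by gcongr
  rw [norm_add_sq_real, inner_smul_right, norm_smul, Real.norm_of_nonneg hρ.le, hnu] at q
  have q2 : t ≤ inner ℝ (w - y) n := by
    have : ρ * t ≤ ρ * inner ℝ (w - y) n := by nlinarith
    exact le_of_mul_le_mul_left this hρ
  have q3 := norm_sub_sq_real (w - y) (t • n)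
  rw [inner_smul_right, norm_smul, Real.norm_of_nonneg ht.le, hnu, ← htdef] at q3
  have q4 : ‖w - y - t • n‖ ^ 2 ≤ 0 := by nlinarith
  have q5 : ‖w - y - t • n‖ = 0 := pow_eq_zero_iff two_ne_zero |>.1 (le_antisymm q4 (sq_nonneg _))
  exact sub_eq_zero.1 (norm_eq_zero.1 q5)

/-- Any other nearest point must avoid the outer ball at `y`, whose centre lies on the normal beyond
`w` because `w` is closer than `ρ`; Cauchy–Schwarz is then an equality and gives the same point. -/
theorem isNearest_unique {w y y' : Euc N} (hlt : Metric.infDist w (closure Ω) < ρ)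
    (hy : IsNearest (closure Ω) w y) (hy' : IsNearest (closure Ω) w y') : y' = y := by
  have hd : ‖w - y'‖ = ‖w - y‖ := by rw [← dist_eq_norm, ← dist_eq_norm, hy.2, hy'.2]
  by_cases hwy : w = y
  · rw [hwy, sub_self, norm_zero, norm_eq_zero, sub_eq_zero] at hd
    exact hd.symm
  have hyf := hT.mem_frontier_of_isNearest hy hwy
  have hw := hT.sub_eq_of_isNearest hy hyf
  have hnu := hT.unit y hyf
  have ho := hT.outer_ball y hyf
  have htρ : ‖w - y‖ < ρ := by rw [← dist_eq_norm, hy.2]; exact hlt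
  set n := outwardNormal Ω y
  set t := ‖w - y‖ with ht
  have hn1 : ¬ dist y' (y + ρ • n) < ρ := fun h => ho h hy'.1
  have e : y' - (y + ρ • n) = -((w - y') + (ρ - t) • n) := by
    have : w = y + t • n := by rw [← hw]; abel
    rw [this]; module
  rw [dist_eq_norm, e, norm_neg, not_lt] at hn1
  have q : ρ ^ 2 ≤ ‖(w - y') + (ρ - t) • n‖ ^ 2 := by have := hT.pos; gcongr
  rw [norm_add_sq_real, inner_smul_right, norm_smul, Real.norm_of_nonneg (by linarith), hnu,
    hd] at q
  have q2 : t ≤ inner ℝ (w - y') n := by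
    have : (ρ - t) * t ≤ (ρ - t) * inner ℝ (w - y') n := by nlinarith
    exact le_of_mul_le_mul_left this (by linarith)
  have q3 := norm_sub_sq_real (w - y') (t • n)
  rw [inner_smul_right, norm_smul, Real.norm_of_nonneg (norm_nonneg _), hnu, hd] at q3
  have q4 : ‖w - y' - t • n‖ ^ 2 ≤ 0 := by
    have : 0 ≤ t := norm_nonneg _
    nlinarith
  have q5 : ‖w - y' - t • n‖ = 0 := pow_eq_zero_iff two_ne_zero |>.1 (le_antisymm q4 (sq_nonneg _))
  have q6 := sub_eq_zero.1 (norm_eq_zero.1 q5)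
  rw [← hw] at q6
  exact sub_right_injective q6

/-- The decomposition of a displacement `d` from `x` into the actual displacement and a
normal component. -/
theorem projClosure_add {x : Euc N} (hx : x ∈ closure Ω) (d : Euc N) :
    ∃ t : ℝ, 0 ≤ t ∧ t ≤ ‖d‖ ∧ ‖(x + d) - projClosure Ω (x + d)‖ = t ∧
      (t = 0 ∨ projClosure Ω (x + d) ∈ frontier Ω ∧
        ‖outwardNormal Ω (projClosure Ω (x + d))‖ = 1) ∧
      projClosure Ω (x + d) - x = d - t • outwardNormal Ω (projClosure Ω (x + d)) ∧
      ‖projClosure Ω (x + d) - x‖ ≤ 2 * ‖d‖ := by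
  have hnear := hT.isNearest_projClosure (x + d)
  set y := projClosure Ω (x + d)
  have htd : ‖x + d - y‖ ≤ ‖d‖ := by
    rw [← dist_eq_norm, hnear.2]
    refine (Metric.infDist_le_dist_of_mem hx).trans ?_
    simp [dist_eq_norm]
  refine ⟨‖x + d - y‖, norm_nonneg _, htd, rfl, ?_, ?_, ?_⟩
  · by_cases h : x + d = y
    · left; simp [h]
    · right
      have := hT.mem_frontier_of_isNearest hnear h
      exact ⟨this, hT.unit _ this⟩
  · by_cases h : x + d = y
    · rw [h, sub_self, norm_zero, zero_smul, ← h]; abel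
    · rw [← hT.sub_eq_of_isNearest hnear (hT.mem_frontier_of_isNearest hnear h)]; abel
  · have : y - x = d - (x + d - y) := by abel
    rw [this]
    exact (norm_sub_le _ _).trans (by linarith)

theorem existsUnique_isNearest {x d : Euc N} (hx : x ∈ closure Ω) (hd : ‖d‖ < ρ) :
    ∃! y, IsNearest (closure Ω) (x + d) y := by
  refine ⟨_, hT.isNearest_projClosure _, fun y' hy' =>
    hT.isNearest_unique ?_ (hT.isNearest_projClosure _) hy'⟩
  refine (Metric.infDist_le_dist_of_mem hx).trans_lt ?_
  simpa [dist_eq_norm] using hd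

/-- Points close to a boundary point `b` can be moved inwards along the normal at `b`. -/
theorem segment_inward {b x : Euc N} {τ : ℝ} (hb : b ∈ frontier Ω) (hx : x ∈ closure Ω)
    (hclose : ‖x - b‖ + τ < ρ) :
    ∀ s ∈ Icc 0 τ, x - s • outwardNormal Ω b ∈ closure Ω := by
  set k := outwardNormal Ω b with hk
  have hku : ‖k‖ = 1 := hT.unit b hb
  have hρ := hT.pos
  have hcont : Continuous fun s : ℝ => x - s • k := by fun_prop
  -- Continuous induction along the segment: the good parameters form a closed set, and from each of
  -- them one can advance a little further.
  refine IsClosed.Icc_subset_of_forall_exists_gt (a := 0) (b := τ)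
    (s := (fun s : ℝ => x - s • k) ⁻¹' closure Ω) ?_ (by simpa using hx) ?_
  · exact (isClosed_closure.preimage hcont).inter isClosed_Icc
  rintro s ⟨hs, hs0, hsτ⟩ u hu
  have hsu : s < u := hu
  have key : ∀ᶠ σ : ℝ in 𝓝[>] s, x - σ • k ∈ closure Ω := by
    by_cases hΩ : x - s • k ∈ Ω
    · have : ∀ᶠ σ : ℝ in 𝓝 s, x - σ • k ∈ Ω := hcont.continuousAt.eventually (hT.isOpen.mem_nhds hΩ)
      exact (this.filter_mono nhdsWithin_le_nhds).mono fun σ h => subset_closure h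
    · have hf : x - s • k ∈ frontier Ω := by rw [hT.isOpen.frontier_eq]; exact ⟨hs, hΩ⟩
      have hlip := hT.normal_lipschitz hf hb
      have hib := hT.inner_ball _ hf
      have hnu := hT.unit _ hf
      set y := x - s • k
      set n := outwardNormal Ω y
      have hyb : ‖y - b‖ < ρ := by
        have : y - b = (x - b) - s • k := by simp only [y]; abel
        rw [this]
        refine (norm_sub_le _ _).trans_lt ?_
        rw [norm_smul, hku, Real.norm_of_nonneg hs0]; linarith
      have hlt : ‖n - k‖ < 1 := hlip.trans_lt (by rw [div_lt_one hρ]; exact hyb)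
      -- The Lipschitz bound keeps the normal at `y` within distance `1` of the one at `b`, so
      -- moving along `-k` enters the inner ball at `y`.
      have hin : 0 < inner ℝ k n := by
        have := norm_sub_sq_real n k
        rw [hnu, hku, real_inner_comm] at this
        have h2 : ‖n - k‖ ^ 2 < 1 := by nlinarith [norm_nonneg (n - k)]
        linarith
      have hev : ∀ᶠ σ : ℝ in 𝓝[>] s, σ ∈ Ioo s (s + ρ * inner ℝ k n) :=
        Ioo_mem_nhdsGT (by nlinarith)
      filter_upwards [hev] with σ hσ
      refine subset_closure (hib ?_)
      have e : x - σ • k - (y - ρ • n) = ρ • n - (σ - s) • k := by simp only [y]; module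
      rw [Metric.mem_ball, dist_eq_norm, e]
      refine lt_of_pow_lt_pow_left₀ 2 hρ.le ?_
      rw [norm_sub_sq_real, norm_smul, norm_smul, hnu, hku, inner_smul_left, inner_smul_right,
        real_inner_comm, Real.norm_of_nonneg hρ.le, Real.norm_of_nonneg (by linarith [hσ.1])]
      simp only [conj_trivial]
      nlinarith [mul_pos (sub_pos.2 hσ.1) (mul_pos hρ hin),
        mul_lt_mul_of_pos_left (sub_lt_iff_lt_add'.2 hσ.2) (sub_pos.2 hσ.1)]
  obtain ⟨σ, hσ, hσ1⟩ := (key.and (Ioc_mem_nhdsGT hsu)).exists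
  exact ⟨σ, hσ, hσ1⟩

/-- Two close points of the closure of `Ω` are joined in it by three short segments. -/
theorem exists_short_path {x y : Euc N} (hx : x ∈ closure Ω) (hy : y ∈ closure Ω)
    (hxy : ‖y - x‖ ≤ ρ / 16) :
    ∃ a b : Euc N, segment ℝ x a ⊆ closure Ω ∧ segment ℝ a b ⊆ closure Ω ∧
      segment ℝ b y ⊆ closure Ω ∧ ‖a - x‖ ≤ 4 * ‖y - x‖ ∧ ‖b - a‖ ≤ ‖y - x‖ ∧
      ‖y - b‖ ≤ 4 * ‖y - x‖ := by
  have hρ := hT.pos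
  set s := ‖y - x‖ with hs
  have hs0 : 0 ≤ s := norm_nonneg _
  by_cases hseg : segment ℝ x y ⊆ closure Ω
  · exact ⟨x, y, by simpa using hx, hseg, by simpa using hy, by simpa using hs0, le_rfl,
      by simpa using hs0⟩
  obtain ⟨w, hw, hwc⟩ := Set.not_subset.1 hseg
  have hnear := hT.isNearest_projClosure w
  set b := projClosure Ω w with hbdef
  have hwb : w ≠ b := fun h => hwc (h ▸ hnear.1)
  have hbf := hT.mem_frontier_of_isNearest hnear hwb
  obtain ⟨θ, hθ, rfl⟩ : ∃ θ ∈ Icc (0 : ℝ) 1, x + θ • (y - x) = w := by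
    rw [segment_eq_image'] at hw; exact hw
  have hwx : ‖x + θ • (y - x) - x‖ ≤ s := by
    rw [add_sub_cancel_left, norm_smul, Real.norm_of_nonneg hθ.1]
    nlinarith [hθ.2]
  have hwbs : ‖x + θ • (y - x) - b‖ ≤ s := by
    rw [← dist_eq_norm, hnear.2]
    refine (Metric.infDist_le_dist_of_mem hx).trans ?_
    rw [dist_eq_norm]; exact hwx
  have hline : ∀ θ' ∈ Icc (0 : ℝ) 1, ‖x + θ' • (y - x) - b‖ ≤ 2 * s := by
    intro θ' hθ'
    have e : x + θ' • (y - x) - b = (x + θ • (y - x) - b) + (θ' - θ) • (y - x) := by module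
    rw [e]
    refine (norm_add_le _ _).trans ?_
    rw [norm_smul, Real.norm_eq_abs]
    have : |θ' - θ| ≤ 1 := by rw [abs_le]; constructor <;> linarith [hθ.1, hθ.2, hθ'.1, hθ'.2]
    nlinarith
  have hxb : ‖x - b‖ ≤ 2 * s := by simpa using hline 0 (by simp)
  have hyb : ‖y - b‖ ≤ 2 * s := by simpa using hline 1 (by simp)
  have hku := hT.unit b hbf
  have hib := hT.inner_ball b hbf
  have inward := fun {p : Euc N} (hp : p ∈ closure Ω) (hpb : ‖p - b‖ ≤ 2 * s) =>
    hT.segment_inward hbf hp (τ := 4 * s) (by linarith)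
  set k := outwardNormal Ω b with hk
  have hseg1 : ∀ p ∈ closure Ω, ‖p - b‖ ≤ 2 * s → segment ℝ p (p - (4 * s) • k) ⊆ closure Ω := by
    intro p hp hpb v hv
    rw [segment_eq_image'] at hv
    obtain ⟨θ', hθ', rfl⟩ := hv
    have e : p + θ' • (p - (4 * s) • k - p) = p - (θ' * (4 * s)) • k := by module
    simp only [e]
    refine inward hp hpb _ ⟨by have := hθ'.1; positivity, ?_⟩
    nlinarith [hθ'.2]
  have hspos : 0 < s := by
    rcases hs0.lt_or_eq with h | h
    · exact h
    · exfalso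
      have hyx : y = x := by rw [← sub_eq_zero, ← norm_eq_zero, ← hs, ← h]
      exact hseg (by rw [hyx]; simpa using hx)
  refine ⟨x - (4 * s) • k, y - (4 * s) • k, hseg1 x hx hxb, ?_, ?_, ?_, ?_, ?_⟩
  · intro v hv
    rw [segment_eq_image'] at hv
    obtain ⟨θ', hθ', rfl⟩ := hv
    have e : x - (4 * s) • k + θ' • (y - (4 * s) • k - (x - (4 * s) • k)) - (b - ρ • k)
        = (x + θ' • (y - x) - b) + (ρ - 4 * s) • k := by module
    refine subset_closure (hib ?_)
    rw [Metric.mem_ball, dist_eq_norm]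
    simp only [e]
    have hl := hline θ' hθ'
    refine (norm_add_le _ _).trans_lt ?_
    rw [norm_smul, hku, Real.norm_of_nonneg (by linarith)]
    linarith
  · rw [segment_symm]; exact hseg1 y hy hyb
  · have : x - (4 * s) • k - x = -((4 * s) • k) := by abel
    rw [this, norm_neg, norm_smul, hku, Real.norm_of_nonneg (by positivity), mul_one]
  · have : y - (4 * s) • k - (x - (4 * s) • k) = y - x := by abel
    rw [this]
  · have : y - (y - (4 * s) • k) = (4 * s) • k := by abel
    rw [this, norm_smul, hku, Real.norm_of_nonneg (by positivity), mul_one]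

end TangentBalls

end Geometry

/-! ### Max-min values -/

section SupInf

variable {A B : Type*} {Q : A → B → ℝ} {C t : ℝ}

theorem bddBelow_range_of_abs_le (hQ : ∀ a b, |Q a b| ≤ C) (a : A) : BddBelow (range (Q a)) :=
  ⟨-C, by rintro _ ⟨b, rfl⟩; exact (abs_le.1 (hQ a b)).1⟩

theorem bddAbove_range_iInf [Nonempty B] (hQ : ∀ a b, |Q a b| ≤ C) :
    BddAbove (range fun a => ⨅ b, Q a b) :=
  ⟨C, by
    rintro _ ⟨a, rfl⟩
    exact (ciInf_le (bddBelow_range_of_abs_le hQ a) (Classical.arbitrary B)).trans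
      (abs_le.1 (hQ a _)).2⟩

theorem supInf_le [Nonempty A] (hQ : ∀ a b, |Q a b| ≤ C) (h : ∀ a, ∃ b, Q a b ≤ t) :
    ⨆ a, ⨅ b, Q a b ≤ t :=
  ciSup_le fun a =>
    let ⟨b, hb⟩ := h a
    (ciInf_le (bddBelow_range_of_abs_le hQ a) b).trans hb

theorem le_supInf [Nonempty B] (hQ : ∀ a b, |Q a b| ≤ C) (h : ∃ a, ∀ b, t ≤ Q a b) :
    t ≤ ⨆ a, ⨅ b, Q a b :=
  let ⟨a, ha⟩ := h
  le_ciSup_of_le (bddAbove_range_iInf hQ) a (le_ciInf ha)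

theorem exists_of_lt_supInf [Nonempty A] (hQ : ∀ a b, |Q a b| ≤ C) (h : t < ⨆ a, ⨅ b, Q a b) :
    ∃ a, ∀ b, t < Q a b :=
  let ⟨a, ha⟩ := exists_lt_of_lt_ciSup h
  ⟨a, fun b => ha.trans_le (ciInf_le (bddBelow_range_of_abs_le hQ a) b)⟩

theorem exists_of_supInf_lt [Nonempty B] (hQ : ∀ a b, |Q a b| ≤ C) (h : ⨆ a, ⨅ b, Q a b < t) (a : A) :
    ∃ b, Q a b < t :=
  exists_lt_of_ciInf_lt ((le_ciSup (bddAbove_range_iInf hQ) a).trans_lt h)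

theorem supInf_le_add [Nonempty A] [Nonempty B] {Q' : A → B → ℝ} {C' τ : ℝ} (hQ : ∀ a b, |Q a b| ≤ C)
    (hQ' : ∀ a b, |Q' a b| ≤ C') (h : ∀ a b, Q a b ≤ Q' a b + τ) :
    ⨆ a, ⨅ b, Q a b ≤ (⨆ a, ⨅ b, Q' a b) + τ := by
  refine le_of_forall_pos_le_add fun ξ hξ => supInf_le hQ fun a => ?_
  obtain ⟨b, hb⟩ := exists_of_supInf_lt hQ'
    (show ⨆ a, ⨅ b, Q' a b < (⨆ a, ⨅ b, Q' a b) + ξ by linarith) a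
  exact ⟨b, by linarith [h a b]⟩

end SupInf

/-- A bound on a set that is improved by a fixed factor `ϑ < 1` at each iteration vanishes. -/
theorem le_of_contraction {X : Type*} {S : Set X} {g : X → ℝ} {ϑ B : ℝ} (h0 : 0 ≤ ϑ) (h1 : ϑ < 1)
    (hB : ∀ x ∈ S, g x ≤ B)
    (hstep : ∀ b : ℝ, 0 ≤ b → (∀ x ∈ S, g x ≤ b) → ∀ x ∈ S, g x ≤ ϑ * b) : ∀ x ∈ S, g x ≤ 0 := by
  have hn : ∀ n : ℕ, ∀ x ∈ S, g x ≤ ϑ ^ n * max B 0 := by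
    intro n
    induction n with
    | zero => intro x hx; simpa using Or.inl (hB x hx)
    | succ n ih =>
      intro x hx
      have := hstep _ (by positivity) ih x hx
      rwa [← mul_assoc, ← pow_succ'] at this
  intro x hx
  have ht : Tendsto (fun n : ℕ => ϑ ^ n * max B 0) atTop (𝓝 (0 * max B 0)) :=
    (tendsto_pow_atTop_nhds_zero_of_lt_one h0 h1).mul_const _
  rw [zero_mul] at ht
  exact ge_of_tendsto' ht fun n => hn n x hx

/-! ### The dynamic programming principle -/

namespace NeumannGame

variable {N : ℕ} (G : NeumannGame N) (ε : ℝ)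

theorem zero_mem_markMoves (hε : 0 < ε) : (0 : Euc N) ∈ G.markMoves ε := by
  simp only [markMoves, mem_ofPred_eq, norm_zero]; positivity

theorem zero_mem_helenMoves (hε : 0 < ε) : ((0 : Euc N), (0 : Op N)) ∈ G.helenMoves ε := by
  simp only [helenMoves, mem_ofPred_eq, norm_zero]
  exact ⟨by positivity, IsSelfAdjoint.zero (Op N), by positivity⟩

/-- The sequence with first term `a` followed by the terms of `m`. -/
def consMove {A : Type*} (a : A) (m : ℕ → A) : ℕ → A
  | 0 => a
  | j + 1 => m j

/-- The value of one round when the continuation value is `W`. -/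
def stage (W : Euc N → ℝ → ℝ) (x : Euc N) (z : ℝ) (c : Euc N × Op N) (d : Euc N) : ℝ :=
  if |(G.next ε (x, z) c d).2| < G.M then
    Real.exp (-G.lam * ε ^ 2) * W (G.next ε (x, z) c d).1 (G.next ε (x, z) c d).2
  else G.capped x z (G.next ε (x, z) c d).2

/-- After the first round the game restarts from the new position, with the strategy restricted to
histories beginning with Mark's first move. -/
theorem state_succ (s : Euc N × ℝ) (σ : G.Strategy ε) (m : ℕ → G.markMoves ε) (j : ℕ) :
    G.state ε s σ m (j + 1) = G.state ε (G.next ε s (σ []).1 (m 0).1)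
      (fun l => σ (m 0 :: l)) (fun i => m (i + 1)) j := by
  induction j with
  | zero => simp [state]
  | succ j ih =>
    rw [state, ih]
    conv_rhs => rw [state]
    rw [List.ofFn_succ]
    rfl

theorem payoff_of_capped {s : Euc N × ℝ} {σ : G.Strategy ε} {m : ℕ → G.markMoves ε}
    (h : ¬ |(G.next ε s (σ []).1 (m 0).1).2| < G.M) :
    G.payoff ε s σ m = G.capped s.1 s.2 (G.next ε s (σ []).1 (m 0).1).2 := by
  classical
  have h0 : G.M ≤ |(G.state ε s σ m (0 + 1)).2| := by
    simpa [state] using not_lt.1 h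
  have H : ∃ j : ℕ, G.M ≤ |(G.state ε s σ m (j + 1)).2| := ⟨0, h0⟩
  have hf : Nat.find H = 0 := (Nat.find_eq_zero H).2 h0
  rw [payoff, dif_pos H]
  rw [hf]
  simp [state]

/-- The stopping index seen from the next state is one less, which costs exactly one discount
factor; if the game never stops, both sides are zero. -/
theorem payoff_of_not_capped {s : Euc N × ℝ} {σ : G.Strategy ε} {m : ℕ → G.markMoves ε}
    (h : |(G.next ε s (σ []).1 (m 0).1).2| < G.M) :
    G.payoff ε s σ m = Real.exp (-G.lam * ε ^ 2) *
      G.payoff ε (G.next ε s (σ []).1 (m 0).1) (fun l => σ (m 0 :: l)) (fun i => m (i + 1)) := by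
  classical
  have h0 : ¬ G.M ≤ |(G.state ε s σ m (0 + 1)).2| := by
    simpa [state] using h
  by_cases H : ∃ j : ℕ, G.M ≤ |(G.state ε s σ m (j + 1)).2|
  · have H' : ∃ j : ℕ, G.M ≤ |(G.state ε (G.next ε s (σ []).1 (m 0).1)
      (fun l => σ (m 0 :: l)) (fun i => m (i + 1)) (j + 1)).2| := by
      obtain ⟨j, hj⟩ := H
      cases j with
      | zero => exact absurd hj h0
      | succ j => exact ⟨j, by rwa [state_succ] at hj⟩
    have hf : Nat.find H = Nat.find H' + 1 := by
      rw [Nat.find_eq_iff]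
      refine ⟨?_, ?_⟩
      · rw [state_succ]; exact Nat.find_spec H'
      · intro n hn
        cases n with
        | zero => exact h0
        | succ n => rw [state_succ]; exact Nat.find_min H' (by omega)
    rw [payoff, dif_pos H, payoff, dif_pos H', hf, state_succ, state_succ, ← mul_assoc,
      ← Real.exp_add]
    congr 2
    push_cast
    ring
  · have H' : ¬ ∃ j : ℕ, G.M ≤ |(G.state ε (G.next ε s (σ []).1 (m 0).1)
      (fun l => σ (m 0 :: l)) (fun i => m (i + 1)) (j + 1)).2| := by
      rintro ⟨j, hj⟩
      exact H ⟨j + 1, by rwa [state_succ]⟩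
    rw [payoff, dif_neg H, payoff, dif_neg H', mul_zero]

/-- The conditions on the game under which the dynamic programming principle holds. -/
structure Regular (Cχ : ℝ) : Prop where
  lam_pos : 0 < G.lam
  proj_mem : ∀ x, projClosure G.Ω x ∈ closure G.Ω
  chi_le : ∀ x ∈ closure G.Ω, |G.χ x| ≤ Cχ

namespace Regular

variable {G ε} {Cχ : ℝ} (hG : G.Regular Cχ)
include hG

theorem abs_capped_le {x : Euc N} (hx : x ∈ closure G.Ω) {z z' : ℝ} (hz : |z| < G.M) :
    |G.capped x z z'| ≤ G.M + Cχ := by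
  have h1 := abs_le.1 (hG.chi_le x hx)
  have h2 := abs_lt.1 hz
  unfold capped
  split_ifs <;> rw [abs_le] <;> constructor <;> linarith [h1.1, h1.2, h2.1, h2.2]

theorem exp_lt_one (hε : 0 < ε) : Real.exp (-G.lam * ε ^ 2) < 1 := by
  have := hG.lam_pos
  rw [Real.exp_lt_one_iff]
  have : 0 < G.lam * ε ^ 2 := by positivity
  linarith

theorem abs_payoff_le {s : Euc N × ℝ} (hs : s.1 ∈ closure G.Ω) (hz : |s.2| < G.M)
    (σ : G.Strategy ε) (m : ℕ → G.markMoves ε) : |G.payoff ε s σ m| ≤ G.M + Cχ := by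
  classical
  have hpos : ∀ j, (G.state ε s σ m j).1 ∈ closure G.Ω := by
    intro j
    cases j with
    | zero => exact hs
    | succ j => exact hG.proj_mem _
  rw [payoff]
  split_ifs with H
  · have hzk : |(G.state ε s σ m (Nat.find H)).2| < G.M := by
      rcases hk : Nat.find H with _ | k
      · exact hz
      · exact not_le.1 (Nat.find_min H (m := k) (by omega))
    rw [abs_mul, abs_of_pos (Real.exp_pos _)]
    refine (mul_le_of_le_one_left (abs_nonneg _) ?_).trans (hG.abs_capped_le (hpos _) hzk)
    rw [Real.exp_le_one_iff]
    have := hG.lam_pos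
    have : 0 ≤ (Nat.find H : ℝ) * G.lam * ε ^ 2 := by positivity
    linarith
  · simpa using (abs_nonneg _).trans (hG.abs_capped_le hs hz (z' := 0))

theorem abs_U_le (hε : 0 < ε) {x : Euc N} (hx : x ∈ closure G.Ω) {z : ℝ} (hz : |z| < G.M) :
    |G.U ε x z| ≤ G.M + Cχ := by
  have : Nonempty (G.markMoves ε) := ⟨⟨0, G.zero_mem_markMoves ε hε⟩⟩
  have : Nonempty (G.helenMoves ε) := ⟨⟨_, G.zero_mem_helenMoves ε hε⟩⟩
  rw [U, if_pos hz]
  have hb := fun (σ : G.Strategy ε) (m : ℕ → G.markMoves ε) =>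
    hG.abs_payoff_le (s := (x, z)) hx hz σ m
  rw [abs_le]
  exact ⟨le_supInf hb ⟨Classical.arbitrary _, fun m => (abs_le.1 (hb _ m)).1⟩,
    supInf_le hb fun σ => ⟨Classical.arbitrary _, (abs_le.1 (hb σ _)).2⟩⟩

theorem abs_stage_le (hε : 0 < ε) {W : Euc N → ℝ → ℝ} {B : ℝ}
    (hW : ∀ x ∈ closure G.Ω, ∀ z : ℝ, |z| < G.M → |W x z| ≤ B)
    {x : Euc N} (hx : x ∈ closure G.Ω) {z : ℝ} (hz : |z| < G.M) (c : Euc N × Op N) (d : Euc N) :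
    |G.stage ε W x z c d| ≤ max B (G.M + Cχ) := by
  unfold stage
  split_ifs with h
  · rw [abs_mul, abs_of_pos (Real.exp_pos _)]
    exact (mul_le_of_le_one_left (abs_nonneg _) (hG.exp_lt_one hε).le).trans
      ((hW _ (hG.proj_mem _) _ h).trans (le_max_left _ _))
  · exact (hG.abs_capped_le hx hz).trans (le_max_right _ _)

theorem abs_stage_U_le (hε : 0 < ε)
    {x : Euc N} (hx : x ∈ closure G.Ω) {z : ℝ} (hz : |z| < G.M) (c : Euc N × Op N) (d : Euc N) :
    |G.stage ε (G.U ε) x z c d| ≤ max (G.M + Cχ) (G.M + Cχ) :=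
  hG.abs_stage_le hε (fun _ hx _ hz => hG.abs_U_le hε hx hz) hx hz c d

/-- For `≤`, the tail of a strategy after Mark's move `d` is a strategy from the next state. For
`≥`, nearly optimal strategies for all possible next states are glued into one. -/
theorem U_eq (hε : 0 < ε) {x : Euc N} (hx : x ∈ closure G.Ω) {z : ℝ} (hz : |z| < G.M) :
    G.U ε x z = ⨆ c : G.helenMoves ε, ⨅ d : G.markMoves ε, G.stage ε (G.U ε) x z c d := by
  have : Nonempty (G.markMoves ε) := ⟨⟨0, G.zero_mem_markMoves ε hε⟩⟩
  have : Nonempty (G.helenMoves ε) := ⟨⟨_, G.zero_mem_helenMoves ε hε⟩⟩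
  have hb := fun (σ : G.Strategy ε) (m : ℕ → G.markMoves ε) =>
    hG.abs_payoff_le (s := (x, z)) hx hz σ m
  have hQ := fun (c : G.helenMoves ε) (d : G.markMoves ε) =>
    hG.abs_stage_U_le hε hx hz c.1 d.1
  have hb' := fun (c : Euc N × Op N) (d : Euc N) (h : |(G.next ε (x, z) c d).2| < G.M)
    (σ : G.Strategy ε) (m : ℕ → G.markMoves ε) =>
    hG.abs_payoff_le (s := G.next ε (x, z) c d) (hG.proj_mem _) h σ m
  apply le_antisymm
  · conv_lhs => rw [U, if_pos hz]
    refine ciSup_le fun σ => ?_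
    refine le_trans ?_ (le_ciSup (bddAbove_range_iInf hQ) (σ []))
    refine le_ciInf fun d => ?_
    unfold stage
    split_ifs with h
    · rw [U, if_pos h, ← div_le_iff₀' (Real.exp_pos _)]
      refine le_ciSup_of_le (bddAbove_range_iInf (hb' _ _ h)) (fun l => σ (d :: l)) ?_
      refine le_ciInf fun m => ?_
      rw [div_le_iff₀' (Real.exp_pos _)]
      have hp := G.payoff_of_not_capped ε (s := (x, z)) (σ := σ) (m := consMove d m) h
      exact (ciInf_le (bddBelow_range_of_abs_le hb σ) (consMove d m)).trans_eq hp
    · have hp := G.payoff_of_capped ε (s := (x, z)) (σ := σ) (m := fun _ => d) h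
      exact (ciInf_le (bddBelow_range_of_abs_le hb σ) (fun _ => d)).trans_eq hp
  · refine le_of_forall_pos_le_add fun τ hτ => ?_
    refine ciSup_le fun c => ?_
    have hch : ∀ d : G.markMoves ε, ∃ σ : G.Strategy ε, |(G.next ε (x, z) c d).2| < G.M →
        ∀ m, G.U ε (G.next ε (x, z) c d).1 (G.next ε (x, z) c d).2 - τ ≤
          G.payoff ε (G.next ε (x, z) c d) σ m := by
      intro d
      by_cases h : |(G.next ε (x, z) c d).2| < G.M
      · have hlt : G.U ε (G.next ε (x, z) c d).1 (G.next ε (x, z) c d).2 - τ <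
            ⨆ σ : G.Strategy ε, ⨅ m : ℕ → G.markMoves ε,
              G.payoff ε (G.next ε (x, z) c d) σ m := by
          conv_lhs => rw [U, if_pos h]
          linarith
        obtain ⟨σ, hσ⟩ := exists_of_lt_supInf (hb' _ _ h) hlt
        exact ⟨σ, fun _ m => (hσ m).le⟩
      · exact ⟨Classical.arbitrary _, fun h' => absurd h' h⟩
    choose σ hσ using hch
    -- Play `c` on the empty history, then follow the continuation selected for Mark's first move.
    let σ' : G.Strategy ε := fun l => List.casesOn l c fun d l => σ d l
    have h1 : (⨅ d : G.markMoves ε, G.stage ε (G.U ε) x z c d) - τ ≤ G.U ε x z := by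
      rw [U, if_pos hz]
      refine le_supInf hb ⟨σ', fun m => ?_⟩
      have hi := ciInf_le (bddBelow_range_of_abs_le hQ c) (m 0)
      have hst : G.stage ε (G.U ε) x z c (m 0) - τ ≤ G.payoff ε (x, z) σ' m := by
        unfold stage
        split_ifs with h
        · rw [G.payoff_of_not_capped ε (s := (x, z)) (σ := σ') (m := m) h]
          have h2 := hσ (m 0) h (fun i => m (i + 1))
          have h3 := mul_le_mul_of_nonneg_left h2 (Real.exp_pos (-G.lam * ε ^ 2)).le
          have h4 := (hG.exp_lt_one hε).le
          refine le_trans ?_ h3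
          nlinarith
        · rw [G.payoff_of_capped ε (s := (x, z)) (σ := σ') (m := m) h]
          simp only [σ']
          linarith
      linarith
    linarith

/-- The capped payoffs do not involve the unknown function, so two bounded solutions differ only
through the discounted branch and their distance contracts. -/
theorem U_unique (hε : 0 < ε) {W : Euc N → ℝ → ℝ} (hWb : G.BoundedValue W)
    (hW : G.SolvesDPP ε W) :
    ∀ x ∈ closure G.Ω, ∀ z : ℝ, |z| < G.M → W x z = G.U ε x z := by
  have : Nonempty (G.markMoves ε) := ⟨⟨0, G.zero_mem_markMoves ε hε⟩⟩
  have : Nonempty (G.helenMoves ε) := ⟨⟨_, G.zero_mem_helenMoves ε hε⟩⟩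
  obtain ⟨B, hB⟩ := hWb
  have key : ∀ y ∈ {y : Euc N × ℝ | y.1 ∈ closure G.Ω ∧ |y.2| < G.M},
      |W y.1 y.2 - G.U ε y.1 y.2| ≤ 0 := by
    refine le_of_contraction (Real.exp_pos _).le (hG.exp_lt_one hε) (B := B + (G.M + Cχ)) ?_ ?_
    · rintro ⟨x, z⟩ ⟨hx, hz⟩
      exact (abs_sub _ _).trans (add_le_add (hB x hx z hz) (hG.abs_U_le hε hx hz))
    · rintro b hb0 hb ⟨x, z⟩ ⟨hx, hz⟩
      have hs : ∀ (c : G.helenMoves ε) (d : G.markMoves ε),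
          |G.stage ε W x z c d - G.stage ε (G.U ε) x z c d| ≤ Real.exp (-G.lam * ε ^ 2) * b := by
        intro c d
        unfold stage
        split_ifs with h
        · rw [← mul_sub, abs_mul, abs_of_pos (Real.exp_pos _)]
          exact mul_le_mul_of_nonneg_left (hb (G.next ε (x, z) c d) ⟨hG.proj_mem _, h⟩)
            (Real.exp_pos _).le
        · simp only [sub_self, abs_zero]; positivity
      have hQ := fun (c : G.helenMoves ε) (d : G.markMoves ε) =>
        hG.abs_stage_U_le hε hx hz c.1 d.1
      have hQ' := fun (c : G.helenMoves ε) (d : G.markMoves ε) =>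
        hG.abs_stage_le hε hB hx hz c.1 d.1
      have e1 := hW x hx z hz
      have e2 := hG.U_eq hε hx hz
      change W x z = ⨆ c : G.helenMoves ε, ⨅ d : G.markMoves ε, G.stage ε W x z c d at e1
      simp only
      rw [e1, e2, abs_sub_le_iff]
      constructor
      · have := supInf_le_add hQ' hQ (τ := Real.exp (-G.lam * ε ^ 2) * b) fun c d => by
          linarith [(abs_le.1 (hs c d)).2]
        linarith
      · have := supInf_le_add hQ hQ' (τ := Real.exp (-G.lam * ε ^ 2) * b) fun c d => by
          linarith [(abs_le.1 (hs c d)).1]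
        linarith
  intro x hx z hz
  exact sub_eq_zero.1 (abs_eq_zero.1 (le_antisymm (key (x, z) ⟨hx, hz⟩) (abs_nonneg _)))

/-- If Mark can always make `z - χ(x)` grow at the discount rate, the value is negative
when `z > χ(x)`. -/
theorem U_le_of_barrier (hε : 0 < ε) (hχ : ∀ x ∈ closure G.Ω, 0 ≤ G.χ x)
    (hbar : ∀ x ∈ closure G.Ω, ∀ z : ℝ, |z| < G.M → ∀ c ∈ G.helenMoves ε, ∃ d ∈ G.markMoves ε,
      Real.exp (G.lam * ε ^ 2) * (z - G.χ x) ≤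
        (G.next ε (x, z) c d).2 - G.χ (G.next ε (x, z) c d).1)
    {x : Euc N} (hx : x ∈ closure G.Ω) {z : ℝ} (hz : |z| < G.M) (hzχ : G.χ x < z) :
    G.U ε x z ≤ G.χ x - z := by
  have : Nonempty (G.markMoves ε) := ⟨⟨0, G.zero_mem_markMoves ε hε⟩⟩
  have : Nonempty (G.helenMoves ε) := ⟨⟨_, G.zero_mem_helenMoves ε hε⟩⟩
  have key : ∀ y ∈ {y : Euc N × ℝ | y.1 ∈ closure G.Ω ∧ |y.2| < G.M ∧ G.χ y.1 < y.2},
      G.U ε y.1 y.2 - (G.χ y.1 - y.2) ≤ 0 := by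
    -- The excess of `U` over `χ - z` contracts by the discount: the barrier hypothesis keeps the
    -- state in the region `χ < z`, and since `χ ≥ 0` neither stopping payoff exceeds `χ - z`.
    refine le_of_contraction (Real.exp_pos _).le (hG.exp_lt_one hε)
      (B := (G.M + Cχ) + (Cχ + G.M)) ?_ ?_
    · rintro ⟨x, z⟩ ⟨hx, hz, -⟩
      have h1 := (abs_le.1 (hG.abs_U_le hε hx hz)).2
      have h2 := (abs_le.1 (hG.chi_le x hx)).1
      have h3 := (abs_lt.1 hz).2
      simp only
      linarith
    · rintro b hb0 hb ⟨x, z⟩ ⟨hx, hz, hzχ⟩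
      simp only at hx hz hzχ ⊢
      rw [sub_le_iff_le_add, hG.U_eq hε hx hz]
      refine supInf_le (fun c d => hG.abs_stage_U_le hε hx hz c.1 d.1) fun c => ?_
      obtain ⟨d, hd, hcd⟩ := hbar x hx z hz c.1 c.2
      have he : 0 < Real.exp (-G.lam * ε ^ 2) := Real.exp_pos _
      have he1 : Real.exp (-G.lam * ε ^ 2) * Real.exp (G.lam * ε ^ 2) = 1 := by
        rw [← Real.exp_add]; simp
      refine ⟨⟨d, hd⟩, ?_⟩
      unfold stage
      split_ifs with h
      · have hpos : G.χ (G.next ε (x, z) c d).1 < (G.next ε (x, z) c d).2 := by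
          have : 0 < Real.exp (G.lam * ε ^ 2) * (z - G.χ x) :=
            mul_pos (Real.exp_pos _) (by linarith)
          linarith
        have h1 := hb (G.next ε (x, z) c d) ⟨hG.proj_mem _, h, hpos⟩
        have h2 := mul_le_mul_of_nonneg_left h1 he.le
        have h3 := mul_le_mul_of_nonneg_left hcd he.le
        rw [← mul_assoc, he1, one_mul] at h3
        linarith
      · have := hχ x hx
        have hp : 0 ≤ Real.exp (-G.lam * ε ^ 2) * b := by positivity
        unfold capped
        split_ifs <;> linarith
  have := key (x, z) ⟨hx, hz, hzχ⟩
  simp only at this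
  linarith

/-- If Helen can always make `-z - χ(x)` grow at the discount rate, the value is positive
when `z < -χ(x)`. -/
theorem le_U_of_barrier (hε : 0 < ε) (hχ : ∀ x ∈ closure G.Ω, 0 ≤ G.χ x)
    (hbar : ∀ x ∈ closure G.Ω, ∀ z : ℝ, |z| < G.M → ∃ c ∈ G.helenMoves ε, ∀ d ∈ G.markMoves ε,
      (G.next ε (x, z) c d).2 + G.χ (G.next ε (x, z) c d).1 ≤
        Real.exp (G.lam * ε ^ 2) * (z + G.χ x))
    {x : Euc N} (hx : x ∈ closure G.Ω) {z : ℝ} (hz : |z| < G.M) (hzχ : z < -G.χ x) :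
    -G.χ x - z ≤ G.U ε x z := by
  have : Nonempty (G.markMoves ε) := ⟨⟨0, G.zero_mem_markMoves ε hε⟩⟩
  have : Nonempty (G.helenMoves ε) := ⟨⟨_, G.zero_mem_helenMoves ε hε⟩⟩
  have key : ∀ y ∈ {y : Euc N × ℝ | y.1 ∈ closure G.Ω ∧ |y.2| < G.M ∧ y.2 < -G.χ y.1},
      (-G.χ y.1 - y.2) - G.U ε y.1 y.2 ≤ 0 := by
    refine le_of_contraction (Real.exp_pos _).le (hG.exp_lt_one hε)
      (B := (G.M + Cχ) + (Cχ + G.M)) ?_ ?_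
    · rintro ⟨x, z⟩ ⟨hx, hz, -⟩
      have h1 := (abs_le.1 (hG.abs_U_le hε hx hz)).1
      have h2 := (abs_le.1 (hG.chi_le x hx)).1
      have h3 := (abs_lt.1 hz).1
      simp only
      linarith
    · rintro b hb0 hb ⟨x, z⟩ ⟨hx, hz, hzχ⟩
      simp only at hx hz hzχ ⊢
      rw [sub_le_comm, hG.U_eq hε hx hz]
      obtain ⟨c, hc, hcd⟩ := hbar x hx z hz
      refine le_supInf (fun c d => hG.abs_stage_U_le hε hx hz c.1 d.1) ⟨⟨c, hc⟩, fun d => ?_⟩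
      replace hcd := hcd d.1 d.2
      have he : 0 < Real.exp (-G.lam * ε ^ 2) := Real.exp_pos _
      have he1 : Real.exp (-G.lam * ε ^ 2) * Real.exp (G.lam * ε ^ 2) = 1 := by
        rw [← Real.exp_add]; simp
      unfold stage
      simp only
      split_ifs with h
      · have hpos : (G.next ε (x, z) c d).2 < -G.χ (G.next ε (x, z) c d).1 := by
          have : Real.exp (G.lam * ε ^ 2) * (z + G.χ x) < 0 :=
            mul_neg_of_pos_of_neg (Real.exp_pos _) (by linarith)
          linarith
        have h1 := hb (G.next ε (x, z) c d) ⟨hG.proj_mem _, h, hpos⟩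
        have h2 := mul_le_mul_of_nonneg_left h1 he.le
        have h3 := mul_le_mul_of_nonneg_left hcd he.le
        rw [← mul_assoc, he1, one_mul] at h3
        linarith
      · have := hχ x hx
        have hp : 0 ≤ Real.exp (-G.lam * ε ^ 2) * b := by positivity
        unfold capped
        split_ifs <;> linarith
  have := key (x, z) ⟨hx, hz, hzχ⟩
  simp only at this
  linarith

end Regular

end NeumannGame

/-! ### One round of the game for small `ε` -/

theorem eventually_mul_rpow_le {a b : ℝ} (hab : b < a) (K : ℝ) {η : ℝ} (hη : 0 < η) :
    ∀ᶠ ε in 𝓝[>] (0 : ℝ), K * ε ^ a ≤ η * ε ^ b := by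
  have h1 : Tendsto (fun ε : ℝ => K * ε ^ (a - b)) (𝓝[>] 0) (𝓝 (K * 0 ^ (a - b))) :=
    ((Real.continuousAt_rpow_const 0 (a - b) (Or.inr (sub_pos.2 hab).le)).tendsto.mono_left
      nhdsWithin_le_nhds).const_mul K
  rw [Real.zero_rpow (sub_pos.2 hab).ne', mul_zero] at h1
  filter_upwards [h1.eventually (gt_mem_nhds hη), self_mem_nhdsWithin] with ε hε hpos
  have hpos' : (0 : ℝ) < ε := hpos
  have h2 : ε ^ a = ε ^ (a - b) * ε ^ b := by rw [← Real.rpow_add hpos']; ring_nf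
  rw [h2, ← mul_assoc]
  exact mul_le_mul_of_nonneg_right hε.le (Real.rpow_nonneg hpos'.le _)

theorem eventually_mul_rpow_le_const {a : ℝ} (ha : 0 < a) (K : ℝ) {η : ℝ} (hη : 0 < η) :
    ∀ᶠ ε in 𝓝[>] (0 : ℝ), K * ε ^ a ≤ η := by
  simpa using eventually_mul_rpow_le ha K hη

theorem eventually_pos_lt_one : ∀ᶠ ε in 𝓝[>] (0 : ℝ), 0 < ε ∧ ε < 1 :=
  Ioo_mem_nhdsGT one_pos

/-- Compactness of the unit sphere, nonempty because the dimension is positive. The maximiser serves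
as a top eigenvector. -/
theorem exists_max_quadratic {N : ℕ} (hN : 0 < N) (A : Op N) :
    ∃ v : Euc N, ‖v‖ = 1 ∧ ∀ w, inner ℝ (A w) w ≤ inner ℝ (A v) v * ‖w‖ ^ 2 := by
  have hne : (Metric.sphere (0 : Euc N) 1).Nonempty :=
    ⟨EuclideanSpace.single ⟨0, hN⟩ 1, by simp⟩
  have hc : ContinuousOn (fun v : Euc N => inner ℝ (A v) v) (Metric.sphere 0 1) := by fun_prop
  obtain ⟨v, hv, hmax⟩ := (isCompact_sphere (0 : Euc N) 1).exists_isMaxOn hne hc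
  refine ⟨v, by simpa using hv, fun w => ?_⟩
  by_cases hw : w = 0
  · simp [hw]
  have hwn : ‖w‖ ≠ 0 := norm_ne_zero_iff.2 hw
  have h1 : inner ℝ (A (‖w‖⁻¹ • w)) (‖w‖⁻¹ • w) ≤ inner ℝ (A v) v :=
    hmax (show ‖w‖⁻¹ • w ∈ Metric.sphere (0 : Euc N) 1 by
      rw [mem_sphere_zero_iff_norm, norm_smul, norm_inv, norm_norm, inv_mul_cancel₀ hwn])
  rw [map_smul, inner_smul_left, inner_smul_right] at h1
  simp only [conj_trivial] at h1
  have h2 : 0 < ‖w‖ := norm_pos_iff.2 hw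
  calc inner ℝ (A w) w = (‖w‖⁻¹ * (‖w‖⁻¹ * inner ℝ (A w) w)) * ‖w‖ ^ 2 := by field_simp
    _ ≤ _ := mul_le_mul_of_nonneg_right h1 (by positivity)

theorem abs_quadratic_le {N : ℕ} (A : Op N) (w : Euc N) : |inner ℝ (A w) w| ≤ ‖A‖ * ‖w‖ ^ 2 := by
  refine (abs_real_inner_le_norm _ _).trans ?_
  have := mul_le_mul_of_nonneg_right (A.le_opNorm w) (norm_nonneg w)
  rw [pow_two, ← mul_assoc]; exact this

theorem isSelfAdjoint_iff_inner {N : ℕ} {A : Op N} :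
    IsSelfAdjoint A ↔ ∀ v w, inner ℝ (A v) w = inner ℝ v (A w) :=
  ContinuousLinearMap.isSelfAdjoint_iff_isSymmetric

theorem isSelfAdjoint_smul_one {N : ℕ} (c : ℝ) : IsSelfAdjoint (c • (1 : Op N)) := by
  rw [isSelfAdjoint_iff_inner]
  intro v w
  simp [inner_smul_left, inner_smul_right]

theorem isSelfAdjoint_add {N : ℕ} {A B : Op N} (hA : IsSelfAdjoint A) (hB : IsSelfAdjoint B) :
    IsSelfAdjoint (A + B) := by
  rw [isSelfAdjoint_iff_inner] at *
  intro v w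
  simp [inner_add_left, inner_add_right, hA, hB]

theorem isSelfAdjoint_sub {N : ℕ} {A B : Op N} (hA : IsSelfAdjoint A) (hB : IsSelfAdjoint B) :
    IsSelfAdjoint (A - B) := by
  rw [isSelfAdjoint_iff_inner] at *
  intro v w
  simp [inner_sub_left, inner_sub_right, hA, hB]

theorem norm_smul_one_le {N : ℕ} {c : ℝ} (hc : 0 ≤ c) : ‖c • (1 : Op N)‖ ≤ c := by
  rw [norm_smul, Real.norm_of_nonneg hc]
  exact mul_le_of_le_one_right hc ContinuousLinearMap.norm_id_le

theorem smul_one_quadratic {N : ℕ} (c : ℝ) (w : Euc N) :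
    inner ℝ ((c • (1 : Op N)) w) w = c * ‖w‖ ^ 2 := by
  simp [inner_smul_left]

theorem NonlinearityHyp.antitone {N : ℕ} {Ω : Set (Euc N)} {f : Euc N → ℝ → Euc N → Op N → ℝ}
    {lam q r : ℝ} (hf : NonlinearityHyp Ω f lam q r) {x : Euc N} (hx : x ∈ closure Ω) (z : ℝ)
    (p : Euc N) {Γ Y : Op N} (hΓ : IsSelfAdjoint Γ) (hY : IsSelfAdjoint Y)
    (hle : ∀ w, inner ℝ (Γ w) w ≤ inner ℝ (Y w) w) : f x z p Y ≤ f x z p Γ := by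
  have hp : (Y - Γ).IsPositive := by
    rw [ContinuousLinearMap.isPositive_def]
    refine ⟨ContinuousLinearMap.isSelfAdjoint_iff_isSymmetric.1 (isSelfAdjoint_sub hY hΓ), fun w => ?_⟩
    rw [ContinuousLinearMap.reApplyInnerSelf_apply]
    simp only [RCLike.re_to_real, sub_apply, inner_sub_left]
    linarith [hle w]
  have := hf.elliptic x hx z p Γ (Y - Γ) hΓ hp
  rwa [add_sub_cancel] at this

/-! ### Mark's answers to Helen's moves and the size of the loss. -/

namespace NeumannGame

variable {N : ℕ}

/-- The standing assumptions on the data of the game. -/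
structure Setting (G : NeumannGame N) (q r ρ H : ℝ) : Prop where
  dim_pos : 0 < N
  balls : TangentBalls G.Ω ρ
  nonlin : NonlinearityHyp G.Ω G.f G.lam q r
  lam_pos : 0 < G.lam
  one_le_q : 1 ≤ q
  one_le_r : 1 ≤ r
  h_cont : ContinuousOn G.h (frontier G.Ω)
  h_le : ∀ x ∈ frontier G.Ω, |G.h x| ≤ H
  H_nonneg : 0 ≤ H
  α_pos : 0 < G.α
  β_pos : 0 < G.β
  γ_pos : 0 < G.γ
  α_lt : G.α < 1 / 3
  αβ : G.α + G.β < 1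
  αγ : 2 * G.α + G.γ < 2
  βq : G.β * q < 2
  γr : G.γ * r < 2
  γα : G.γ < 1 - G.α
  βq' : G.β * (q - 1) < G.α + 1
  γr' : G.γ * (r - 1) < 2 * G.α
  γr'' : G.γ * r < 1 + G.α

namespace Setting

variable {G : NeumannGame N} {q r ρ H : ℝ} (hG : G.Setting q r ρ H)
include hG

/-- A large eigenvalue of Helen's matrix yields a second order gain that dominates `ε² f`. -/
theorem eventually_second_order_gain {C C₀ K θ : ℝ} (hC : 0 ≤ C) (hC₀ : 0 ≤ C₀) (hθ : 0 < θ) :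
    ∀ᶠ ε in 𝓝[>] (0 : ℝ), ∀ s μ : ℝ, 0 ≤ s → s ≤ C₀ + θ → θ < μ →
      μ ≤ (1 + C₀) * ε ^ (-G.γ) →
      ε ^ 2 * K + ε ^ 2 * (C * (1 + s ^ q + (C₀ + μ) ^ r)) ≤ 1 / 2 * (μ * ε ^ (2 - 2 * G.α)) := by
  have hα := hG.α_pos
  have hq := hG.one_le_q
  have hr := hG.one_le_r
  filter_upwards [eventually_pos_lt_one,
    eventually_mul_rpow_le (a := 2) (b := 2 - 2 * G.α) (by linarith)
      (K + C * (1 + (C₀ + θ) ^ q)) (show 0 < θ / 4 by positivity),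
    eventually_mul_rpow_le (a := 2 - G.γ * (r - 1)) (b := 2 - 2 * G.α) (by linarith [hG.γr'])
      (C * ((C₀ / θ + 1) ^ r * (1 + C₀) ^ (r - 1))) (show (0 : ℝ) < 1 / 4 by norm_num)]
    with ε ⟨hε, hε1⟩ e1 e2 s μ hs0 hs hθμ hμ
  rw [Real.rpow_two] at e1
  have hμ0 : 0 < μ := hθ.trans hθμ
  have hB0 : 0 < 1 + C₀ := by linarith
  have hA0 : 0 < C₀ / θ + 1 := by positivity
  have hpq : s ^ q ≤ (C₀ + θ) ^ q := Real.rpow_le_rpow hs0 hs (by linarith)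
  -- One factor `μ` is kept, and the remaining `μ^(r-1)` is at most a constant times `ε^(-γ(r-1))`.
  -- The condition `γ(r-1) < 2α` then makes this term small against the gain `μ ε^(2-2α)`.
  have hμr : (C₀ + μ) ^ r ≤
      (C₀ / θ + 1) ^ r * (1 + C₀) ^ (r - 1) * (ε ^ (-G.γ)) ^ (r - 1) * μ := by
    have h3 : C₀ + μ ≤ (C₀ / θ + 1) * μ := by
      have : C₀ ≤ C₀ / θ * μ := by
        rw [div_mul_eq_mul_div, le_div_iff₀ hθ]; nlinarith
      linarith
    have h4 : μ ^ (r - 1) ≤ ((1 + C₀) * ε ^ (-G.γ)) ^ (r - 1) :=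
      Real.rpow_le_rpow hμ0.le hμ (by linarith)
    rw [Real.mul_rpow hB0.le (Real.rpow_nonneg hε.le _)] at h4
    calc (C₀ + μ) ^ r ≤ ((C₀ / θ + 1) * μ) ^ r :=
          Real.rpow_le_rpow (by linarith) h3 (by linarith)
      _ = (C₀ / θ + 1) ^ r * (μ ^ (r - 1) * μ) := by
        rw [Real.mul_rpow hA0.le hμ0.le, ← Real.rpow_add_one hμ0.ne']; ring_nf
      _ ≤ (C₀ / θ + 1) ^ r * (((1 + C₀) ^ (r - 1) * (ε ^ (-G.γ)) ^ (r - 1)) * μ) := by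
        refine mul_le_mul_of_nonneg_left (mul_le_mul_of_nonneg_right h4 hμ0.le) ?_
        exact Real.rpow_nonneg hA0.le _
      _ = _ := by ring
  have hεr : ε ^ 2 * (ε ^ (-G.γ)) ^ (r - 1) = ε ^ (2 - G.γ * (r - 1)) := by
    rw [← Real.rpow_mul hε.le, ← Real.rpow_two, ← Real.rpow_add hε]; ring_nf
  have h5 : ε ^ 2 * (C * (1 + s ^ q + (C₀ + μ) ^ r)) ≤ ε ^ 2 * (C * (1 + (C₀ + θ) ^ q)) +
      C * ((C₀ / θ + 1) ^ r * (1 + C₀) ^ (r - 1)) * ε ^ (2 - G.γ * (r - 1)) * μ := by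
    rw [← hεr]
    calc ε ^ 2 * (C * (1 + s ^ q + (C₀ + μ) ^ r)) ≤ ε ^ 2 * (C * (1 + (C₀ + θ) ^ q +
            (C₀ / θ + 1) ^ r * (1 + C₀) ^ (r - 1) * (ε ^ (-G.γ)) ^ (r - 1) * μ)) :=
          mul_le_mul_of_nonneg_left (mul_le_mul_of_nonneg_left (by linarith) hC) (sq_nonneg _)
      _ = _ := by ring
  have h6 := mul_le_mul_of_nonneg_right e2 hμ0.le
  have h7 : θ * ε ^ (2 - 2 * G.α) ≤ μ * ε ^ (2 - 2 * G.α) :=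
    mul_le_mul_of_nonneg_right hθμ.le (Real.rpow_nonneg hε.le _)
  linarith

/-- A wrong slope of Helen yields a first order gain that dominates the other terms. -/
theorem eventually_first_order_gain {C C₀ K θ : ℝ} (hC : 0 ≤ C) (hC₀ : 0 ≤ C₀) (hθ : 0 < θ) :
    ∀ᶠ ε in 𝓝[>] (0 : ℝ), ∀ s a μ : ℝ, 0 ≤ s → s ≤ C₀ + a → s ≤ ε ^ (-G.β) → θ < a → 0 ≤ μ →
      μ ≤ (1 + C₀ + θ) * ε ^ (-G.γ) →
      ε ^ 2 * K + 1 / 2 * ((1 + C₀) * ε ^ (-G.γ) * ε ^ (2 - 2 * G.α)) +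
        ε ^ 2 * (C * (1 + s ^ q + (C₀ + μ) ^ r)) ≤ ε ^ (1 - G.α) * a := by
  have hα := hG.α_pos
  have hγ := hG.γ_pos
  have hq := hG.one_le_q
  have hr := hG.one_le_r
  -- The four exponents exceed `1 - α`, by `γ < 1 - α`, `α > 0`, `β(q-1) < 1 + α` and `γr < 1 + α`.
  -- They belong to the quadratic term, the bounded part of `f`, its growth in `p` and its growth in
  -- `Γ`.
  filter_upwards [eventually_pos_lt_one,
    eventually_mul_rpow_le (a := 2 - 2 * G.α - G.γ) (b := 1 - G.α) (by linarith [hG.γα])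
      (1 / 2 * (1 + C₀)) (show 0 < θ / 8 by positivity),
    eventually_mul_rpow_le (a := 2) (b := 1 - G.α) (by linarith)
      (C + K) (show 0 < θ / 8 by positivity),
    eventually_mul_rpow_le (a := 2 - G.β * (q - 1)) (b := 1 - G.α) (by linarith [hG.βq'])
      (C * (C₀ / θ + 1)) (show (0 : ℝ) < 1 / 8 by norm_num),
    eventually_mul_rpow_le (a := 2 - G.γ * r) (b := 1 - G.α) (by linarith [hG.γr''])
      (C * (C₀ + (1 + C₀ + θ)) ^ r) (show 0 < θ / 8 by positivity)]
    with ε ⟨hε, hε1⟩ e3 e4 e5 e6 s a μ hs0 hs hsβ hθa hμ0 hμ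
  rw [Real.rpow_two] at e4
  have ha0 : 0 < a := hθ.trans hθa
  have hεγ : 1 ≤ ε ^ (-G.γ) := Real.one_le_rpow_of_pos_of_le_one_of_nonpos hε hε1.le (by linarith)
  have hpA : s ≤ (C₀ / θ + 1) * a := by
    have : C₀ ≤ C₀ / θ * a := by
      rw [div_mul_eq_mul_div, le_div_iff₀ hθ]; nlinarith
    linarith
  have hpq : s ^ q ≤ (C₀ / θ + 1) * a * (ε ^ (-G.β)) ^ (q - 1) := by
    rcases hs0.eq_or_lt with h0 | h0
    · rw [← h0, Real.zero_rpow (by linarith)]; positivity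
    · have : s ^ q = s * s ^ (q - 1) := by
        rw [mul_comm, ← Real.rpow_add_one h0.ne']; ring_nf
      rw [this]
      exact mul_le_mul hpA (Real.rpow_le_rpow hs0 hsβ (by linarith))
        (Real.rpow_nonneg hs0 _) (hs0.trans hpA)
  have hμr : (C₀ + μ) ^ r ≤ (C₀ + (1 + C₀ + θ)) ^ r * (ε ^ (-G.γ)) ^ r := by
    rw [← Real.mul_rpow (by positivity) (by positivity)]
    refine Real.rpow_le_rpow (by linarith) ?_ (by linarith)
    nlinarith
  have hεr : ε ^ 2 * (ε ^ (-G.γ)) ^ r = ε ^ (2 - G.γ * r) := by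
    rw [← Real.rpow_mul hε.le, ← Real.rpow_two, ← Real.rpow_add hε]; ring_nf
  have hεq : ε ^ 2 * (ε ^ (-G.β)) ^ (q - 1) = ε ^ (2 - G.β * (q - 1)) := by
    rw [← Real.rpow_mul hε.le, ← Real.rpow_two, ← Real.rpow_add hε]; ring_nf
  have hεγα : ε ^ (-G.γ) * ε ^ (2 - 2 * G.α) = ε ^ (2 - 2 * G.α - G.γ) := by
    rw [← Real.rpow_add hε]; ring_nf
  have h5 : ε ^ 2 * (C * (1 + s ^ q + (C₀ + μ) ^ r)) ≤
      ε ^ 2 * C + C * (C₀ / θ + 1) * ε ^ (2 - G.β * (q - 1)) * a +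
        C * (C₀ + (1 + C₀ + θ)) ^ r * ε ^ (2 - G.γ * r) := by
    rw [← hεr, ← hεq]
    calc ε ^ 2 * (C * (1 + s ^ q + (C₀ + μ) ^ r)) ≤
        ε ^ 2 * (C * (1 + (C₀ / θ + 1) * a * (ε ^ (-G.β)) ^ (q - 1) +
          (C₀ + (1 + C₀ + θ)) ^ r * (ε ^ (-G.γ)) ^ r)) :=
          mul_le_mul_of_nonneg_left (mul_le_mul_of_nonneg_left (by linarith) hC) (sq_nonneg _)
      _ = _ := by ring
  have h6 := mul_le_mul_of_nonneg_right e5 ha0.le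
  have h7 : θ * ε ^ (1 - G.α) ≤ a * ε ^ (1 - G.α) :=
    mul_le_mul_of_nonneg_right hθa.le (Real.rpow_nonneg hε.le _)
  have h8 : 0 ≤ a * ε ^ (1 - G.α) := mul_nonneg ha0.le (Real.rpow_nonneg hε.le _)
  rw [mul_assoc (1 + C₀), hεγα]
  linarith

/-- Lower bound for `f` at Helen's choice in terms of the largest eigenvalue of `Γ - X`. -/
theorem exists_eigenvector {x : Euc N} (hx : x ∈ closure G.Ω) (z : ℝ) (p : Euc N) {X Γ : Op N}
    (hX : IsSelfAdjoint X) (hΓ : IsSelfAdjoint Γ) :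
    ∃ v : Euc N, ‖v‖ = 1 ∧ inner ℝ ((Γ - X) v) v ≤ ‖Γ - X‖ ∧
      ∀ μ : ℝ, inner ℝ ((Γ - X) v) v ≤ μ → G.f x z p (X + μ • (1 : Op N)) ≤ G.f x z p Γ := by
  obtain ⟨v, hv, hmax⟩ := exists_max_quadratic hG.dim_pos (Γ - X)
  refine ⟨v, hv, ?_, fun μ h1 => ?_⟩
  · have := (le_abs_self _).trans (abs_quadratic_le (Γ - X) v)
    rwa [hv, one_pow, mul_one] at this
  · refine hG.nonlin.antitone hx z p hΓ (isSelfAdjoint_add hX (isSelfAdjoint_smul_one μ))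
      fun w => ?_
    have h2 := hmax w
    rw [add_apply, inner_add_left, smul_one_quadratic]
    rw [sub_apply, inner_sub_left] at h2
    have := mul_le_mul_of_nonneg_right h1 (sq_nonneg ‖w‖)
    linarith

/-- Mark has an answer to any choice `(p, Γ)` of Helen which is, up to an error, at least as good
for him as if she had chosen `(P, X)`. -/
theorem mark_response (L : ℝ) {C₀ θ : ℝ} (hC₀ : 0 ≤ C₀) (hθ : 0 < θ) :
    ∀ᶠ ε in 𝓝[>] (0 : ℝ), ∀ x ∈ closure G.Ω, ∀ z : ℝ, |z| ≤ L →
      ∀ (P : Euc N) (X : Op N), ‖P‖ ≤ C₀ → IsSelfAdjoint X → ‖X‖ ≤ C₀ →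
      ∀ c ∈ G.helenMoves ε, ∃ d ∈ G.markMoves ε, ∃ p' : Euc N, ‖p' - P‖ ≤ θ ∧
        ε ^ 2 * G.f x z p' (X + θ • (1 : Op N)) ≤
          inner ℝ (c.1 - P) d + 1 / 2 * inner ℝ ((c.2 - X) d) d + ε ^ 2 * G.f x z c.1 c.2 := by
  obtain ⟨C, hC, hgrow⟩ := hG.nonlin.growth L
  have hγ := hG.γ_pos
  have hq := hG.one_le_q
  have hr := hG.one_le_r
  filter_upwards [eventually_pos_lt_one,
    hG.eventually_second_order_gain (K := C * (1 + C₀ ^ q + (C₀ + θ) ^ r)) hC hC₀ hθ,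
    hG.eventually_first_order_gain (K := C * (1 + C₀ ^ q + (C₀ + θ) ^ r)) hC hC₀ hθ]
    with ε ⟨hε, hε1⟩ gain₂ gain₁
  rintro x hx z hz P X hP hX hXn ⟨p, Γ⟩ ⟨hp, hΓ, hΓn⟩
  simp only at hp hΓ hΓn ⊢
  have hεγ : 1 ≤ ε ^ (-G.γ) := Real.one_le_rpow_of_pos_of_le_one_of_nonpos hε hε1.le (by linarith)
  have hε2 : (0 : ℝ) ≤ ε ^ 2 := sq_nonneg ε
  have hnorm : ∀ μ : ℝ, 0 ≤ μ → ‖X + μ • (1 : Op N)‖ ≤ C₀ + μ := fun μ hμ =>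
    (norm_add_le _ _).trans (add_le_add hXn (norm_smul_one_le hμ))
  have hsa : ∀ μ : ℝ, IsSelfAdjoint (X + μ • (1 : Op N)) := fun μ =>
    isSelfAdjoint_add hX (isSelfAdjoint_smul_one μ)
  -- When Mark moves, the comparison slope is `P` itself, so the target is at most a constant times
  -- `ε²` and any dominating gain suffices.
  have htarget : ε ^ 2 * G.f x z P (X + θ • (1 : Op N)) ≤
      ε ^ 2 * (C * (1 + C₀ ^ q + (C₀ + θ) ^ r)) := by
    refine mul_le_mul_of_nonneg_left ((le_abs_self _).trans
      ((hgrow x hx z P _ (hsa θ) hz).trans (mul_le_mul_of_nonneg_left ?_ hC))) hε2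
    have h1 := Real.rpow_le_rpow (norm_nonneg _) hP (show 0 ≤ q by linarith)
    have h2 := Real.rpow_le_rpow (norm_nonneg _) (hnorm θ hθ.le) (show 0 ≤ r by linarith)
    linarith
  obtain ⟨v, hv, hμle, hlow⟩ := hG.exists_eigenvector hx z p hX hΓ
  have hΓX : ‖Γ - X‖ ≤ (1 + C₀) * ε ^ (-G.γ) := by
    refine (norm_sub_le _ _).trans ?_
    nlinarith
  have hlow' : ∀ μ : ℝ, inner ℝ ((Γ - X) v) v ≤ μ → 0 ≤ μ →
      ε ^ 2 * -(C * (1 + ‖p‖ ^ q + (C₀ + μ) ^ r)) ≤ ε ^ 2 * G.f x z p Γ := by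
    intro μ h1 h2
    refine mul_le_mul_of_nonneg_left (le_trans ?_ (hlow μ h1)) hε2
    have h3 := hgrow x hx z p _ (hsa μ) hz
    have h5 := mul_le_mul_of_nonneg_left
      (Real.rpow_le_rpow (norm_nonneg _) (hnorm μ h2) (show 0 ≤ r by linarith)) hC
    have := neg_abs_le (G.f x z p (X + μ • (1 : Op N)))
    linarith
  generalize hμdef : inner ℝ ((Γ - X) v) v = μ at hμle hlow hlow'
  have hsq : (ε ^ (1 - G.α)) ^ 2 = ε ^ (2 - 2 * G.α) := by
    rw [← Real.rpow_natCast, ← Real.rpow_mul hε.le]; congr 1; push_cast; ring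
  have hmove : 0 < ε ^ (1 - G.α) := Real.rpow_pos_of_pos hε _
  -- Three cases. If slope and top eigenvalue are nearly right, Mark stays put and ellipticity
  -- concludes. If only the eigenvalue is too large, he moves at full length along its direction. If
  -- the slope is wrong, he moves at full length along `p - P`.
  rcases le_or_gt ‖p - P‖ θ with hpP | hpP
  · rcases le_or_gt μ θ with hμθ | hμθ
    · refine ⟨0, G.zero_mem_markMoves ε hε, p, hpP, ?_⟩
      simp only [inner_zero_right, map_zero, mul_zero, zero_add]
      exact mul_le_mul_of_nonneg_left (hlow θ hμθ) hε2
    -- The sign makes the first order term nonnegative and leaves the quadratic term unchanged.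
    · obtain ⟨s, hs, hsin⟩ : ∃ s : ℝ, s ^ 2 = 1 ∧ 0 ≤ s * inner ℝ (p - P) v := by
        rcases le_total 0 (inner ℝ (p - P) v) with h | h
        · exact ⟨1, by norm_num, by linarith⟩
        · exact ⟨-1, by norm_num, by linarith⟩
      have hs1 : |s| = 1 := by rw [← sq_eq_sq₀ (abs_nonneg _) zero_le_one, sq_abs, hs, one_pow]
      refine ⟨(s * ε ^ (1 - G.α)) • v, ?_, P, by simpa using hθ.le, htarget.trans ?_⟩
      · simp only [markMoves, mem_ofPred_eq]
        rw [norm_smul, hv, norm_mul, Real.norm_eq_abs, hs1, Real.norm_of_nonneg hmove.le]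
        simp
      rw [map_smul, inner_smul_right, inner_smul_left, inner_smul_right, hμdef]
      simp only [conj_trivial]
      have hfin : 1 / 2 * (s * ε ^ (1 - G.α) * (s * ε ^ (1 - G.α) * μ))
          = 1 / 2 * (μ * ε ^ (2 - 2 * G.α)) := by
        rw [← hsq]; linear_combination (1 / 2 * μ * (ε ^ (1 - G.α)) ^ 2) * hs
      rw [hfin]
      have hpn : ‖p‖ ≤ C₀ + θ := by
        have := norm_add_le (p - P) P
        rw [sub_add_cancel] at this; linarith
      have h1 := gain₂ ‖p‖ μ (norm_nonneg _) hpn hμθ (hμle.trans hΓX)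
      have h2 := hlow' μ le_rfl (hθ.trans hμθ).le
      have h8 : 0 ≤ s * ε ^ (1 - G.α) * inner ℝ (p - P) v := by
        have := mul_nonneg hmove.le hsin; linarith
      linarith
  · have ha0 : 0 < ‖p - P‖ := hθ.trans hpP
    have hdn : ‖(ε ^ (1 - G.α) / ‖p - P‖) • (p - P)‖ = ε ^ (1 - G.α) := by
      rw [norm_smul, Real.norm_of_nonneg (by positivity)]; field_simp
    refine ⟨(ε ^ (1 - G.α) / ‖p - P‖) • (p - P), hdn.le, P, by simpa using hθ.le,
      htarget.trans ?_⟩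
    have hi : inner ℝ (p - P) ((ε ^ (1 - G.α) / ‖p - P‖) • (p - P)) = ε ^ (1 - G.α) * ‖p - P‖ := by
      rw [inner_smul_right, real_inner_self_eq_norm_sq]; field_simp
    rw [hi]
    generalize (ε ^ (1 - G.α) / ‖p - P‖) • (p - P) = d at hdn
    have h1 := neg_abs_le (inner ℝ ((Γ - X) d) d)
    have h2 := abs_quadratic_le (Γ - X) d
    rw [hdn, hsq] at h2
    have h3 : ‖Γ - X‖ * ε ^ (2 - 2 * G.α) ≤ (1 + C₀) * ε ^ (-G.γ) * ε ^ (2 - 2 * G.α) :=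
      mul_le_mul_of_nonneg_right hΓX (Real.rpow_nonneg hε.le _)
    -- The top eigenvalue may be negative here, while the lower bound on `f` needs a nonnegative
    -- parameter.
    have hμ0 : 0 ≤ max μ θ := hθ.le.trans (le_max_right _ _)
    have hμ' : max μ θ ≤ (1 + C₀ + θ) * ε ^ (-G.γ) := by
      refine max_le (hμle.trans (hΓX.trans ?_)) ?_ <;> nlinarith
    have h4 := hlow' (max μ θ) (le_max_left _ _) hμ0
    have hpA : ‖p‖ ≤ C₀ + ‖p - P‖ := by
      have h5 := norm_add_le (p - P) P
      rw [sub_add_cancel] at h5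
      linarith
    have h5 := gain₁ ‖p‖ ‖p - P‖ (max μ θ) (norm_nonneg _) hpA hp hpP hμ0 hμ'
    linarith

/-- The loss in one round tends to zero with `ε`. -/
theorem abs_loss_le (L : ℝ) {τ : ℝ} (hτ : 0 < τ) :
    ∀ᶠ ε in 𝓝[>] (0 : ℝ), ∀ x ∈ closure G.Ω, ∀ z : ℝ, |z| ≤ L →
      ∀ c ∈ G.helenMoves ε, ∀ d ∈ G.markMoves ε, |G.loss ε x z c d| ≤ τ := by
  obtain ⟨C, hC, hgrow⟩ := hG.nonlin.growth L
  have hq := hG.one_le_q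
  have hr := hG.one_le_r
  have hα := hG.α_pos
  have hα3 := hG.α_lt
  have hH := hG.H_nonneg
  -- The exponents of the two displacement terms, of the three parts of the bound on `f` and of the
  -- coupon; they are positive because `α + β < 1`, `2α + γ < 2`, `βq < 2`, `γr < 2` and `α < 1`.
  filter_upwards [eventually_pos_lt_one,
    eventually_mul_rpow_le_const (a := 1 - G.α - G.β) (by linarith [hG.αβ]) 1
      (show 0 < τ / 6 by positivity),
    eventually_mul_rpow_le_const (a := 2 - 2 * G.α - G.γ) (by linarith [hG.αγ]) 1
      (show 0 < τ / 6 by positivity),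
    eventually_mul_rpow_le_const (a := 2) two_pos C (show 0 < τ / 6 by positivity),
    eventually_mul_rpow_le_const (a := 2 - G.β * q) (by linarith [hG.βq]) C
      (show 0 < τ / 6 by positivity),
    eventually_mul_rpow_le_const (a := 2 - G.γ * r) (by linarith [hG.γr]) C
      (show 0 < τ / 6 by positivity),
    eventually_mul_rpow_le_const (a := 1 - G.α) (by linarith) H
      (show 0 < τ / 6 by positivity)]
    with ε ⟨hε, hε1⟩ e1 e2 e3 e4 e5 e6
  rintro x hx z hz ⟨p, Γ⟩ ⟨hp, hΓ, hΓn⟩ d hd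
  simp only at hp hΓ hΓn
  have hd' : ‖d‖ ≤ ε ^ (1 - G.α) := hd
  rw [Real.rpow_two] at e3
  obtain ⟨t, ht0, htd, hteq, htf, -, -⟩ := hG.balls.projClosure_add hx d
  have b1 : |inner ℝ p d| ≤ τ / 6 := by
    refine (abs_real_inner_le_norm _ _).trans (le_trans ?_ e1)
    have : ε ^ (1 - G.α - G.β) = ε ^ (-G.β) * ε ^ (1 - G.α) := by
      rw [← Real.rpow_add hε]; ring_nf
    rw [this, one_mul]; gcongr
  have b2 : |inner ℝ (Γ d) d| ≤ τ / 6 := by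
    refine (abs_quadratic_le _ _).trans (le_trans ?_ e2)
    have : ε ^ (2 - 2 * G.α - G.γ) = ε ^ (-G.γ) * (ε ^ (1 - G.α)) ^ 2 := by
      rw [← Real.rpow_natCast, ← Real.rpow_mul hε.le, ← Real.rpow_add hε]; push_cast; ring_nf
    rw [this, one_mul]; gcongr
  have b3 : |ε ^ 2 * G.f x z p Γ| ≤ τ / 6 + τ / 6 + τ / 6 := by
    rw [abs_mul, abs_of_nonneg (by positivity)]
    have h1 : ‖p‖ ^ q ≤ (ε ^ (-G.β)) ^ q := by gcongr
    have h2 : ‖Γ‖ ^ r ≤ (ε ^ (-G.γ)) ^ r := by gcongr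
    have hεr : ε ^ 2 * (ε ^ (-G.γ)) ^ r = ε ^ (2 - G.γ * r) := by
      rw [← Real.rpow_mul hε.le, ← Real.rpow_two, ← Real.rpow_add hε]; ring_nf
    have hεq : ε ^ 2 * (ε ^ (-G.β)) ^ q = ε ^ (2 - G.β * q) := by
      rw [← Real.rpow_mul hε.le, ← Real.rpow_two, ← Real.rpow_add hε]; ring_nf
    rw [← hεr] at e5
    rw [← hεq] at e4
    calc ε ^ 2 * |G.f x z p Γ| ≤ ε ^ 2 * (C * (1 + ‖p‖ ^ q + ‖Γ‖ ^ r)) := by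
          gcongr; exact hgrow x hx z p Γ hΓ hz
      _ ≤ ε ^ 2 * (C * (1 + (ε ^ (-G.β)) ^ q + (ε ^ (-G.γ)) ^ r)) := by gcongr
      _ = C * ε ^ 2 + C * (ε ^ 2 * (ε ^ (-G.β)) ^ q) + C * (ε ^ 2 * (ε ^ (-G.γ)) ^ r) := by ring
      _ ≤ _ := by linarith
  have b4 : |t * G.h (projClosure G.Ω (x + d))| ≤ τ / 6 := by
    rcases htf with h | ⟨h, -⟩
    · rw [h, zero_mul, abs_zero]; positivity
    · rw [abs_mul, abs_of_nonneg ht0]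
      refine le_trans ?_ e6
      rw [mul_comm]
      gcongr
      · exact hG.h_le _ h
      · linarith
  simp only [loss, hteq]
  rw [abs_le] at b1 b2 b3 b4 ⊢
  constructor <;> linarith [b1.1, b1.2, b2.1, b2.2, b3.1, b3.2, b4.1, b4.2]

end Setting

end NeumannGame

/-! ### Test functions -/

section Smooth

variable {N : ℕ}

/-- The Riesz isomorphism as a real linear map. -/
def dualToVec (N : ℕ) : (Euc N →L[ℝ] ℝ) →L[ℝ] Euc N :=
  LinearMap.toContinuousLinearMap
    { toFun := fun l => (InnerProductSpace.toDual ℝ (Euc N)).symm l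
      map_add' := fun l l' => map_add _ l l'
      map_smul' := fun c l => by simp }

theorem gradient_eq_dualToVec (φ : Euc N → ℝ) :
    gradient φ = fun x => dualToVec N (fderiv ℝ φ x) := rfl

theorem contDiff_gradient {φ : Euc N → ℝ} (hφ : ContDiff ℝ ∞ φ) : ContDiff ℝ ∞ (gradient φ) := by
  rw [gradient_eq_dualToVec]
  exact (dualToVec N).contDiff.comp (hφ.fderiv_right (m := ∞) (by simp))

theorem contDiff_hess {φ : Euc N → ℝ} (hφ : ContDiff ℝ ∞ φ) : ContDiff ℝ ∞ (hess φ) :=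
  (contDiff_gradient hφ).fderiv_right (m := ∞) (by simp)

theorem hasFDerivAt_inner_gradient {φ : Euc N → ℝ} {x : Euc N} (h : DifferentiableAt ℝ φ x) :
    HasFDerivAt φ (innerSL ℝ (gradient φ x)) x := by
  refine h.hasFDerivAt.congr_fderiv (ContinuousLinearMap.ext fun v => ?_)
  change fderiv ℝ φ x v = inner ℝ (gradient φ x) v
  exact inner_gradient_left.symm

theorem hasFDerivAt_gradient {φ : Euc N → ℝ} (hφ : ContDiff ℝ ∞ φ) (x : Euc N) :
    HasFDerivAt (gradient φ) (hess φ x) x :=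
  ((contDiff_gradient hφ).differentiable (by simp) x).hasFDerivAt

theorem isSelfAdjoint_hess {φ : Euc N → ℝ} (hφ : ContDiff ℝ ∞ φ) (x : Euc N) :
    IsSelfAdjoint (hess φ x) := by
  have hd : DifferentiableAt ℝ (fderiv ℝ φ) x :=
    (hφ.fderiv_right (m := ∞) (by simp)).differentiable (by simp) x
  have he : hess φ x = (dualToVec N).comp (fderiv ℝ (fderiv ℝ φ) x) := by
    have := ((dualToVec N).hasFDerivAt (x := fderiv ℝ φ x)).comp x hd.hasFDerivAt
    exact this.fderiv
  have hin : ∀ v w, inner ℝ (hess φ x v) w = fderiv ℝ (fderiv ℝ φ) x v w := by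
    intro v w
    rw [he]
    exact InnerProductSpace.toDual_symm_apply
  have hs : IsSymmSndFDerivAt ℝ φ x := (contDiff_infty.1 hφ 2).contDiffAt.isSymmSndFDerivAt (by simp)
  rw [isSelfAdjoint_iff_inner]
  intro v w
  rw [hin, real_inner_comm, hin]
  exact hs v w

/-- Second order Taylor expansion, uniformly near a point. -/
theorem exists_taylor_bound {φ : Euc N → ℝ} (hφ : ContDiff ℝ ∞ φ) (x₀ : Euc N) :
    ∃ C : ℝ, 0 ≤ C ∧ ∀ x ∈ Metric.closedBall x₀ 1, ‖gradient φ x‖ ≤ C ∧ ‖hess φ x‖ ≤ C ∧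
      ∀ y ∈ Metric.closedBall x₀ 1,
        |φ y - φ x - inner ℝ (gradient φ x) (y - x)
          - 1 / 2 * inner ℝ (hess φ x (y - x)) (y - x)| ≤ C * ‖y - x‖ ^ 3 := by
  have hK := isCompact_closedBall x₀ (1 : ℝ)
  obtain ⟨C₁, hC₁⟩ := hK.exists_bound_of_continuousOn (contDiff_gradient hφ).continuous.continuousOn
  obtain ⟨C₂, hC₂⟩ := hK.exists_bound_of_continuousOn (contDiff_hess hφ).continuous.continuousOn
  obtain ⟨C₃, hC₃⟩ := hK.exists_bound_of_continuousOn
    ((contDiff_hess hφ).fderiv_right (m := ∞) (by simp)).continuous.continuousOn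
  have hx₀ : x₀ ∈ Metric.closedBall x₀ (1 : ℝ) := Metric.mem_closedBall_self zero_le_one
  have h1 := (norm_nonneg _).trans (hC₁ x₀ hx₀)
  have h3 := (norm_nonneg _).trans (hC₃ x₀ hx₀)
  have h2 := (norm_nonneg _).trans (hC₂ x₀ hx₀)
  refine ⟨C₁ + C₂ + C₃, by linarith, fun x hx => ⟨by linarith [hC₁ x hx], by linarith [hC₂ x hx],
    fun y hy => ?_⟩⟩
  have hseg : segment ℝ x y ⊆ Metric.closedBall x₀ 1 := (convex_closedBall x₀ 1).segment_subset hx hy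
  have hxs : x ∈ segment ℝ x y := left_mem_segment ℝ x y
  have hys : y ∈ segment ℝ x y := right_mem_segment ℝ x y
  have hle : ∀ w ∈ segment ℝ x y, ‖w - x‖ ≤ ‖y - x‖ := by
    intro w hw
    rw [segment_eq_image'] at hw
    obtain ⟨t, ht, rfl⟩ := hw
    simp only [add_sub_cancel_left]
    rw [norm_smul, Real.norm_of_nonneg ht.1]
    exact mul_le_of_le_one_left (norm_nonneg _) ht.2
  have hH : ∀ w ∈ segment ℝ x y, ‖hess φ w - hess φ x‖ ≤ C₃ * ‖y - x‖ := by
    intro w hw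
    refine ((convex_closedBall x₀ (1 : ℝ)).norm_image_sub_le_of_norm_fderiv_le (𝕜 := ℝ)
      (fun v _ => (contDiff_hess hφ).differentiable (by simp) v) hC₃ hx (hseg hw)).trans ?_
    exact mul_le_mul_of_nonneg_left (hle w hw) h3
  have hG : ∀ w ∈ segment ℝ x y,
      ‖gradient φ w - gradient φ x - hess φ x (w - x)‖ ≤ C₃ * ‖y - x‖ ^ 2 := by
    intro w hw
    refine ((convex_segment x y).norm_image_sub_le_of_norm_hasFDerivWithin_le' (𝕜 := ℝ)
      (fun v _ => (hasFDerivAt_gradient hφ v).hasFDerivWithinAt) hH hxs hw).trans ?_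
    rw [pow_two, ← mul_assoc]
    exact mul_le_mul_of_nonneg_left (hle w hw) (by positivity)
  have hsa := isSelfAdjoint_iff_inner.1 (isSelfAdjoint_hess hφ x)
  -- By symmetry of the Hessian, subtracting its quadratic form leaves a gradient that varies by at
  -- most `C₃‖y - x‖²` on the segment; one more mean value inequality gives the cubic error.
  have hR : ∀ w, HasFDerivAt (fun w => φ w - 1 / 2 * inner ℝ (hess φ x (w - x)) (w - x))
      (innerSL ℝ (gradient φ w - hess φ x (w - x))) w := by
    intro w
    have e1 := hasFDerivAt_inner_gradient (hφ.differentiable (by simp) w)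
    have e2 : HasFDerivAt (fun w : Euc N => w - x) (ContinuousLinearMap.id ℝ (Euc N)) w :=
      (hasFDerivAt_id w).sub_const x
    have e3 := ((hess φ x).hasFDerivAt (x := w - x)).comp w e2
    have e4 := (e3.inner ℝ e2).const_mul (1 / 2)
    refine (e1.sub e4).congr_fderiv ?_
    ext v
    change inner ℝ (gradient φ w) v - 1 / 2 * (inner ℝ (hess φ x (w - x)) v +
      inner ℝ (hess φ x v) (w - x)) = inner ℝ (gradient φ w - hess φ x (w - x)) v
    rw [hsa v (w - x), real_inner_comm (hess φ x (w - x)) v, inner_sub_left]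
    ring
  have hfin := (convex_segment x y).norm_image_sub_le_of_norm_hasFDerivWithin_le' (𝕜 := ℝ)
    (φ := innerSL ℝ (gradient φ x)) (C := C₃ * ‖y - x‖ ^ 2)
    (fun v _ => (hR v).hasFDerivWithinAt) (fun w hw => by
      rw [← map_sub, innerSL_apply_norm]
      rw [sub_right_comm]
      exact hG w hw) hxs hys
  simp only [sub_self, map_zero, inner_zero_left, mul_zero, sub_zero, innerSL_apply_apply,
    Real.norm_eq_abs] at hfin
  have e : φ y - φ x - inner ℝ (gradient φ x) (y - x)
      - 1 / 2 * inner ℝ (hess φ x (y - x)) (y - x) = φ y - 1 / 2 * inner ℝ (hess φ x (y - x)) (y - x)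
      - φ x - inner ℝ (gradient φ x) (y - x) := by ring
  rw [e]
  refine hfin.trans ?_
  have : 0 ≤ ‖y - x‖ ^ 3 := by positivity
  nlinarith

/-- Adding a quartic perturbation does not change the derivatives of order at most two at its
centre. -/
theorem quartic_perturbation {φ : Euc N → ℝ} (hφ : ContDiff ℝ ∞ φ) (c : ℝ) (x₀ : Euc N) :
    ContDiff ℝ ∞ (fun y => φ y + c * ‖y - x₀‖ ^ 4) ∧
    gradient (fun y => φ y + c * ‖y - x₀‖ ^ 4) x₀ = gradient φ x₀ ∧
    hess (fun y => φ y + c * ‖y - x₀‖ ^ 4) x₀ = hess φ x₀ := by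
  have hq : (fun y : Euc N => φ y + c * ‖y - x₀‖ ^ 4)
      = fun y => φ y + c * (‖y - x₀‖ ^ 2) ^ 2 := by ext y; ring
  have hsm : ContDiff ℝ ∞ (fun y : Euc N => φ y + c * (‖y - x₀‖ ^ 2) ^ 2) := by
    have : ContDiff ℝ ∞ (fun y : Euc N => ‖y - x₀‖ ^ 2) :=
      (contDiff_id.sub contDiff_const).norm_sq ℝ
    exact hφ.add (contDiff_const.mul (this.pow 2))
  have hgrad : gradient (fun y => φ y + c * ‖y - x₀‖ ^ 4)
      = fun y => gradient φ y + (4 * c * ‖y - x₀‖ ^ 2) • (y - x₀) := by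
    ext1 y
    have e1 := hasFDerivAt_inner_gradient (hφ.differentiable (by simp) y)
    have e2 : HasFDerivAt (fun w : Euc N => w - x₀) (ContinuousLinearMap.id ℝ (Euc N)) y :=
      (hasFDerivAt_id y).sub_const x₀
    have e3 := (e2.norm_sq.pow 2).const_mul c
    have e4 : HasGradientAt (fun y => φ y + c * ‖y - x₀‖ ^ 4)
        (gradient φ y + (4 * c * ‖y - x₀‖ ^ 2) • (y - x₀)) y := by
      rw [hq, hasGradientAt_iff_hasFDerivAt]
      refine (e1.add e3).congr_fderiv ?_
      ext v
      simp
      ring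
    exact e4.gradient
  refine ⟨by rw [hq]; exact hsm, by rw [hgrad]; simp, ?_⟩
  -- The gradient of the quartic is of third order at `x₀`, so its own derivative there is zero.
  have hz : HasFDerivAt (fun y : Euc N => (4 * c * ‖y - x₀‖ ^ 2) • (y - x₀)) (0 : Op N) x₀ := by
    have e2 : HasFDerivAt (fun w : Euc N => w - x₀) (ContinuousLinearMap.id ℝ (Euc N)) x₀ :=
      (hasFDerivAt_id x₀).sub_const x₀
    refine ((e2.norm_sq.const_mul (4 * c)).smul e2).congr_fderiv ?_
    ext v
    simp
  have hsum := (hasFDerivAt_gradient hφ x₀).add hz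
  rw [add_zero] at hsum
  rw [hess, hgrad]
  exact hsum.fderiv

end Smooth

/-! ### Consistency of one round with the equation -/

namespace NeumannGame.Setting

variable {N : ℕ} {G : NeumannGame N} {q r ρ H : ℝ} (hG : G.Setting q r ρ H)
include hG

/-- Variation of a test function along one round. -/
theorem exists_expansion {φ : Euc N → ℝ} (hφ : ContDiff ℝ ∞ φ) (x₀ : Euc N) :
    ∃ C : ℝ, 0 ≤ C ∧ ∀ x ∈ closure G.Ω, ‖x - x₀‖ ≤ 1 / 2 →
      ‖gradient φ x‖ ≤ C ∧ ‖hess φ x‖ ≤ C ∧ ∀ d : Euc N, ‖d‖ ≤ 1 / 4 →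
      |φ (projClosure G.Ω (x + d)) - φ x - (inner ℝ (gradient φ x) d
          + 1 / 2 * inner ℝ (hess φ x d) d - ‖x + d - projClosure G.Ω (x + d)‖ *
            inner ℝ (gradient φ x) (outwardNormal G.Ω (projClosure G.Ω (x + d))))| ≤
        C * (‖x + d - projClosure G.Ω (x + d)‖ * ‖d‖) + C * ‖d‖ ^ 3 := by
  obtain ⟨C, hC, hT⟩ := exists_taylor_bound hφ x₀
  refine ⟨8 * C, by positivity, fun x hx hxx₀ => ?_⟩
  have hxb : x ∈ Metric.closedBall x₀ 1 := by
    rw [Metric.mem_closedBall, dist_eq_norm]; linarith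
  obtain ⟨h1, h2, h3⟩ := hT x hxb
  refine ⟨by linarith, by linarith, fun d hd => ?_⟩
  obtain ⟨t, ht0, htd, hteq, htf, hΔ, hyd⟩ := hG.balls.projClosure_add hx d
  rw [hteq]
  generalize projClosure G.Ω (x + d) = y at *
  have hyb : y ∈ Metric.closedBall x₀ 1 := by
    rw [Metric.mem_closedBall, dist_eq_norm]
    have : y - x₀ = (y - x) + (x - x₀) := by abel
    rw [this]
    exact (norm_add_le _ _).trans (by linarith)
  have h4 := h3 y hyb
  have h5 : C * ‖y - x‖ ^ 3 ≤ C * (8 * ‖d‖ ^ 3) := by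
    have : ‖y - x‖ ^ 3 ≤ (2 * ‖d‖) ^ 3 := pow_le_pow_left₀ (norm_nonneg _) hyd 3
    exact mul_le_mul_of_nonneg_left (by linarith) hC
  generalize outwardNormal G.Ω y = n at *
  have hsa := isSelfAdjoint_iff_inner.1 (isSelfAdjoint_hess hφ x) d n
  -- Expansion with `y - x = d - t n`. The terms containing `t` are `O(t‖d‖)`, as `t ≤ ‖d‖`, and so
  -- negligible against the boundary term.
  have hquad : inner ℝ (hess φ x (y - x)) (y - x) = inner ℝ (hess φ x d) d
      - 2 * (t * inner ℝ (hess φ x d) n) + t ^ 2 * inner ℝ (hess φ x n) n := by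
    rw [hΔ]
    simp only [map_sub, map_smul, inner_sub_left, inner_sub_right, inner_smul_left,
      inner_smul_right, conj_trivial]
    rw [real_inner_comm d (hess φ x n), ← hsa]
    ring
  have hlin : inner ℝ (gradient φ x) (y - x) = inner ℝ (gradient φ x) d
      - t * inner ℝ (gradient φ x) n := by
    rw [hΔ, inner_sub_right, inner_smul_right]
  rw [hquad, hlin] at h4
  have hrem : |t * inner ℝ (hess φ x d) n - 1 / 2 * (t ^ 2 * inner ℝ (hess φ x n) n)|
      ≤ 2 * C * (t * ‖d‖) := by
    rcases htf with h | ⟨-, hn⟩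
    · simp [h]
    · have a1 : |inner ℝ (hess φ x d) n| ≤ C * ‖d‖ := by
        refine (abs_real_inner_le_norm _ _).trans ?_
        rw [hn, mul_one]
        exact ((hess φ x).le_opNorm d).trans (mul_le_mul_of_nonneg_right h2 (norm_nonneg _))
      have a2 : |inner ℝ (hess φ x n) n| ≤ C := by
        refine (abs_quadratic_le _ _).trans ?_
        rw [hn, one_pow, mul_one]; exact h2
      refine (abs_sub _ _).trans ?_
      rw [abs_mul, abs_mul, abs_mul, abs_of_nonneg ht0, abs_of_nonneg (sq_nonneg t),
        abs_of_nonneg (by norm_num : (0 : ℝ) ≤ 1 / 2)]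
      have b1 := mul_le_mul_of_nonneg_left a1 ht0
      have b2 := mul_le_mul_of_nonneg_left a2 (sq_nonneg t)
      have b3 : t ^ 2 * C ≤ t * ‖d‖ * C := by
        rw [pow_two]
        exact mul_le_mul_of_nonneg_right (mul_le_mul_of_nonneg_left htd ht0) hC
      have b4 : 0 ≤ t * ‖d‖ * C := by positivity
      linarith
  have hC3 : 0 ≤ C * (t * ‖d‖) := by positivity
  rw [abs_le] at h4 hrem ⊢
  constructor <;> linarith [h4.1, h4.2, hrem.1, hrem.2]

/-- Variation of the debt in one round. -/
theorem debt_increment (L : ℝ) {η : ℝ} (hη : 0 < η) :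
    ∀ᶠ ε in 𝓝[>] (0 : ℝ), ∀ x ∈ closure G.Ω, ∀ z : ℝ, |z| ≤ L →
      ∀ c ∈ G.helenMoves ε, ∀ d ∈ G.markMoves ε,
        |(G.next ε (x, z) c d).2 - z - G.loss ε x z c d - ε ^ 2 * (G.lam * z)| ≤ η * ε ^ 2 := by
  have hl := hG.lam_pos
  filter_upwards [eventually_pos_lt_one,
    eventually_mul_rpow_le_const (a := 2) two_pos G.lam one_pos,
    eventually_mul_rpow_le_const (a := 2) two_pos (G.lam ^ 2 * L) (show 0 < η / 2 by positivity),
    hG.abs_loss_le L (show 0 < η / (4 * G.lam) by positivity)] with ε ⟨hε, hε1⟩ e1 e2 e3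
  intro x hx z hz c hc d hd
  have hloss := e3 x hx z hz c hc d hd
  rw [Real.rpow_two] at e1 e2
  generalize hδ : G.loss ε x z c d = δ at hloss
  have hnext : (G.next ε (x, z) c d).2 = Real.exp (G.lam * ε ^ 2) * (z + δ) := by
    rw [← hδ]; rfl
  have hs0 : 0 < ε ^ 2 := by positivity
  set s := G.lam * ε ^ 2 with hs
  have hspos : 0 < s := by positivity
  have hexp := Real.abs_exp_sub_one_sub_id_le (x := s) (by rw [abs_of_pos hspos]; exact e1)
  rw [hnext]
  -- The remainder of the exponential is `O(ε⁴)`; the interest `s δ` on the loss is `o(ε²)`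
  -- precisely because the loss tends to zero.
  have he : Real.exp s * (z + δ) - z - δ - ε ^ 2 * (G.lam * z)
      = (Real.exp s - 1 - s) * z + (Real.exp s - 1 - s) * δ + s * δ := by rw [hs]; ring
  rw [he]
  have hss : s ^ 2 ≤ s := by nlinarith
  have b1 : |(Real.exp s - 1 - s) * z| ≤ s ^ 2 * L := by
    rw [abs_mul]; exact mul_le_mul hexp hz (abs_nonneg _) (sq_nonneg _)
  have b2 : |(Real.exp s - 1 - s) * δ| ≤ s * (η / (4 * G.lam)) := by
    rw [abs_mul]; exact mul_le_mul (hexp.trans hss) hloss (abs_nonneg _) hspos.le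
  have b3 : |s * δ| ≤ s * (η / (4 * G.lam)) := by
    rw [abs_mul, abs_of_pos hspos]; exact mul_le_mul_of_nonneg_left hloss hspos.le
  have b4 : s * (η / (4 * G.lam)) = η / 4 * ε ^ 2 := by rw [hs]; field_simp
  have b5 : s ^ 2 * L ≤ η / 2 * ε ^ 2 := by
    have := mul_le_mul_of_nonneg_right e2 hs0.le
    calc s ^ 2 * L = G.lam ^ 2 * L * ε ^ 2 * ε ^ 2 := by rw [hs]; ring
      _ ≤ _ := this
  refine (abs_add_le _ _).trans ?_
  have := abs_add_le ((Real.exp s - 1 - s) * z) ((Real.exp s - 1 - s) * δ)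
  linarith

theorem exists_f_near {x₀ : Euc N} (hx₀ : x₀ ∈ closure G.Ω) (ζ : ℝ) (P : Euc N) {X : Op N}
    (hX : IsSelfAdjoint X) {η : ℝ} (hη : 0 < η) :
    ∃ κ : ℝ, 0 < κ ∧ ∀ x ∈ closure G.Ω, ∀ (z : ℝ) (p : Euc N) (Γ : Op N), IsSelfAdjoint Γ →
      ‖x - x₀‖ < κ → |z - ζ| < κ → ‖p - P‖ < κ → ‖Γ - X‖ < κ →
      |G.f x z p Γ - G.f x₀ ζ P X| < η := by
  have hc := hG.nonlin.continuous (x₀, ζ, P, X) ⟨hx₀, hX⟩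
  obtain ⟨κ, hκ, h⟩ := Metric.continuousWithinAt_iff.1 hc η hη
  refine ⟨κ, hκ, fun x hx z p Γ hΓ h1 h2 h3 h4 => ?_⟩
  have := h (x := (x, z, p, Γ)) ⟨hx, hΓ⟩ (by
    simp only [dist_eq_norm]
    exact max_lt h1 (max_lt h2 (max_lt h3 h4)))
  rwa [Real.dist_eq] at this

/-- Near an interior point there are no boundary points, so the claim is vacuous; placing `x₀ ∈
frontier G.Ω` in the conclusion lets one expansion serve interior and boundary points. -/
theorem exists_boundary_near {φ : Euc N → ℝ} (hφ : ContDiff ℝ ∞ φ) (x₀ : Euc N) {η : ℝ}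
    (hη : 0 < η) :
    ∃ κ : ℝ, 0 < κ ∧ ∀ x : Euc N, ‖x - x₀‖ < κ → ∀ y ∈ frontier G.Ω, ‖y - x₀‖ < κ →
      x₀ ∈ frontier G.Ω ∧ |(inner ℝ (gradient φ x) (outwardNormal G.Ω y) - G.h y) -
        (inner ℝ (gradient φ x₀) (outwardNormal G.Ω x₀) - G.h x₀)| < η := by
  by_cases hx₀ : x₀ ∈ frontier G.Ω
  · have hc : ContinuousOn (fun w : Euc N × Euc N =>
        inner ℝ (gradient φ w.1) (outwardNormal G.Ω w.2) - G.h w.2) (univ ×ˢ frontier G.Ω) := by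
      refine ContinuousOn.sub (ContinuousOn.inner ?_ ?_) ?_
      · exact ((contDiff_gradient hφ).continuous.comp continuous_fst).continuousOn
      · exact hG.balls.continuousOn_normal.comp continuousOn_snd fun w hw => hw.2
      · exact hG.h_cont.comp continuousOn_snd fun w hw => hw.2
    obtain ⟨κ, hκ, h⟩ := Metric.continuousWithinAt_iff.1 (hc (x₀, x₀) ⟨mem_univ _, hx₀⟩) η hη
    refine ⟨κ, hκ, fun x hx y hy hyx => ⟨hx₀, ?_⟩⟩
    have := h (x := (x, y)) ⟨mem_univ _, hy⟩ (by
      rw [← dist_eq_norm] at hx hyx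
      exact max_lt hx hyx)
    rwa [Real.dist_eq] at this
  · have : (frontier G.Ω)ᶜ ∈ 𝓝 x₀ := isClosed_frontier.isOpen_compl.mem_nhds hx₀
    obtain ⟨κ, hκ, h⟩ := Metric.mem_nhds_iff.1 this
    refine ⟨κ, hκ, fun x _ y hy hyx => absurd hy (h ?_)⟩
    rwa [Metric.mem_ball, dist_eq_norm]

/-- All the estimates on one round used in the consistency proofs: near `x₀`, the debt
increment minus the variation of the test function is, up to `η ε²`, the sum of the moves'
first and second order terms, of the equation, and of the boundary term. -/
theorem round_expansion {φ : Euc N → ℝ} (hφ : ContDiff ℝ ∞ φ) (x₀ : Euc N) (ζ : ℝ) {η : ℝ}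
    (hη : 0 < η) :
    ∃ κ : ℝ, 0 < κ ∧ ∃ C : ℝ, 0 ≤ C ∧ ∀ᶠ ε in 𝓝[>] (0 : ℝ), ∀ x ∈ closure G.Ω, ‖x - x₀‖ < κ →
      ‖gradient φ x‖ ≤ C ∧ ‖hess φ x‖ ≤ C ∧
      ‖gradient φ x - gradient φ x₀‖ < η ∧ ‖hess φ x - hess φ x₀‖ < η ∧
      ∀ z : ℝ, |z - ζ| < κ → |G.lam * z - G.lam * ζ| ≤ η ∧
      ∀ c ∈ G.helenMoves ε, ∀ d ∈ G.markMoves ε, ∃ t b : ℝ, 0 ≤ t ∧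
        (t = 0 ∨ x₀ ∈ frontier G.Ω ∧
          |b - (inner ℝ (gradient φ x₀) (outwardNormal G.Ω x₀) - G.h x₀)| ≤ η) ∧
        |(G.next ε (x, z) c d).2 - z - (φ (G.next ε (x, z) c d).1 - φ x) -
          (inner ℝ (c.1 - gradient φ x) d + 1 / 2 * inner ℝ ((c.2 - hess φ x) d) d +
            ε ^ 2 * (G.f x z c.1 c.2 + G.lam * z) + t * b)| ≤ η * ε ^ 2 + η * t := by
  have hl := hG.lam_pos
  have hα3 := hG.α_lt
  have hα := hG.α_pos
  obtain ⟨C, hC, hexp⟩ := hG.exists_expansion hφ x₀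
  obtain ⟨κ₁, hκ₁, hbd⟩ := hG.exists_boundary_near hφ x₀ hη
  obtain ⟨κ₂, hκ₂, hg⟩ := Metric.continuousAt_iff.1
    ((contDiff_gradient hφ).continuous.continuousAt (x := x₀)) η hη
  obtain ⟨κ₃, hκ₃, hh⟩ := Metric.continuousAt_iff.1
    ((contDiff_hess hφ).continuous.continuousAt (x := x₀)) η hη
  have hm : ∃ κ : ℝ, 0 < κ ∧ κ ≤ 1 / 2 ∧ κ ≤ κ₁ / 2 ∧ κ ≤ κ₂ ∧ κ ≤ κ₃ ∧ G.lam * κ ≤ η := by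
    refine ⟨min (1 / 2) (min (κ₁ / 2) (min κ₂ (min κ₃ (η / G.lam)))), by positivity,
      min_le_left _ _, ?_, ?_, ?_, ?_⟩
    · exact (min_le_right _ _).trans (min_le_left _ _)
    · exact (min_le_right _ _).trans ((min_le_right _ _).trans (min_le_left _ _))
    · exact (min_le_right _ _).trans ((min_le_right _ _).trans
        ((min_le_right _ _).trans (min_le_left _ _)))
    · rw [← le_div_iff₀' hl]
      exact (min_le_right _ _).trans ((min_le_right _ _).trans
        ((min_le_right _ _).trans (min_le_right _ _)))
  obtain ⟨κ, hκ, k0, k1, k2, k3, k4⟩ := hm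
  refine ⟨κ, hκ, C, hC, ?_⟩
  filter_upwards [eventually_pos_lt_one, hG.debt_increment (|ζ| + 1) (show 0 < η / 2 by positivity),
    eventually_mul_rpow_le_const (a := 1 - G.α) (by linarith) 1
      (show 0 < min (1 / 4) (κ₁ / 8) by positivity),
    eventually_mul_rpow_le_const (a := 1 - G.α) (by linarith) C hη,
    -- The cubic Taylor remainder is `o(ε²)` exactly because `α < 1/3`.
    eventually_mul_rpow_le (a := 3 - 3 * G.α) (b := 2) (by linarith) C
      (show 0 < η / 2 by positivity)] with ε ⟨hε, hε1⟩ e1 e2 e3 e4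
  rw [one_mul] at e2
  rw [Real.rpow_two] at e4
  intro x hx hxx
  obtain ⟨h1, h2, h3⟩ := hexp x hx (by linarith)
  refine ⟨h1, h2, ?_, ?_, fun z hz => ⟨?_, fun c hc d hd => ?_⟩⟩
  · rw [← dist_eq_norm]; exact hg (by rw [dist_eq_norm]; linarith)
  · rw [← dist_eq_norm]; exact hh (by rw [dist_eq_norm]; linarith)
  · rw [← mul_sub, abs_mul, abs_of_pos hl]
    exact (mul_le_mul_of_nonneg_left hz.le hl.le).trans k4
  have hdn : ‖d‖ ≤ ε ^ (1 - G.α) := hd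
  have hd1 : ‖d‖ ≤ 1 / 4 := hdn.trans (e2.trans (min_le_left _ _))
  have hd2 : ‖d‖ ≤ κ₁ / 8 := hdn.trans (e2.trans (min_le_right _ _))
  have hzL : |z| ≤ |ζ| + 1 := by
    have := abs_sub_abs_le_abs_sub z ζ
    linarith
  have h4 := h3 d hd1
  have h5 := e1 x hx z hzL c hc d hd
  obtain ⟨t, ht0, htd, hteq, htf, hΔ, hyd⟩ := hG.balls.projClosure_add hx d
  have hy : (G.next ε (x, z) c d).1 = projClosure G.Ω (x + d) := rfl
  rw [hy]
  simp only [loss] at h5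
  rw [hteq] at h4 h5
  generalize projClosure G.Ω (x + d) = y at *
  refine ⟨t, inner ℝ (gradient φ x) (outwardNormal G.Ω y) - G.h y, ht0, ?_, ?_⟩
  · rcases htf with h | ⟨hyf, -⟩
    · exact Or.inl h
    · right
      have hyx : ‖y - x₀‖ < κ₁ := by
        have : y - x₀ = (y - x) + (x - x₀) := by abel
        rw [this]
        exact (norm_add_le _ _).trans_lt (by linarith)
      obtain ⟨a1, a2⟩ := hbd x (by linarith) y hyf hyx
      exact ⟨a1, a2.le⟩
  · have hd3 : C * ‖d‖ ^ 3 ≤ η / 2 * ε ^ 2 := by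
      refine le_trans ?_ e4
      have : ε ^ (3 - 3 * G.α) = (ε ^ (1 - G.α)) ^ 3 := by
        rw [← Real.rpow_natCast, ← Real.rpow_mul hε.le]; congr 1; push_cast; ring
      rw [this]
      exact mul_le_mul_of_nonneg_left (pow_le_pow_left₀ (norm_nonneg _) hdn 3) hC
    have hd4 : C * (t * ‖d‖) ≤ η * t := by
      have : C * ‖d‖ ≤ η := (mul_le_mul_of_nonneg_left hdn hC).trans e3
      nlinarith
    rw [inner_sub_left, sub_apply, inner_sub_left]
    generalize (G.next ε (x, z) c d).2 = z' at *
    rw [abs_le] at h4 h5 ⊢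
    constructor <;> linarith [h4.1, h4.2, h5.1, h5.2]

/-- If the equation fails to be a subsolution inequality at `x₀`, Mark can make the debt grow more
than the test function. -/
theorem mark_step {φ : Euc N → ℝ} (hφ : ContDiff ℝ ∞ φ) {x₀ : Euc N} (hx₀ : x₀ ∈ closure G.Ω)
    {ζ : ℝ} (hF : 0 < G.f x₀ ζ (gradient φ x₀) (hess φ x₀) + G.lam * ζ)
    (hB : x₀ ∈ frontier G.Ω → 0 < inner ℝ (gradient φ x₀) (outwardNormal G.Ω x₀) - G.h x₀) :
    ∃ κ : ℝ, 0 < κ ∧ ∀ᶠ ε in 𝓝[>] (0 : ℝ), ∀ x ∈ closure G.Ω, ‖x - x₀‖ < κ →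
      ∀ z : ℝ, |z - ζ| < κ → ∀ c ∈ G.helenMoves ε, ∃ d ∈ G.markMoves ε,
        κ * ε ^ 2 ≤ (G.next ε (x, z) c d).2 - z - (φ (G.next ε (x, z) c d).1 - φ x) := by
  set F := G.f x₀ ζ (gradient φ x₀) (hess φ x₀) + G.lam * ζ with hFdef
  set b₀ := inner ℝ (gradient φ x₀) (outwardNormal G.Ω x₀) - G.h x₀ with hb₀
  obtain ⟨κ₁, hκ₁, hf⟩ := hG.exists_f_near hx₀ ζ (gradient φ x₀) (isSelfAdjoint_hess hφ x₀)
    (show 0 < F / 4 by positivity)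
  -- The bound by `κ₁` keeps the arguments of `f` where it is controlled, the one by `F` preserves
  -- the sign of the equation, and the one by `b₀` preserves the sign of the boundary term for every
  -- overshoot `t`.
  obtain ⟨η, hη, hη1, hη2, hη3⟩ : ∃ η : ℝ, 0 < η ∧ η ≤ κ₁ / 2 ∧ η ≤ F / 8 ∧
      (x₀ ∈ frontier G.Ω → η ≤ b₀ / 2) := by
    by_cases hx : x₀ ∈ frontier G.Ω
    · have := hB hx
      exact ⟨min (κ₁ / 2) (min (F / 8) (b₀ / 2)), by positivity, min_le_left _ _,
        (min_le_right _ _).trans (min_le_left _ _),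
        fun _ => (min_le_right _ _).trans (min_le_right _ _)⟩
    · exact ⟨min (κ₁ / 2) (F / 8), by positivity, min_le_left _ _, min_le_right _ _,
        fun h => absurd h hx⟩
  obtain ⟨κ₂, hκ₂, C, hC, hround⟩ := hG.round_expansion hφ x₀ ζ hη
  refine ⟨min (F / 4) (min κ₁ (min κ₂ 1)), by positivity, ?_⟩
  filter_upwards [eventually_pos_lt_one, hround,
    hG.mark_response (|ζ| + 1) hC (show 0 < κ₁ / 3 by positivity)] with ε ⟨hε, hε1⟩ e1 e2
  intro x hx hxx z hz c hc
  have m1 : min (F / 4) (min κ₁ (min κ₂ 1)) ≤ κ₁ := (min_le_right _ _).trans (min_le_left _ _)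
  have m2 : min (F / 4) (min κ₁ (min κ₂ 1)) ≤ κ₂ :=
    (min_le_right _ _).trans ((min_le_right _ _).trans (min_le_left _ _))
  have m3 : min (F / 4) (min κ₁ (min κ₂ 1)) ≤ 1 :=
    (min_le_right _ _).trans ((min_le_right _ _).trans (min_le_right _ _))
  obtain ⟨g1, g2, g3, g4, g5⟩ := e1 x hx (hxx.trans_le m2)
  obtain ⟨g6, g7⟩ := g5 z (hz.trans_le m2)
  have hzL : |z| ≤ |ζ| + 1 := by
    have := abs_sub_abs_le_abs_sub z ζ
    linarith
  obtain ⟨d, hd, p', hp', hresp⟩ := e2 x hx z hzL (gradient φ x) (hess φ x) g1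
    (isSelfAdjoint_hess hφ x) g2 c hc
  refine ⟨d, hd, ?_⟩
  obtain ⟨t, b, ht, htb, hmain⟩ := g7 c hc d hd
  have hfn := hf x hx z p' (hess φ x + (κ₁ / 3) • (1 : Op N))
    (isSelfAdjoint_add (isSelfAdjoint_hess hφ x) (isSelfAdjoint_smul_one _))
    (hxx.trans_le m1) (hz.trans_le m1) (by
      have : p' - gradient φ x₀ = (p' - gradient φ x) + (gradient φ x - gradient φ x₀) := by abel
      rw [this]
      exact (norm_add_le _ _).trans_lt (by linarith)) (by
      have : hess φ x + (κ₁ / 3) • (1 : Op N) - hess φ x₀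
          = (hess φ x - hess φ x₀) + (κ₁ / 3) • (1 : Op N) := by abel
      rw [this]
      have := norm_smul_one_le (N := N) (show 0 ≤ κ₁ / 3 by positivity)
      exact (norm_add_le _ _).trans_lt (by linarith))
  have htb' : 0 ≤ t * b - η * t := by
    rcases htb with h | ⟨h, hb⟩
    · simp [h]
    · have := (abs_le.1 hb).1
      have := hη3 h
      nlinarith
  have hε2 : 0 < ε ^ 2 := by positivity
  have hlow : ε ^ 2 * (F / 2 + F / 8) ≤
      ε ^ 2 * (G.f x z p' (hess φ x + (κ₁ / 3) • (1 : Op N)) + G.lam * z) := by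
    refine mul_le_mul_of_nonneg_left ?_ hε2.le
    have := (abs_lt.1 hfn).1
    have := (abs_le.1 g6).1
    linarith
  have h1 := (abs_le.1 hmain).1
  have h2 : min (F / 4) (min κ₁ (min κ₂ 1)) * ε ^ 2 ≤ F / 4 * ε ^ 2 :=
    mul_le_mul_of_nonneg_right (min_le_left _ _) hε2.le
  have h3 : η * ε ^ 2 ≤ F / 8 * ε ^ 2 := mul_le_mul_of_nonneg_right hη2 hε2.le
  have h4 : 0 < F * ε ^ 2 := mul_pos hF hε2
  linarith

/-- If the equation fails to be a supersolution inequality at `x₀`, Helen can make the debt grow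
less than the test function. -/
theorem helen_step {φ : Euc N → ℝ} (hφ : ContDiff ℝ ∞ φ) {x₀ : Euc N} (hx₀ : x₀ ∈ closure G.Ω)
    {ζ : ℝ} (hF : G.f x₀ ζ (gradient φ x₀) (hess φ x₀) + G.lam * ζ < 0)
    (hB : x₀ ∈ frontier G.Ω → inner ℝ (gradient φ x₀) (outwardNormal G.Ω x₀) - G.h x₀ < 0) :
    ∃ κ : ℝ, 0 < κ ∧ ∀ᶠ ε in 𝓝[>] (0 : ℝ), ∀ x ∈ closure G.Ω, ‖x - x₀‖ < κ →
      ∀ z : ℝ, |z - ζ| < κ → ∃ c ∈ G.helenMoves ε, ∀ d ∈ G.markMoves ε,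
        (G.next ε (x, z) c d).2 - z - (φ (G.next ε (x, z) c d).1 - φ x) ≤ -(κ * ε ^ 2) := by
  set F := -(G.f x₀ ζ (gradient φ x₀) (hess φ x₀) + G.lam * ζ) with hFdef
  set b₀ := -(inner ℝ (gradient φ x₀) (outwardNormal G.Ω x₀) - G.h x₀) with hb₀
  have hF0 : 0 < F := by linarith
  obtain ⟨κ₁, hκ₁, hf⟩ := hG.exists_f_near hx₀ ζ (gradient φ x₀) (isSelfAdjoint_hess hφ x₀)
    (show 0 < F / 4 by positivity)
  obtain ⟨η, hη, hη1, hη2, hη3⟩ : ∃ η : ℝ, 0 < η ∧ η ≤ κ₁ / 2 ∧ η ≤ F / 8 ∧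
      (x₀ ∈ frontier G.Ω → η ≤ b₀ / 2) := by
    by_cases hx : x₀ ∈ frontier G.Ω
    · have : 0 < b₀ := by linarith [hB hx]
      exact ⟨min (κ₁ / 2) (min (F / 8) (b₀ / 2)), by positivity, min_le_left _ _,
        (min_le_right _ _).trans (min_le_left _ _),
        fun _ => (min_le_right _ _).trans (min_le_right _ _)⟩
    · exact ⟨min (κ₁ / 2) (F / 8), by positivity, min_le_left _ _, min_le_right _ _,
        fun h => absurd h hx⟩
  obtain ⟨κ₂, hκ₂, C, hC, hround⟩ := hG.round_expansion hφ x₀ ζ hη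
  refine ⟨min (F / 4) (min κ₁ κ₂), by positivity, ?_⟩
  filter_upwards [eventually_pos_lt_one, hround,
    eventually_mul_rpow_le_const hG.β_pos C one_pos,
    eventually_mul_rpow_le_const hG.γ_pos C one_pos] with ε ⟨hε, hε1⟩ e1 e2 e3
  intro x hx hxx z hz
  have m1 : min (F / 4) (min κ₁ κ₂) ≤ κ₁ := (min_le_right _ _).trans (min_le_left _ _)
  have m2 : min (F / 4) (min κ₁ κ₂) ≤ κ₂ := (min_le_right _ _).trans (min_le_right _ _)
  obtain ⟨g1, g2, g3, g4, g5⟩ := e1 x hx (hxx.trans_le m2)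
  obtain ⟨g6, g7⟩ := g5 z (hz.trans_le m2)
  -- With these moves the terms linear and quadratic in `d` vanish, so in the expansion Mark acts
  -- only through the overshoot, where the boundary inequality favours Helen.
  have hmoves : (gradient φ x, hess φ x) ∈ G.helenMoves ε := by
    refine ⟨g1.trans ?_, isSelfAdjoint_hess hφ x, g2.trans ?_⟩
    · rw [Real.rpow_neg hε.le, ← one_div, le_div_iff₀ (Real.rpow_pos_of_pos hε _)]; exact e2
    · rw [Real.rpow_neg hε.le, ← one_div, le_div_iff₀ (Real.rpow_pos_of_pos hε _)]; exact e3
  refine ⟨_, hmoves, fun d hd => ?_⟩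
  obtain ⟨t, b, ht, htb, hmain⟩ := g7 _ hmoves d hd
  have hfn := hf x hx z (gradient φ x) (hess φ x) (isSelfAdjoint_hess hφ x)
    (hxx.trans_le m1) (hz.trans_le m1) (by linarith) (by linarith)
  have htb' : t * b + η * t ≤ 0 := by
    rcases htb with h | ⟨h, hb⟩
    · simp [h]
    · have := (abs_le.1 hb).2
      have := hη3 h
      nlinarith
  have hε2 : 0 < ε ^ 2 := by positivity
  have hlow : ε ^ 2 * (G.f x z (gradient φ x) (hess φ x) + G.lam * z) ≤
      ε ^ 2 * -(F / 2 + F / 8) := by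
    refine mul_le_mul_of_nonneg_left ?_ hε2.le
    have := (abs_lt.1 hfn).2
    have := (abs_le.1 g6).2
    linarith
  have h1 := (abs_le.1 hmain).2
  have h2 : min (F / 4) (min κ₁ κ₂) * ε ^ 2 ≤ F / 4 * ε ^ 2 :=
    mul_le_mul_of_nonneg_right (min_le_left _ _) hε2.le
  have h3 : η * ε ^ 2 ≤ F / 8 * ε ^ 2 := mul_le_mul_of_nonneg_right hη2 hε2.le
  have h4 : 0 < F * ε ^ 2 := mul_pos hF0 hε2
  simp only [sub_self, inner_zero_left, zero_apply, mul_zero, zero_add] at h1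
  linarith

end NeumannGame.Setting

/-! ### Relaxed limits -/

section Relaxed

variable {N : ℕ}

/-- `W` is the upper relaxed limit on `S` of `T s ε y` as `s → ∞`, `ε → 0⁺` and `y → x` in `S`. -/
def IsRelaxedUpper (S : Set (Euc N)) (T : ℝ → ℝ → Euc N → ℝ) (W : Euc N → ℝ) : Prop :=
  ∀ x ∈ S, ∀ η : ℝ, 0 < η →
    (∀ᶠ e in (atTop ×ˢ 𝓝[>] (0 : ℝ)) ×ˢ 𝓝[S] x, T e.1.1 e.1.2 e.2 < W x + η) ∧
    ∃ᶠ e in (atTop ×ˢ 𝓝[>] (0 : ℝ)) ×ˢ 𝓝[S] x, W x - η < T e.1.1 e.1.2 e.2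

theorem isRelaxedUpper_limsup {S : Set (Euc N)} {T : ℝ → ℝ → Euc N → ℝ} {B s₀ : ℝ}
    (hB : ∀ᶠ ε in 𝓝[>] (0 : ℝ), ∀ s ≥ s₀, ∀ y ∈ S, |T s ε y| ≤ B) :
    IsRelaxedUpper S T fun x =>
      limsup (fun e : (ℝ × ℝ) × Euc N => T e.1.1 e.1.2 e.2)
        ((atTop ×ˢ 𝓝[>] (0 : ℝ)) ×ˢ 𝓝[S] x) := by
  intro x hx η hη
  have hne : (𝓝[S] x).NeBot := mem_closure_iff_nhdsWithin_neBot.1 (subset_closure hx)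
  have hev : ∀ᶠ e in (atTop ×ˢ 𝓝[>] (0 : ℝ)) ×ˢ 𝓝[S] x, |T e.1.1 e.1.2 e.2| ≤ B := by
    filter_upwards [(eventually_ge_atTop s₀).prod_mk hB |>.prod_mk self_mem_nhdsWithin]
      with e he
    exact he.1.2 _ he.1.1 _ he.2
  have h1 : IsBoundedUnder (· ≤ ·) ((atTop ×ˢ 𝓝[>] (0 : ℝ)) ×ˢ 𝓝[S] x)
      fun e : (ℝ × ℝ) × Euc N => T e.1.1 e.1.2 e.2 :=
    isBoundedUnder_of_eventually_le (hev.mono fun e he => (abs_le.1 he).2)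
  have h2 : IsBoundedUnder (· ≥ ·) ((atTop ×ˢ 𝓝[>] (0 : ℝ)) ×ˢ 𝓝[S] x)
      fun e : (ℝ × ℝ) × Euc N => T e.1.1 e.1.2 e.2 :=
    isBoundedUnder_of_eventually_ge (hev.mono fun e he => (abs_le.1 he).1)
  exact ⟨eventually_lt_of_limsup_lt (by linarith) h1,
    frequently_lt_of_lt_limsup h2.isCoboundedUnder_le (by linarith)⟩

/-- Used for semicontinuity: an upper bound near `x` is also one near each point close to `x`. -/
theorem eventually_nhdsWithin_of_prod {ι : Type*} {l : Filter ι} {S : Set (Euc N)} {x : Euc N}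
    {p : ι × Euc N → Prop} (h : ∀ᶠ e in l ×ˢ 𝓝[S] x, p e) :
    ∀ᶠ y in 𝓝[S] x, ∀ᶠ e in l ×ˢ 𝓝[S] y, p e := by
  obtain ⟨pa, ha, pb, hb, hab⟩ := eventually_prod_iff.1 h
  filter_upwards [eventually_eventually_nhdsWithin.2 hb] with y hy
  exact (ha.prod_mk hy).mono fun e he => hab he.1 he.2

namespace IsRelaxedUpper

variable {S : Set (Euc N)} {T : ℝ → ℝ → Euc N → ℝ} {W : Euc N → ℝ} (hT : IsRelaxedUpper S T W)
include hT

theorem upperSemicontinuousOn : UpperSemicontinuousOn W S := by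
  intro x hx y hy
  have h1 := (hT x hx ((y - W x) / 2) (by linarith)).1
  filter_upwards [eventually_nhdsWithin_of_prod h1, self_mem_nhdsWithin] with x' hx' hxS
  obtain ⟨e, he1, he2⟩ := ((hT x' hxS ((y - W x) / 4) (by linarith)).2.and_eventually hx').exists
  linarith

theorem abs_le {B s₀ : ℝ} (hB : ∀ᶠ ε in 𝓝[>] (0 : ℝ), ∀ s ≥ s₀, ∀ y ∈ S, |T s ε y| ≤ B)
    {x : Euc N} (hx : x ∈ S) : |W x| ≤ B := by
  have hne : (𝓝[S] x).NeBot := mem_closure_iff_nhdsWithin_neBot.1 (subset_closure hx)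
  have hev : ∀ᶠ e in (atTop ×ˢ 𝓝[>] (0 : ℝ)) ×ˢ 𝓝[S] x, |T e.1.1 e.1.2 e.2| ≤ B := by
    filter_upwards [(eventually_ge_atTop s₀).prod_mk hB |>.prod_mk self_mem_nhdsWithin]
      with e he
    exact he.1.2 _ he.1.1 _ he.2
  refine le_of_forall_pos_le_add fun η hη => ?_
  obtain ⟨h1, h2⟩ := hT x hx η hη
  obtain ⟨e, he1, he2⟩ := (h2.and_eventually hev).exists
  obtain ⟨e', he1', he2'⟩ := (h1.and hev).exists
  rw [_root_.abs_le] at he2 he2' ⊢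
  constructor <;> linarith [he2.1, he2.2, he2'.1, he2'.2]

/-- Away from a maximum point `x₀` of `W - φ`, the functions `T s ε - φ - |· - x₀|⁴` stay
below its value. -/
theorem eventually_lt_away (hS : IsClosed S) {φ : Euc N → ℝ} (hφ : Continuous φ) {x₀ : Euc N}
    {R κ : ℝ} (hκ : 0 < κ)
    (hmax : ∀ y ∈ S, ‖y - x₀‖ ≤ R → W y - φ y ≤ W x₀ - φ x₀) :
    ∀ᶠ e in (atTop : Filter ℝ) ×ˢ 𝓝[>] (0 : ℝ), ∀ y ∈ S, ‖y - x₀‖ ≤ R → κ ≤ ‖y - x₀‖ →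
      T e.1 e.2 y - (φ y + ‖y - x₀‖ ^ 4) < W x₀ - φ x₀ - κ ^ 4 / 2 := by
  set K := (S ∩ Metric.closedBall x₀ R) \ Metric.ball x₀ κ with hK
  have hKc : IsCompact K :=
    ((isCompact_closedBall x₀ R).inter_left hS).diff Metric.isOpen_ball
  have hmem : ∀ y, y ∈ K ↔ y ∈ S ∧ ‖y - x₀‖ ≤ R ∧ κ ≤ ‖y - x₀‖ := by
    intro y
    simp only [hK, Set.mem_sdiff, mem_inter_iff, Metric.mem_closedBall, Metric.mem_ball, dist_eq_norm,
      not_lt, and_assoc]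
  have hev : {e : (ℝ × ℝ) × Euc N | e.2 ∈ S → T e.1.1 e.1.2 e.2 - (φ e.2 + ‖e.2 - x₀‖ ^ 4) <
      W x₀ - φ x₀ - κ ^ 4 / 2} ∈ ((atTop : Filter ℝ) ×ˢ 𝓝[>] (0 : ℝ)) ×ˢ 𝓝ˢ K := by
    -- The pointwise bounds become uniform by compactness of the annulus, on which the quartic term
    -- leaves a margin `κ⁴`; half of it pays for the approximations.
    refine hKc.mem_prod_nhdsSet_of_forall fun y hy => ?_
    obtain ⟨hyS, hyR, hyκ⟩ := (hmem y).1 hy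
    have h1 := (hT y hyS (κ ^ 4 / 4) (by positivity)).1
    have hc : ContinuousAt (fun w => φ w + ‖w - x₀‖ ^ 4) y := by fun_prop
    have h2 : ∀ᶠ w in 𝓝 y, φ y + ‖y - x₀‖ ^ 4 - κ ^ 4 / 4 < φ w + ‖w - x₀‖ ^ 4 :=
      hc.eventually (lt_mem_nhds (by have : 0 < κ ^ 4 := by positivity
                                     linarith))
    obtain ⟨pa, ha, pb, hb, hab⟩ := eventually_prod_iff.1 h1
    have hb' := eventually_nhdsWithin_iff.1 hb
    filter_upwards [ha.prod_mk (hb'.and h2)] with e he hes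
    have h3 := hab he.1 (he.2.1 hes)
    have h4 := hmax y hyS hyR
    have h5 : κ ^ 4 ≤ ‖y - x₀‖ ^ 4 := pow_le_pow_left₀ hκ.le hyκ 4
    have h6 := he.2.2
    simp only at h3
    linarith
  obtain ⟨pa, ha, pb, hb, hab⟩ := eventually_prod_iff.1 hev
  filter_upwards [ha] with e he y hyS hyR hyκ
  exact hab he (hb.self_of_nhdsSet y ((hmem y).2 ⟨hyS, hyR, hyκ⟩)) hyS

end IsRelaxedUpper

/-- A bounded antitone sequence has a small decrement at one of its first terms. -/
theorem exists_small_increment {M : ℕ → ℝ} {B c : ℝ} (hB : ∀ j, |M j| ≤ B) (n : ℕ)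
    (hn : 2 * B < n * c) : ∃ j < n, M (j + 1) - M j ≤ c := by
  by_contra! h
  have hsum : ∀ j ≤ n, M 0 + j * c ≤ M j := by
    intro j
    induction j with
    | zero => intro _; simp
    | succ j ih =>
      intro hj
      have := ih (by omega)
      have := h j (by omega)
      push_cast
      linarith
  have h1 := hsum n le_rfl
  have h2 := (abs_le.1 (hB n)).2
  have h3 := (abs_le.1 (hB 0)).1
  linarith

/-- At a local maximum of `W - φ`, there are nearby approximate maxima of
`T s ε - φ - |· - x₀|⁴`, even compared with the larger function `T (s - a ε²) ε`. -/
theorem IsRelaxedUpper.exists_near_max {S : Set (Euc N)} {T : ℝ → ℝ → Euc N → ℝ} {W : Euc N → ℝ}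
    (hT : IsRelaxedUpper S T W) (hS : IsClosed S) {B s₀ a : ℝ} (ha : 0 < a)
    (hB : ∀ᶠ ε in 𝓝[>] (0 : ℝ), ∀ s ≥ s₀, ∀ y ∈ S, |T s ε y| ≤ B)
    (hanti : ∀ᶠ ε in 𝓝[>] (0 : ℝ), ∀ s ≥ s₀, ∀ s' ≥ s, ∀ y ∈ S, T s' ε y ≤ T s ε y)
    {φ : Euc N → ℝ} (hφ : Continuous φ) {x₀ : Euc N} (hx₀ : x₀ ∈ S)
    (hmax : IsLocalMaxOn (fun y => W y - φ y) S x₀) :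
    ∃ R : ℝ, 0 < R ∧ ∀ κ : ℝ, 0 < κ → ∃ᶠ ε in 𝓝[>] (0 : ℝ), ∃ s : ℝ, s₀ ≤ s - a * ε ^ 2 ∧
      ∃ x ∈ S, ‖x - x₀‖ < κ ∧ |T s ε x - W x₀| < κ ∧ ∀ y ∈ S, ‖y - x₀‖ ≤ R →
        T (s - a * ε ^ 2) ε y - (φ y + ‖y - x₀‖ ^ 4) ≤
          T s ε x - (φ x + ‖x - x₀‖ ^ 4) + κ * ε ^ 2 := by
  obtain ⟨R, hR, hRmax⟩ : ∃ R : ℝ, 0 < R ∧ ∀ y ∈ S, ‖y - x₀‖ ≤ R → W y - φ y ≤ W x₀ - φ x₀ := by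
    obtain ⟨R, hR, h⟩ := Metric.mem_nhdsWithin_iff.1 hmax
    refine ⟨R / 2, by positivity, fun y hy hyR => h ⟨?_, hy⟩⟩
    rw [Metric.mem_ball, dist_eq_norm]; linarith
  refine ⟨R, hR, fun κ hκ => ?_⟩
  have hψc : Continuous fun y : Euc N => φ y + ‖y - x₀‖ ^ 4 := by fun_prop
  set ψ : Euc N → ℝ := fun y => φ y + ‖y - x₀‖ ^ 4 with hψ
  have hψ₀ : ψ x₀ = φ x₀ := by simp [hψ]
  -- the size of the neighbourhood
  obtain ⟨pa, hpa, pb, hpb, hpab⟩ := eventually_prod_iff.1 (hT x₀ hx₀ (κ / 2) (by positivity)).1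
  obtain ⟨κ₁, hκ₁, hκ₁b⟩ := Metric.mem_nhdsWithin_iff.1 hpb
  obtain ⟨κ₂, hκ₂, hκ₂b⟩ := Metric.continuousAt_iff.1 (hψc.continuousAt (x := x₀)) (κ / 4)
    (by positivity)
  obtain ⟨κ', hκ', k1, k2, k3, k4⟩ : ∃ κ' : ℝ, 0 < κ' ∧ κ' ≤ κ ∧ κ' ≤ R ∧ κ' ≤ κ₁ ∧ κ' ≤ κ₂ :=
    ⟨min (min κ R) (min κ₁ κ₂), by positivity, (min_le_left _ _).trans (min_le_left _ _),
      (min_le_left _ _).trans (min_le_right _ _), (min_le_right _ _).trans (min_le_left _ _),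
      (min_le_right _ _).trans (min_le_right _ _)⟩
  -- Three errors `η` accumulate below: `T` against `W x₀`, the oscillation of `ψ`, and
  -- near-maximality. Their sum must not exceed the margin `κ'⁴/2` of the annulus.
  obtain ⟨η, hη, η1, η2⟩ : ∃ η : ℝ, 0 < η ∧ η ≤ κ' ^ 4 / 6 ∧ η ≤ κ / 6 :=
    ⟨min (κ' ^ 4 / 6) (κ / 6), by positivity, min_le_left _ _, min_le_right _ _⟩
  obtain ⟨κ₃, hκ₃, hκ₃b⟩ := Metric.continuousAt_iff.1 (hψc.continuousAt (x := x₀)) η hη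
  have haway := hT.eventually_lt_away hS hφ hκ' hRmax
  obtain ⟨qa, hqa, qb, hqb, hqab⟩ := eventually_prod_iff.1 (haway.and hpa)
  obtain ⟨s₁, hs₁⟩ := eventually_atTop.1 hqa
  -- bounds on the compact set
  set K := S ∩ Metric.closedBall x₀ R with hK
  have hKc : IsCompact K := (isCompact_closedBall x₀ R).inter_left hS
  have hKmem : ∀ y, y ∈ K ↔ y ∈ S ∧ ‖y - x₀‖ ≤ R := by
    intro y; rw [hK, mem_inter_iff, Metric.mem_closedBall, dist_eq_norm]
  have hx₀K : x₀ ∈ K := (hKmem x₀).2 ⟨hx₀, by simpa using hR.le⟩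
  have : Nonempty K := ⟨⟨x₀, hx₀K⟩⟩
  obtain ⟨Bψ, hBψ⟩ := hKc.exists_bound_of_continuousOn hψc.continuousOn
  set B' := B + Bψ with hB'
  set s₂ := max s₀ s₁ with hs₂
  have hfreq := (hT x₀ hx₀ η hη).2
  have hnear : ∀ᶠ y in 𝓝[S] x₀, y ∈ S ∧ ‖y - x₀‖ < min R κ₃ := by
    filter_upwards [self_mem_nhdsWithin,
      mem_nhdsWithin_of_mem_nhds (Metric.ball_mem_nhds x₀ (show 0 < min R κ₃ by positivity))]
      with y h1 h2
    exact ⟨h1, by rwa [Metric.mem_ball, dist_eq_norm] at h2⟩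
  have hεs : ∀ᶠ ε in 𝓝[>] (0 : ℝ), (0 < ε ∧ ε < 1) ∧ qb ε ∧
      (∀ s ≥ s₀, ∀ y ∈ S, |T s ε y| ≤ B) ∧ (∀ s ≥ s₀, ∀ s' ≥ s, ∀ y ∈ S, T s' ε y ≤ T s ε y) :=
    eventually_pos_lt_one.and (hqb.and (hB.and hanti))
  -- The starting level is taken high enough that all the downward steps used later stay above `s₂`;
  -- their total length is bounded independently of `ε`.
  have hall := ((eventually_ge_atTop (s₂ + (4 * B' * a / κ + 2 * a))).prod_mk hεs).prod_mk hnear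
  refine Tendsto.frequently (f := fun e : (ℝ × ℝ) × Euc N => e.1.2)
    (tendsto_snd.comp tendsto_fst) ((hfreq.and_eventually hall).mono ?_)
  rintro ⟨⟨s, ε⟩, y⟩ ⟨hy, ⟨hs, ⟨hε, hε1⟩, hqε, hBε, hantiε⟩, hyS, hyn⟩
  simp only at hy hs hε hε1 hqε hBε hantiε hyS hyn ⊢
  have hε2 : 0 < ε ^ 2 := by positivity
  have hyK : y ∈ K := (hKmem y).2 ⟨hyS, (hyn.trans_le (min_le_left _ _)).le⟩
  have hyψ : |ψ y - ψ x₀| < η := by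
    rw [← Real.dist_eq]
    exact hκ₃b (by rw [dist_eq_norm]; exact hyn.trans_le (min_le_right _ _))
  -- the maximum as a function of `s`
  have hbd : ∀ σ ≥ s₀, ∀ w : K, |T σ ε w - ψ w| ≤ B' := fun σ hσ w =>
    (abs_sub _ _).trans (add_le_add (hBε σ hσ w ((hKmem w).1 w.2).1) (hBψ w w.2))
  have hB'0 : 0 ≤ B' := (abs_nonneg _).trans (hbd s₀ le_rfl ⟨x₀, hx₀K⟩)
  have hba : ∀ σ ≥ s₀, BddAbove (range fun w : K => T σ ε w - ψ w) := fun σ hσ =>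
    ⟨B', by rintro _ ⟨w, rfl⟩; exact (_root_.abs_le.1 (hbd σ hσ w)).2⟩
  -- About `4B'/(κε²)` steps of size `aε²`: enough that not all increments of a sequence bounded by
  -- `B'` can exceed `κε²/2`, yet the levels descend only by `O(1)`.
  obtain ⟨n, hn1, hn2⟩ : ∃ n : ℕ, 2 * B' < n * (κ / 2 * ε ^ 2) ∧
      n * (a * ε ^ 2) ≤ 4 * B' * a / κ + 2 * a := by
    refine ⟨⌈2 * B' / (κ / 2 * ε ^ 2)⌉₊ + 1, ?_, ?_⟩
    · rw [← div_lt_iff₀ (by positivity)]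
      push_cast
      linarith [Nat.le_ceil (2 * B' / (κ / 2 * ε ^ 2))]
    · have h1 := (Nat.ceil_lt_add_one (show 0 ≤ 2 * B' / (κ / 2 * ε ^ 2) by positivity)).le
      have h2 : ((⌈2 * B' / (κ / 2 * ε ^ 2)⌉₊ + 1 : ℕ) : ℝ) * (a * ε ^ 2) ≤
          (2 * B' / (κ / 2 * ε ^ 2) + 1 + 1) * (a * ε ^ 2) := by
        push_cast
        exact mul_le_mul_of_nonneg_right (by linarith) (by positivity)
      have h3 : (2 * B' / (κ / 2 * ε ^ 2) + 1 + 1) * (a * ε ^ 2)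
          = 4 * B' * a / κ + 2 * a * ε ^ 2 := by field_simp; ring
      have h4 : 2 * a * ε ^ 2 ≤ 2 * a := by
        have : ε ^ 2 ≤ 1 := by nlinarith
        nlinarith
      linarith
  have hσ : ∀ j : ℕ, j ≤ n → s₂ ≤ s - j * (a * ε ^ 2) := by
    intro j hj
    have : (j : ℝ) * (a * ε ^ 2) ≤ n * (a * ε ^ 2) :=
      mul_le_mul_of_nonneg_right (by exact_mod_cast hj) (by positivity)
    linarith
  have hs02 : s₀ ≤ s₂ := le_max_left _ _
  -- Truncating the index at `n` keeps every level in the range where the bounds hold.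
  set M : ℕ → ℝ := fun j => ⨆ w : K, (T (s - (min j n : ℕ) * (a * ε ^ 2)) ε w - ψ w) with hM
  have hMB : ∀ j, |M j| ≤ B' := by
    intro j
    have hσj := hs02.trans (hσ (min j n) (min_le_right _ _))
    rw [_root_.abs_le]
    constructor
    · exact (_root_.abs_le.1 (hbd _ hσj ⟨x₀, hx₀K⟩)).1.trans (le_ciSup (hba _ hσj) ⟨x₀, hx₀K⟩)
    · exact ciSup_le fun w => (_root_.abs_le.1 (hbd _ hσj w)).2
  obtain ⟨j, hjn, hj⟩ := exists_small_increment hMB n hn1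
  have hmin1 : min j n = j := min_eq_left hjn.le
  have hmin2 : min (j + 1) n = j + 1 := min_eq_left hjn
  simp only [hM, hmin1, hmin2] at hj
  set σ := s - j * (a * ε ^ 2) with hσdef
  have hσ' : s - ((j + 1 : ℕ) : ℝ) * (a * ε ^ 2) = σ - a * ε ^ 2 := by
    rw [hσdef]; push_cast; ring
  rw [hσ'] at hj
  have hσ1 : s₂ ≤ σ := hσ j hjn.le
  have hσ2 : s₂ ≤ σ - a * ε ^ 2 := by rw [← hσ']; exact hσ (j + 1) hjn
  have hσs : σ ≤ s := by
    have : 0 ≤ (j : ℝ) * (a * ε ^ 2) := by positivity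
    linarith
  -- The supremum need not be attained. Half of the allowance `κε²` is spent on near-maximality, the
  -- other half on the change of level.
  obtain ⟨w, hw⟩ := exists_lt_of_lt_ciSup
    (show (⨆ w : K, (T σ ε w - ψ w)) - min (κ / 2 * ε ^ 2) η < ⨆ w : K, (T σ ε w - ψ w) by
      have : 0 < min (κ / 2 * ε ^ 2) η := by positivity
      linarith)
  have hwS := ((hKmem w).1 w.2).1
  have hwR := ((hKmem w).1 w.2).2
  have hy1 : T σ ε y - ψ y ≤ ⨆ w : K, (T σ ε w - ψ w) :=
    le_ciSup (hba σ (hs02.trans hσ1)) ⟨y, hyK⟩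
  have hy2 : T s ε y ≤ T σ ε y := hantiε σ (hs02.trans hσ1) s hσs y hyS
  have hwlow : W x₀ - φ x₀ - 3 * η < T σ ε w - ψ w := by
    have h1 := min_le_right (κ / 2 * ε ^ 2) η
    have h2 := (abs_lt.1 hyψ).2
    linarith
  obtain ⟨hq1, hq2⟩ := hqab (hs₁ σ ((le_max_right _ _).trans hσ1)) hqε
  have hwκ : ‖(w : Euc N) - x₀‖ < κ' := by
    by_contra hge
    have := hq1 w hwS hwR (not_lt.1 hge)
    simp only [hψ] at hwlow
    linarith
  refine ⟨σ, hs02.trans hσ2, w, hwS, hwκ.trans_le k1, ?_, ?_⟩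
  · have h1 : T σ ε w < W x₀ + κ / 2 :=
      hpab (x := (σ, ε)) hq2 (y := (w : Euc N))
        (hκ₁b ⟨by rw [Metric.mem_ball, dist_eq_norm]; exact hwκ.trans_le k3, hwS⟩)
    have h2 : |ψ w - ψ x₀| < κ / 4 := by
      rw [← Real.dist_eq]
      exact hκ₂b (by rw [dist_eq_norm]; exact hwκ.trans_le k4)
    rw [abs_lt] at h2 ⊢
    constructor <;> linarith [h2.1, h2.2]
  · intro v hvS hvR
    have h1 : T (σ - a * ε ^ 2) ε v - ψ v ≤ ⨆ w : K, (T (σ - a * ε ^ 2) ε w - ψ w) :=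
      le_ciSup (hba _ (hs02.trans hσ2)) ⟨v, (hKmem v).2 ⟨hvS, hvR⟩⟩
    have h2 := min_le_left (κ / 2 * ε ^ 2) η
    have h3 : T (σ - a * ε ^ 2) ε v - ψ v ≤ T σ ε w - ψ w + κ * ε ^ 2 := by linarith
    exact h3

end Relaxed

/-! ### Viscosity properties of relaxed limits -/

namespace NeumannGame.Setting

variable {N : ℕ} {G : NeumannGame N} {q r ρ H : ℝ} (hG : G.Setting q r ρ H)
include hG

theorem eventually_next_near {R : ℝ} (hR : 0 < R) :
    ∀ᶠ ε in 𝓝[>] (0 : ℝ), ∀ x ∈ closure G.Ω, ∀ (x₀ : Euc N) (z : ℝ) (c : Euc N × Op N),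
      ‖x - x₀‖ ≤ R / 2 → ∀ d ∈ G.markMoves ε, ‖(G.next ε (x, z) c d).1 - x₀‖ ≤ R := by
  filter_upwards [eventually_mul_rpow_le_const (a := 1 - G.α) (by linarith [hG.α_lt]) 1
    (show 0 < R / 4 by positivity)] with ε hε x hx x₀ z c hxx₀ d hd
  rw [one_mul] at hε
  obtain ⟨t, -, -, -, -, -, hyd⟩ := hG.balls.projClosure_add hx d
  have hd' : ‖d‖ ≤ ε ^ (1 - G.α) := hd
  have : (G.next ε (x, z) c d).1 - x₀ = (projClosure G.Ω (x + d) - x) + (x - x₀) := by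
    simp only [next]; abel
  rw [this]
  exact (norm_add_le _ _).trans (by linarith)

/-- The relaxed upper limit of the suprema of a family of sets of debts from which Helen can stay
in the family is a viscosity subsolution. -/
theorem isViscSub_of_family {A : ℝ → ℝ → Euc N → Set ℝ} {W : Euc N → ℝ} {B s₀ a : ℝ} (ha : 0 < a)
    (hW : IsRelaxedUpper (closure G.Ω) (fun s ε y => sSup (A s ε y)) W)
    (hA : ∀ᶠ ε in 𝓝[>] (0 : ℝ), ∀ s ≥ s₀, ∀ y ∈ closure G.Ω, (A s ε y).Nonempty ∧
      BddAbove (A s ε y) ∧ |sSup (A s ε y)| ≤ B ∧ ∀ s' ≥ s, A s' ε y ⊆ A s ε y)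
    (hstep : ∀ᶠ ε in 𝓝[>] (0 : ℝ), ∀ s : ℝ, s₀ ≤ s - a * ε ^ 2 → ∀ x ∈ closure G.Ω,
      ∀ z ∈ A s ε x, |z| ≤ B + 1 / 4 → ∃ c ∈ G.helenMoves ε, ∀ d ∈ G.markMoves ε,
        (G.next ε (x, z) c d).2 ∈ A (s - a * ε ^ 2) ε (G.next ε (x, z) c d).1) :
    IsViscSub G.Ω G.f G.lam G.h W := by
  have hB : ∀ᶠ ε in 𝓝[>] (0 : ℝ), ∀ s ≥ s₀, ∀ y ∈ closure G.Ω, |sSup (A s ε y)| ≤ B :=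
    hA.mono fun ε h s hs y hy => (h s hs y hy).2.2.1
  have hanti : ∀ᶠ ε in 𝓝[>] (0 : ℝ), ∀ s ≥ s₀, ∀ s' ≥ s, ∀ y ∈ closure G.Ω,
      sSup (A s' ε y) ≤ sSup (A s ε y) :=
    hA.mono fun ε h s hs s' hs' y hy => csSup_le_csSup (h s hs y hy).2.1
      (h s' (le_trans hs hs') y hy).1 ((h s hs y hy).2.2.2 s' hs')
  -- One statement for both cases: the boundary premise is vacuous in `Ω`, and on the boundary it is
  -- the only case in which `min` leaves something to prove.
  have key : ∀ x₀ ∈ closure G.Ω, ∀ φ : Euc N → ℝ, ContDiff ℝ ∞ φ →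
      IsLocalMaxOn (fun y => W y - φ y) (closure G.Ω) x₀ →
      (x₀ ∈ frontier G.Ω → 0 < inner ℝ (gradient φ x₀) (outwardNormal G.Ω x₀) - G.h x₀) →
      G.f x₀ (W x₀) (gradient φ x₀) (hess φ x₀) + G.lam * W x₀ ≤ 0 := by
    intro x₀ hx₀ φ hφ hmax hBd
    by_contra! hF
    obtain ⟨hφ', hgr, hhe⟩ := quartic_perturbation hφ 1 x₀
    simp only [one_mul] at hφ' hgr hhe
    obtain ⟨κ, hκ, hmark⟩ := hG.mark_step hφ' hx₀ (ζ := W x₀) (by rw [hgr, hhe]; exact hF)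
      (by rw [hgr]; exact hBd)
    obtain ⟨R, hR, hnear⟩ := hW.exists_near_max isClosed_closure ha hB hanti hφ.continuous hx₀ hmax
    obtain ⟨ε, ⟨s, hs, x, hx, hxx₀, hTx, hTy⟩, ⟨hε, hε1⟩, h1, h2, h3, h4⟩ :=
      ((hnear (min (κ / 4) (R / 2)) (by positivity)).and_eventually
        (eventually_pos_lt_one.and (hA.and (hstep.and (hmark.and
          (hG.eventually_next_near hR)))))).exists
    have hε2 : 0 < ε ^ 2 := by positivity
    have hs₀ : s₀ ≤ s := by
      have : 0 < a * ε ^ 2 := by positivity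
      linarith
    obtain ⟨hne, hbdd, hTB, -⟩ := h1 s hs₀ x hx
    have hε3 : ε ^ 2 < 1 := by nlinarith
    have hk2 : 0 < min (κ / 4) (1 / 4) := by positivity
    -- Helen's good move must start from a debt in the set itself, so the supremum is replaced by an
    -- element within `κε²/4` of it.
    obtain ⟨z, hz, hzlt⟩ := exists_lt_of_lt_csSup hne
      (show sSup (A s ε x) - min (κ / 4) (1 / 4) * ε ^ 2 < sSup (A s ε x) by
        have := mul_pos hk2 hε2
        linarith)
    have hzle : z ≤ sSup (A s ε x) := le_csSup hbdd hz
    have hm1 : min (κ / 4) (1 / 4) * ε ^ 2 ≤ κ / 4 * ε ^ 2 :=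
      mul_le_mul_of_nonneg_right (min_le_left _ _) hε2.le
    have hm2 : min (κ / 4) (1 / 4) * ε ^ 2 ≤ 1 / 4 * ε ^ 2 :=
      mul_le_mul_of_nonneg_right (min_le_right _ _) hε2.le
    have hm3 : κ / 4 * ε ^ 2 ≤ κ / 4 := by
      have : 0 < κ / 4 := by positivity
      nlinarith
    have hk4 := min_le_left (κ / 4) (R / 2)
    have hzL : |z| ≤ B + 1 / 4 := by
      rw [abs_le] at hTB ⊢
      constructor <;> linarith [hTB.1, hTB.2]
    obtain ⟨c, hc, hcd⟩ := h2 s hs x hx z hz hzL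
    have hzζ : |z - W x₀| < κ := by
      rw [abs_lt] at hTx ⊢
      constructor <;> linarith [hTx.1, hTx.2]
    obtain ⟨d, hd, hinc⟩ := h3 x hx (by linarith) z hzζ c hc
    have hy := hcd d hd
    have hyR := h4 x hx x₀ z c (hxx₀.trans_le (min_le_right _ _)).le d hd
    have hyΩ : (G.next ε (x, z) c d).1 ∈ closure G.Ω := hG.balls.projClosure_mem _
    have hle := le_csSup (h1 (s - a * ε ^ 2) hs _ hyΩ).2.1 hy
    -- The new debt is at most the supremum at the lower level, yet Mark has gained `κε²` over the
    -- test function; the two allowances of `κε²/4` cannot absorb this.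
    have hfin := hTy _ hyΩ hyR
    have hm4 : min (κ / 4) (R / 2) * ε ^ 2 ≤ κ / 4 * ε ^ 2 :=
      mul_le_mul_of_nonneg_right hk4 hε2.le
    have hm5 : 0 < κ * ε ^ 2 := by positivity
    linarith
  refine ⟨hW.upperSemicontinuousOn, fun x hx φ hφ hmax => ?_, fun x hx φ hφ hmax => ?_⟩
  · refine key x (subset_closure hx) φ hφ hmax fun hf => ?_
    rw [hG.balls.isOpen.frontier_eq] at hf
    exact absurd hx hf.2
  · by_contra! h
    rw [lt_min_iff] at h
    exact absurd (key x (frontier_subset_closure hx) φ hφ hmax fun _ => h.2) (not_le.2 h.1)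

/-- The relaxed lower limit of the infima of a family of sets of debts from which Mark can stay
in the family is a viscosity supersolution. -/
theorem isViscSuper_of_family {A : ℝ → ℝ → Euc N → Set ℝ} {W : Euc N → ℝ} {B s₀ a : ℝ} (ha : 0 < a)
    (hW : IsRelaxedUpper (closure G.Ω) (fun s ε y => -sInf (A s ε y)) fun x => -W x)
    (hA : ∀ᶠ ε in 𝓝[>] (0 : ℝ), ∀ s ≥ s₀, ∀ y ∈ closure G.Ω, (A s ε y).Nonempty ∧
      BddBelow (A s ε y) ∧ |sInf (A s ε y)| ≤ B ∧ ∀ s' ≥ s, A s' ε y ⊆ A s ε y)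
    (hstep : ∀ᶠ ε in 𝓝[>] (0 : ℝ), ∀ s : ℝ, s₀ ≤ s - a * ε ^ 2 → ∀ x ∈ closure G.Ω,
      ∀ z ∈ A s ε x, |z| ≤ B + 1 / 4 → ∀ c ∈ G.helenMoves ε, ∃ d ∈ G.markMoves ε,
        (G.next ε (x, z) c d).2 ∈ A (s - a * ε ^ 2) ε (G.next ε (x, z) c d).1) :
    IsViscSuper G.Ω G.f G.lam G.h W := by
  have hB : ∀ᶠ ε in 𝓝[>] (0 : ℝ), ∀ s ≥ s₀, ∀ y ∈ closure G.Ω, |-sInf (A s ε y)| ≤ B :=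
    hA.mono fun ε h s hs y hy => by rw [abs_neg]; exact (h s hs y hy).2.2.1
  have hanti : ∀ᶠ ε in 𝓝[>] (0 : ℝ), ∀ s ≥ s₀, ∀ s' ≥ s, ∀ y ∈ closure G.Ω,
      -sInf (A s' ε y) ≤ -sInf (A s ε y) :=
    hA.mono fun ε h s hs s' hs' y hy => neg_le_neg (csInf_le_csInf (h s hs y hy).2.1
      (h s' (le_trans hs hs') y hy).1 ((h s hs y hy).2.2.2 s' hs'))
  have key : ∀ x₀ ∈ closure G.Ω, ∀ φ : Euc N → ℝ, ContDiff ℝ ∞ φ →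
      IsLocalMinOn (fun y => W y - φ y) (closure G.Ω) x₀ →
      (x₀ ∈ frontier G.Ω → inner ℝ (gradient φ x₀) (outwardNormal G.Ω x₀) - G.h x₀ < 0) →
      0 ≤ G.f x₀ (W x₀) (gradient φ x₀) (hess φ x₀) + G.lam * W x₀ := by
    intro x₀ hx₀ φ hφ hmin hBd
    by_contra! hF
    obtain ⟨hφ', hgr, hhe⟩ := quartic_perturbation hφ (-1) x₀
    obtain ⟨κ, hκ, hhelen⟩ := hG.helen_step hφ' hx₀ (ζ := W x₀) (by rw [hgr, hhe]; exact hF)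
      (by rw [hgr]; exact hBd)
    have hmax : IsLocalMaxOn (fun y => -W y - -φ y) (closure G.Ω) x₀ := by
      filter_upwards [hmin] with y hy
      linarith
    obtain ⟨R, hR, hnear⟩ := hW.exists_near_max isClosed_closure ha hB hanti hφ.continuous.neg hx₀
      hmax
    obtain ⟨ε, ⟨s, hs, x, hx, hxx₀, hTx, hTy⟩, ⟨hε, hε1⟩, h1, h2, h3, h4⟩ :=
      ((hnear (min (κ / 4) (R / 2)) (by positivity)).and_eventually
        (eventually_pos_lt_one.and (hA.and (hstep.and (hhelen.and
          (hG.eventually_next_near hR)))))).exists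
    have hε2 : 0 < ε ^ 2 := by positivity
    have hs₀ : s₀ ≤ s := by
      have : 0 < a * ε ^ 2 := by positivity
      linarith
    obtain ⟨hne, hbdd, hTB, -⟩ := h1 s hs₀ x hx
    have hε3 : ε ^ 2 < 1 := by nlinarith
    have hk2 : 0 < min (κ / 4) (1 / 4) := by positivity
    obtain ⟨z, hz, hzlt⟩ := exists_lt_of_csInf_lt hne
      (show sInf (A s ε x) < sInf (A s ε x) + min (κ / 4) (1 / 4) * ε ^ 2 by
        have := mul_pos hk2 hε2
        linarith)
    have hzle : sInf (A s ε x) ≤ z := csInf_le hbdd hz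
    have hm1 : min (κ / 4) (1 / 4) * ε ^ 2 ≤ κ / 4 * ε ^ 2 :=
      mul_le_mul_of_nonneg_right (min_le_left _ _) hε2.le
    have hm2 : min (κ / 4) (1 / 4) * ε ^ 2 ≤ 1 / 4 * ε ^ 2 :=
      mul_le_mul_of_nonneg_right (min_le_right _ _) hε2.le
    have hm3 : κ / 4 * ε ^ 2 ≤ κ / 4 := by
      have : 0 < κ / 4 := by positivity
      nlinarith
    have hk4 := min_le_left (κ / 4) (R / 2)
    have hzL : |z| ≤ B + 1 / 4 := by
      rw [abs_le] at hTB ⊢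
      constructor <;> linarith [hTB.1, hTB.2]
    have hzζ : |z - W x₀| < κ := by
      rw [abs_lt] at hTx ⊢
      constructor <;> linarith [hTx.1, hTx.2]
    obtain ⟨c, hc, hinc⟩ := h3 x hx (by linarith) z hzζ
    obtain ⟨d, hd, hy⟩ := h2 s hs x hx z hz hzL c hc
    replace hinc := hinc d hd
    have hyR := h4 x hx x₀ z c (hxx₀.trans_le (min_le_right _ _)).le d hd
    have hyΩ : (G.next ε (x, z) c d).1 ∈ closure G.Ω := hG.balls.projClosure_mem _
    simp only [Pi.neg_apply] at hTy
    have hle := csInf_le (h1 (s - a * ε ^ 2) hs _ hyΩ).2.1 hy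
    have hfin := hTy _ hyΩ hyR
    have hm4 : min (κ / 4) (R / 2) * ε ^ 2 ≤ κ / 4 * ε ^ 2 :=
      mul_le_mul_of_nonneg_right hk4 hε2.le
    have hm5 : 0 < κ * ε ^ 2 := by positivity
    linarith
  refine ⟨?_, fun x hx φ hφ hmin => ?_, fun x hx φ hφ hmin => ?_⟩
  · intro x hx y hy
    have := hW.upperSemicontinuousOn x hx (-y) (by simpa using hy)
    filter_upwards [this] with w hw
    linarith
  · refine key x (subset_closure hx) φ hφ hmin fun hf => ?_
    rw [hG.balls.isOpen.frontier_eq] at hf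
    exact absurd hx hf.2
  · by_contra! h
    rw [max_lt_iff] at h
    exact absurd (key x (frontier_subset_closure hx) φ hφ hmin fun _ => h.2) (not_le.2 h.1)

end NeumannGame.Setting

/-! ### The barrier `χ` -/

section Cb2

variable {N : ℕ} {Ω : Set (Euc N)} {ψ : Euc N → ℝ}

/-- A function in `C²_b` satisfies first order Taylor estimates between nearby points of the
closure of the domain. -/
theorem TangentBalls.exists_taylor_bound {ρ : ℝ} (hT : TangentBalls Ω ρ) (hψ : IsCb2 Ω ψ) :
    ∃ C : ℝ, 0 ≤ C ∧ ∀ x ∈ closure Ω, |ψ x| ≤ C ∧ ‖gradient ψ x‖ ≤ C ∧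
      ∀ y ∈ closure Ω, ‖y - x‖ ≤ ρ / 16 → ‖gradient ψ y - gradient ψ x‖ ≤ C * ‖y - x‖ ∧
        |ψ y - ψ x - inner ℝ (gradient ψ x) (y - x)| ≤ C * ‖y - x‖ ^ 2 := by
  obtain ⟨O, hO, -, hsub, hsm, C, hC⟩ := hψ
  have hd1 : ∀ x ∈ closure Ω, HasFDerivAt ψ (fderiv ℝ ψ x) x := fun x hx =>
    ((hsm.contDiffAt (hO.mem_nhds (hsub hx))).differentiableAt (by simp)).hasFDerivAt
  have hd2 : ∀ x ∈ closure Ω, HasFDerivAt (fderiv ℝ ψ) (fderiv ℝ (fderiv ℝ ψ) x) x := fun x hx =>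
    (((hsm.contDiffAt (hO.mem_nhds (hsub hx))).fderiv_right (m := 1)
      (by norm_num)).differentiableAt (by simp)).hasFDerivAt
  have hb0 : ∀ x ∈ closure Ω, |ψ x| ≤ C := fun x hx => by
    have := hC x (hsub hx) 0 (by norm_num)
    rwa [norm_iteratedFDeriv_zero] at this
  have hb1 : ∀ x ∈ closure Ω, ‖fderiv ℝ ψ x‖ ≤ C := fun x hx => by
    have := hC x (hsub hx) 1 (by norm_num)
    rwa [norm_iteratedFDeriv_one] at this
  have hb2 : ∀ x ∈ closure Ω, ‖fderiv ℝ (fderiv ℝ ψ) x‖ ≤ C := fun x hx => by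
    have := hC x (hsub hx) 2 le_rfl
    rwa [← norm_iteratedFDeriv_fderiv (n := 1), norm_iteratedFDeriv_one] at this
  have hgrad : ∀ x, ‖gradient ψ x‖ = ‖fderiv ℝ ψ x‖ := fun x => LinearIsometryEquiv.norm_map _ _
  have hgrad' : ∀ x y, ‖gradient ψ y - gradient ψ x‖ = ‖fderiv ℝ ψ y - fderiv ℝ ψ x‖ := by
    intro x y
    unfold gradient
    rw [← map_sub, LinearIsometryEquiv.norm_map]
  obtain ⟨x₁, hx₁⟩ := hT.nonempty
  have hC0 : 0 ≤ C := (abs_nonneg _).trans (hb0 x₁ (subset_closure hx₁))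
  -- The three pieces of the path have lengths at most `4s`, `s`, `4s`, and the derivative has
  -- varied by at most `4Cs`, `5Cs`, `9Cs` on them: `16 + 5 + 36 = 57`.
  refine ⟨57 * C, by positivity, fun x hx => ⟨by linarith [hb0 x hx], by
    rw [hgrad]; linarith [hb1 x hx], fun y hy hyx => ?_⟩⟩
  have hseg : ∀ a b : Euc N, segment ℝ a b ⊆ closure Ω → ∀ w ∈ segment ℝ a b,
      ‖fderiv ℝ ψ w - fderiv ℝ ψ a‖ ≤ C * ‖b - a‖ := by
    intro a b hab w hw
    refine ((convex_segment a b).norm_image_sub_le_of_norm_hasFDerivWithin_le (𝕜 := ℝ)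
      (fun v hv => (hd2 v (hab hv)).hasFDerivWithinAt) (fun v hv => hb2 v (hab hv))
      (left_mem_segment ℝ a b) hw).trans (mul_le_mul_of_nonneg_left ?_ hC0)
    rw [segment_eq_image'] at hw
    obtain ⟨t, ht, rfl⟩ := hw
    simp only [add_sub_cancel_left]
    rw [norm_smul, Real.norm_of_nonneg ht.1]
    exact mul_le_of_le_one_left (norm_nonneg _) ht.2
  have hval : ∀ a b : Euc N, segment ℝ a b ⊆ closure Ω → ∀ K : ℝ,
      (∀ w ∈ segment ℝ a b, ‖fderiv ℝ ψ w - fderiv ℝ ψ x‖ ≤ K) →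
      |ψ b - ψ a - fderiv ℝ ψ x (b - a)| ≤ K * ‖b - a‖ := by
    intro a b hab K hK
    exact (convex_segment a b).norm_image_sub_le_of_norm_hasFDerivWithin_le' (𝕜 := ℝ)
      (fun v hv => (hd1 v (hab hv)).hasFDerivWithinAt) hK (left_mem_segment ℝ a b)
      (right_mem_segment ℝ a b)
  obtain ⟨a, b, h1, h2, h3, l1, l2, l3⟩ := hT.exists_short_path hx hy hyx
  generalize hs : ‖y - x‖ = s at l1 l2 l3 ⊢
  have hs0 : 0 ≤ s := hs ▸ norm_nonneg _
  have c1 : ∀ w ∈ segment ℝ x a, ‖fderiv ℝ ψ w - fderiv ℝ ψ x‖ ≤ C * (4 * s) := fun w hw =>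
    (hseg x a h1 w hw).trans (mul_le_mul_of_nonneg_left l1 hC0)
  have c2 : ∀ w ∈ segment ℝ a b, ‖fderiv ℝ ψ w - fderiv ℝ ψ x‖ ≤ C * (5 * s) := fun w hw => by
    have := (norm_sub_le_norm_sub_add_norm_sub (fderiv ℝ ψ w) (fderiv ℝ ψ a) (fderiv ℝ ψ x)).trans
      (add_le_add ((hseg a b h2 w hw).trans (mul_le_mul_of_nonneg_left l2 hC0))
        (c1 a (right_mem_segment ℝ x a)))
    linarith
  have c3 : ∀ w ∈ segment ℝ b y, ‖fderiv ℝ ψ w - fderiv ℝ ψ x‖ ≤ C * (9 * s) := fun w hw => by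
    have := (norm_sub_le_norm_sub_add_norm_sub (fderiv ℝ ψ w) (fderiv ℝ ψ b) (fderiv ℝ ψ x)).trans
      (add_le_add ((hseg b y h3 w hw).trans (mul_le_mul_of_nonneg_left l3 hC0))
        (c2 b (right_mem_segment ℝ a b)))
    linarith
  have hCs : 0 ≤ C * s := by positivity
  constructor
  · rw [hgrad']
    have := c3 y (right_mem_segment ℝ b y)
    linarith
  · have v1 := (hval x a h1 _ c1).trans (mul_le_mul_of_nonneg_left l1 (by positivity))
    have v2 := (hval a b h2 _ c2).trans (mul_le_mul_of_nonneg_left l2 (by positivity))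
    have v3 := (hval b y h3 _ c3).trans (mul_le_mul_of_nonneg_left l3 (by positivity))
    have hi : inner ℝ (gradient ψ x) (y - x) = fderiv ℝ ψ x (y - x) := inner_gradient_left
    rw [hi]
    have hsplit : ψ y - ψ x - fderiv ℝ ψ x (y - x) = (ψ a - ψ x - fderiv ℝ ψ x (a - x)) +
        (ψ b - ψ a - fderiv ℝ ψ x (b - a)) + (ψ y - ψ b - fderiv ℝ ψ x (y - b)) := by
      simp only [map_sub]; ring
    rw [hsplit]
    refine (abs_add_three _ _ _).trans ?_
    nlinarith

/-- Variation of `ψ` along one round; the normal derivative of `ψ` on the boundary helps. -/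
theorem TangentBalls.exists_increment_le {ρ H : ℝ} (hT : TangentBalls Ω ρ) (hψ : IsCb2 Ω ψ)
    (hψn : ∀ x ∈ frontier Ω, inner ℝ (gradient ψ x) (outwardNormal Ω x) = H + 1) :
    ∃ C s₀ : ℝ, 0 ≤ C ∧ 0 < s₀ ∧ ∀ x ∈ closure Ω, |ψ x| ≤ C ∧ ‖gradient ψ x‖ ≤ C ∧
      ∀ d : Euc N, ‖d‖ ≤ s₀ → ψ (projClosure Ω (x + d)) - ψ x ≤
        inner ℝ (gradient ψ x) d + C * ‖d‖ ^ 2 - ‖x + d - projClosure Ω (x + d)‖ * H := by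
  obtain ⟨C, hC, hTay⟩ := hT.exists_taylor_bound hψ
  have hρ := hT.pos
  -- As `‖y - x‖ ≤ 2‖d‖`, the first bound makes the Taylor estimate applicable. The second gives
  -- `C‖y - x‖ ≤ 1`, so the extra `1` in the normal derivative pays for taking the gradient at `x`
  -- instead of at the landing point.
  refine ⟨4 * C, min (ρ / 32) (1 / (2 * C + 1)), by positivity, by positivity, fun x hx => ?_⟩
  obtain ⟨h1, h2, h3⟩ := hTay x hx
  refine ⟨by linarith, by linarith, fun d hd => ?_⟩
  obtain ⟨t, ht0, htd, hteq, htf, hΔ, hyd⟩ := hT.projClosure_add hx d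
  have hyΩ := hT.projClosure_mem (x + d)
  rw [hteq]
  generalize projClosure Ω (x + d) = y at *
  obtain ⟨h4, h5⟩ := h3 y hyΩ (by linarith [hd.trans (min_le_left _ _)])
  have h6 : C * ‖y - x‖ ^ 2 ≤ C * (2 * ‖d‖) ^ 2 :=
    mul_le_mul_of_nonneg_left (pow_le_pow_left₀ (norm_nonneg _) hyd 2) hC
  have hlin : inner ℝ (gradient ψ x) (y - x) = inner ℝ (gradient ψ x) d
      - t * inner ℝ (gradient ψ x) (outwardNormal Ω y) := by
    rw [hΔ, inner_sub_right, inner_smul_right]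
  rw [hlin] at h5
  have hn : t * H ≤ t * inner ℝ (gradient ψ x) (outwardNormal Ω y) := by
    rcases htf with h | ⟨hyf, hyn⟩
    · simp [h]
    · refine mul_le_mul_of_nonneg_left ?_ ht0
      have e1 := hψn y hyf
      have e2 := abs_real_inner_le_norm (gradient ψ y - gradient ψ x) (outwardNormal Ω y)
      rw [hyn, mul_one, inner_sub_left] at e2
      have e3 := (abs_le.1 (e2.trans h4)).2
      have e4 : C * ‖y - x‖ ≤ 1 := by
        have e5 : ‖d‖ * (2 * C + 1) ≤ 1 := by
          rw [← le_div_iff₀ (by positivity)]; exact hd.trans (min_le_right _ _)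
        have := mul_le_mul_of_nonneg_left hyd hC
        nlinarith [norm_nonneg d]
      linarith
  have := (abs_le.1 h5).2
  linarith

end Cb2

theorem eventually_exp_mul_le (l K : ℝ) : ∀ᶠ ε in 𝓝[>] (0 : ℝ), Real.exp (l * ε ^ 2) * K ≤ K + 1 := by
  have hc : Continuous fun ε : ℝ => Real.exp (l * ε ^ 2) * K := by fun_prop
  have h0 := hc.tendsto 0
  simp only [ne_eq, OfNat.ofNat_ne_zero, not_false_eq_true, zero_pow, mul_zero, Real.exp_zero,
    one_mul] at h0
  exact ((h0.eventually (gt_mem_nhds (lt_add_one K))).filter_mono nhdsWithin_le_nhds).mono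
    fun ε h => h.le

theorem two_mul_smul_one_quadratic {N : ℕ} (C : ℝ) (d : Euc N) :
    1 / 2 * inner ℝ (((2 * C) • (1 : Op N)) d) d = C * ‖d‖ ^ 2 := by
  rw [smul_one_quadratic]; ring

namespace NeumannGame

variable {N : ℕ}

/-- The assumptions under which `χ` is a barrier for the game: `P` stands for its gradient. -/
structure Barrier (G : NeumannGame N) (H : ℝ) (P : Euc N → Euc N) (C s₀ m K : ℝ) : Prop where
  C_nonneg : 0 ≤ C
  s₀_pos : 0 < s₀
  m_pos : 0 < m
  grad_le : ∀ x ∈ closure G.Ω, ‖P x‖ ≤ C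
  increment : ∀ x ∈ closure G.Ω, ∀ d : Euc N, ‖d‖ ≤ s₀ →
    G.χ (projClosure G.Ω (x + d)) - G.χ x ≤
      inner ℝ (P x) d + C * ‖d‖ ^ 2 - ‖x + d - projClosure G.Ω (x + d)‖ * H
  f_le : ∀ x ∈ closure G.Ω, ∀ z : ℝ, |z| ≤ G.M → ∀ (p : Euc N) (Γ : Op N), IsSelfAdjoint Γ →
    ‖p‖ ≤ 2 * C + 1 → ‖Γ‖ ≤ 2 * C + 1 → |G.f x z p Γ| ≤ K
  le_lam : K + 1 ≤ G.lam * m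
  le_chi : ∀ x ∈ closure G.Ω, m ≤ G.χ x
  chi_le : ∀ x ∈ closure G.Ω, G.χ x ≤ G.M - 1

namespace Barrier

variable {G : NeumannGame N} {q r ρ H : ℝ} {P : Euc N → Euc N} {C s₀ m K : ℝ}
  (hb : G.Barrier H P C s₀ m K) (hG : G.Setting q r ρ H)
include hb hG

theorem regular : G.Regular (G.M - 1) where
  lam_pos := hG.lam_pos
  proj_mem := hG.balls.projClosure_mem
  chi_le x hx := by
    rw [abs_of_nonneg (hb.m_pos.le.trans (hb.le_chi x hx))]; exact hb.chi_le x hx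

theorem one_lt_M : 1 < G.M := by
  obtain ⟨x, hx⟩ := hG.balls.nonempty
  have h1 := hb.le_chi x (subset_closure hx)
  have h2 := hb.chi_le x (subset_closure hx)
  linarith [hb.m_pos]

/-- The interest on `χ ≥ m` in one round is at least `λε²m ≥ ε²(K + 1)`, which covers the accrued
cost of `f`. -/
theorem discount {ε : ℝ} (he : Real.exp (G.lam * ε ^ 2) * K ≤ K + 1) {y : Euc N}
    (hy : y ∈ closure G.Ω) : G.χ y ≤ Real.exp (G.lam * ε ^ 2) * (G.χ y - ε ^ 2 * K) := by
  have h1 := Real.add_one_le_exp (G.lam * ε ^ 2)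
  have h2 := hb.le_chi y hy
  have h3 := mul_le_mul_of_nonneg_left hb.le_lam (sq_nonneg ε)
  have h4 := mul_le_mul_of_nonneg_left he (sq_nonneg ε)
  have h5 : G.lam * ε ^ 2 * m ≤ (Real.exp (G.lam * ε ^ 2) - 1) * G.χ y :=
    mul_le_mul (by linarith) h2 hb.m_pos.le (by
      have := mul_nonneg hG.lam_pos.le (sq_nonneg ε)
      linarith)
  linarith

theorem eventually_move_le : ∀ᶠ ε in 𝓝[>] (0 : ℝ), ε ^ (1 - G.α) ≤ s₀ := by
  filter_upwards [eventually_mul_rpow_le_const (a := 1 - G.α) (by linarith [hG.α_lt]) 1 hb.s₀_pos]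
    with ε h
  rwa [one_mul] at h

/-- Mark answers as if Helen had played the gradient of `χ` and `2C` times the identity, whose
quadratic term `C‖d‖²` dominates the Taylor error. The normal slope of `χ` compensates the coupon.
-/
theorem mark_barrier : ∀ᶠ ε in 𝓝[>] (0 : ℝ), ∀ x ∈ closure G.Ω, ∀ z : ℝ, |z| < G.M →
    ∀ c ∈ G.helenMoves ε, ∃ d ∈ G.markMoves ε, Real.exp (G.lam * ε ^ 2) * (z - G.χ x) ≤
      (G.next ε (x, z) c d).2 - G.χ (G.next ε (x, z) c d).1 := by
  have hC := hb.C_nonneg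
  filter_upwards [eventually_exp_mul_le G.lam K, hb.eventually_move_le hG,
    hG.mark_response G.M (C₀ := 2 * C) (by positivity) one_pos] with ε e1 e2 e3
  intro x hx z hz c hc
  obtain ⟨d, hd, p', hp', hresp⟩ := e3 x hx z hz.le (P x) ((2 * C) • (1 : Op N))
    (by linarith [hb.grad_le x hx]) (isSelfAdjoint_smul_one _) (norm_smul_one_le (by positivity))
    c hc
  refine ⟨d, hd, ?_⟩
  have hinc := hb.increment x hx d (le_trans hd e2)
  have hpn : ‖p'‖ ≤ 2 * C + 1 := by
    have h5 := norm_add_le (p' - P x) (P x)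
    rw [sub_add_cancel] at h5
    linarith [hb.grad_le x hx]
  have hXn : ‖(2 * C) • (1 : Op N) + (1 : ℝ) • (1 : Op N)‖ ≤ 2 * C + 1 :=
    (norm_add_le _ _).trans (add_le_add (norm_smul_one_le (by positivity))
      (norm_smul_one_le zero_le_one))
  have hf := hb.f_le x hx z hz.le p' _
    (isSelfAdjoint_add (isSelfAdjoint_smul_one (2 * C)) (isSelfAdjoint_smul_one 1)) hpn hXn
  have hf' := mul_le_mul_of_nonneg_left (neg_le_of_abs_le hf) (sq_nonneg ε)
  obtain ⟨t, ht0, -, hteq, htf, -, -⟩ := hG.balls.projClosure_add hx d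
  have hth : t * G.h (projClosure G.Ω (x + d)) ≤ t * H := by
    rcases htf with h | ⟨h, -⟩
    · simp [h]
    · exact mul_le_mul_of_nonneg_left (le_of_abs_le (hG.h_le _ h)) ht0
  have hdisc := hb.discount hG e1 (hG.balls.projClosure_mem (x + d))
  simp only [next, loss]
  rw [hteq] at hinc ⊢
  rw [inner_sub_left, sub_apply, inner_sub_left, mul_sub, two_mul_smul_one_quadratic] at hresp
  have hδ : G.χ (projClosure G.Ω (x + d)) - ε ^ 2 * K ≤ G.χ x + (inner ℝ c.1 d +
      1 / 2 * inner ℝ (c.2 d) d + ε ^ 2 * G.f x z c.1 c.2 -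
        t * G.h (projClosure G.Ω (x + d))) := by linarith
  have := mul_le_mul_of_nonneg_left hδ (Real.exp_pos (G.lam * ε ^ 2)).le
  linarith

/-- Helen plays the slope of `-χ` with a matrix negative enough to offset the Taylor error, which
works against every displacement. -/
theorem helen_barrier : ∀ᶠ ε in 𝓝[>] (0 : ℝ), ∀ x ∈ closure G.Ω, ∀ z : ℝ, |z| < G.M →
    ∃ c ∈ G.helenMoves ε, ∀ d ∈ G.markMoves ε,
      (G.next ε (x, z) c d).2 + G.χ (G.next ε (x, z) c d).1 ≤
        Real.exp (G.lam * ε ^ 2) * (z + G.χ x) := by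
  have hC := hb.C_nonneg
  filter_upwards [eventually_pos_lt_one, eventually_exp_mul_le G.lam K, hb.eventually_move_le hG,
    eventually_mul_rpow_le_const hG.β_pos C one_pos,
    eventually_mul_rpow_le_const hG.γ_pos (2 * C) one_pos] with ε ⟨hε, hε1⟩ e1 e2 e3 e4
  intro x hx z hz
  have hXn : ‖(-(2 * C)) • (1 : Op N)‖ ≤ 2 * C := by
    rw [norm_smul, norm_neg, Real.norm_of_nonneg (by positivity)]
    exact mul_le_of_le_one_right (by positivity) ContinuousLinearMap.norm_id_le
  refine ⟨(-P x, (-(2 * C)) • (1 : Op N)), ⟨?_, isSelfAdjoint_smul_one _, ?_⟩, fun d hd => ?_⟩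
  · simp only [norm_neg]
    refine (hb.grad_le x hx).trans ?_
    rw [Real.rpow_neg hε.le, ← one_div, le_div_iff₀ (Real.rpow_pos_of_pos hε _)]; exact e3
  · refine hXn.trans ?_
    rw [Real.rpow_neg hε.le, ← one_div, le_div_iff₀ (Real.rpow_pos_of_pos hε _)]; exact e4
  have hinc := hb.increment x hx d (le_trans hd e2)
  have hf := hb.f_le x hx z hz.le (-P x) _ (isSelfAdjoint_smul_one (-(2 * C)))
    (by rw [norm_neg]; linarith [hb.grad_le x hx]) (by linarith)
  have hf' := mul_le_mul_of_nonneg_left (le_of_abs_le hf) (sq_nonneg ε)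
  obtain ⟨t, ht0, -, hteq, htf, -, -⟩ := hG.balls.projClosure_add hx d
  have hth : -(t * G.h (projClosure G.Ω (x + d))) ≤ t * H := by
    rcases htf with h | ⟨h, -⟩
    · simp [h]
    · have := mul_le_mul_of_nonneg_left (neg_le_of_abs_le (hG.h_le _ h)) ht0
      linarith
  have hdisc := hb.discount hG e1 (hG.balls.projClosure_mem (x + d))
  simp only [next, loss]
  rw [hteq] at hinc ⊢
  rw [inner_neg_left, smul_one_quadratic]
  have hδ : G.χ (projClosure G.Ω (x + d)) - ε ^ 2 * K ≤ G.χ x - (-inner ℝ (P x) d +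
      1 / 2 * (-(2 * C) * ‖d‖ ^ 2) + ε ^ 2 * G.f x z (-P x) ((-(2 * C)) • (1 : Op N)) -
        t * G.h (projClosure G.Ω (x + d))) := by linarith
  have := mul_le_mul_of_nonneg_left hδ (Real.exp_pos (G.lam * ε ^ 2)).le
  linarith

/-- Above `χ` the value function is negative. -/
theorem eventually_U_le : ∀ᶠ ε in 𝓝[>] (0 : ℝ), ∀ x ∈ closure G.Ω, ∀ z : ℝ, G.χ x < z →
    G.U ε x z ≤ G.χ x - z := by
  filter_upwards [eventually_pos_lt_one, hb.mark_barrier hG] with ε ⟨hε, _⟩ hbar x hx z hz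
  have hχ : ∀ x ∈ closure G.Ω, 0 ≤ G.χ x := fun x hx => hb.m_pos.le.trans (hb.le_chi x hx)
  by_cases h : |z| < G.M
  · exact (hb.regular hG).U_le_of_barrier hε hχ hbar hx h hz
  · have := hχ x hx
    rw [U, if_neg h, capped]
    split_ifs <;> linarith

/-- Below `-χ` the value function is positive. -/
theorem eventually_le_U : ∀ᶠ ε in 𝓝[>] (0 : ℝ), ∀ x ∈ closure G.Ω, ∀ z : ℝ, z < -G.χ x →
    -G.χ x - z ≤ G.U ε x z := by
  filter_upwards [eventually_pos_lt_one, hb.helen_barrier hG] with ε ⟨hε, _⟩ hbar x hx z hz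
  have hχ : ∀ x ∈ closure G.Ω, 0 ≤ G.χ x := fun x hx => hb.m_pos.le.trans (hb.le_chi x hx)
  by_cases h : |z| < G.M
  · exact (hb.regular hG).le_U_of_barrier hε hχ hbar hx h hz
  · have h1 := hχ x hx
    have h2 := hb.one_lt_M hG
    rw [U, if_neg h, capped, if_neg (by linarith)]
    linarith

theorem eventually_next_close : ∀ᶠ ε in 𝓝[>] (0 : ℝ), ∀ x ∈ closure G.Ω, ∀ z : ℝ,
    |z| ≤ G.M → ∀ c ∈ G.helenMoves ε, ∀ d ∈ G.markMoves ε,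
      |(G.next ε (x, z) c d).2 - z| ≤ 1 / 8 := by
  have hM : 0 < G.M := one_pos.trans (hb.one_lt_M hG)
  have hl := hG.lam_pos
  filter_upwards [hG.abs_loss_le G.M (show (0 : ℝ) < 1 / 32 by norm_num),
    hG.debt_increment G.M (show (0 : ℝ) < 1 / 32 by norm_num), eventually_pos_lt_one,
    eventually_mul_rpow_le_const (a := 2) two_pos (G.lam * G.M) (show (0 : ℝ) < 1 / 32 by norm_num)]
    with ε h1 h2 ⟨hε, hε1⟩ h3 x hx z hz c hc d hd
  have h4 := abs_le.1 (h1 x hx z hz c hc d hd)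
  have h5 := abs_le.1 (h2 x hx z hz c hc d hd)
  rw [Real.rpow_two] at h3
  have h6 : |ε ^ 2 * (G.lam * z)| ≤ 1 / 32 := by
    rw [abs_mul, abs_mul, abs_of_pos hl, abs_of_nonneg (sq_nonneg ε)]
    have := mul_le_mul_of_nonneg_left (mul_le_mul_of_nonneg_left hz hl.le) (sq_nonneg ε)
    linarith
  have h7 := abs_le.1 h6
  have h8 : ε ^ 2 < 1 := by nlinarith
  rw [abs_le]
  constructor <;> linarith [h4.1, h4.2, h5.1, h5.2, h7.1, h7.2]

/-- While the debt is not close to the caps, the value of a round is the discounted value of the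
next state. -/
theorem eventually_stage_eq : ∀ᶠ ε in 𝓝[>] (0 : ℝ), ∀ x ∈ closure G.Ω, ∀ z : ℝ,
    |z| ≤ G.M - 1 / 4 → ∀ c ∈ G.helenMoves ε, ∀ d ∈ G.markMoves ε,
      G.U ε (G.next ε (x, z) c d).1 (G.next ε (x, z) c d).2 =
        Real.exp (G.lam * ε ^ 2) * G.stage ε (G.U ε) x z c d := by
  filter_upwards [hb.eventually_next_close hG] with ε h1 x hx z hz c hc d hd
  have h2 := abs_le.1 (h1 x hx z (by linarith) c hc d hd)
  have h3 := abs_le.1 hz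
  rw [stage, if_pos (by rw [abs_lt]; constructor <;> linarith [h2.1, h2.2, h3.1, h3.2]),
    ← mul_assoc, ← Real.exp_add, neg_mul, add_neg_cancel, Real.exp_zero, one_mul]

/-- Helen can keep the value function above a given level, up to the discount. -/
theorem eventually_helen_keeps : ∀ᶠ ε in 𝓝[>] (0 : ℝ), ∀ x ∈ closure G.Ω, ∀ z : ℝ,
    |z| ≤ G.M - 1 / 4 → ∀ τ : ℝ, τ < G.U ε x z → ∃ c ∈ G.helenMoves ε, ∀ d ∈ G.markMoves ε,
      Real.exp (G.lam * ε ^ 2) * τ <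
        G.U ε (G.next ε (x, z) c d).1 (G.next ε (x, z) c d).2 := by
  filter_upwards [eventually_pos_lt_one, hb.eventually_stage_eq hG] with ε ⟨hε, _⟩ h1 x hx z hz τ hτ
  have hz' : |z| < G.M := by linarith
  have : Nonempty (G.helenMoves ε) := ⟨⟨_, G.zero_mem_helenMoves ε hε⟩⟩
  rw [(hb.regular hG).U_eq hε hx hz'] at hτ
  obtain ⟨c, hc⟩ := exists_of_lt_supInf
    (fun c d => (hb.regular hG).abs_stage_U_le hε hx hz' _ _) hτ
  refine ⟨c, c.2, fun d hd => ?_⟩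
  rw [h1 x hx z hz c c.2 d hd]
  exact mul_lt_mul_of_pos_left (hc ⟨d, hd⟩) (Real.exp_pos _)

/-- Mark can keep the value function below a given level, up to the discount. -/
theorem eventually_mark_keeps : ∀ᶠ ε in 𝓝[>] (0 : ℝ), ∀ x ∈ closure G.Ω, ∀ z : ℝ,
    |z| ≤ G.M - 1 / 4 → ∀ τ : ℝ, G.U ε x z < τ → ∀ c ∈ G.helenMoves ε, ∃ d ∈ G.markMoves ε,
      G.U ε (G.next ε (x, z) c d).1 (G.next ε (x, z) c d).2 <
        Real.exp (G.lam * ε ^ 2) * τ := by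
  filter_upwards [eventually_pos_lt_one, hb.eventually_stage_eq hG]
    with ε ⟨hε, _⟩ h1 x hx z hz τ hτ c hc
  have hz' : |z| < G.M := by linarith
  have : Nonempty (G.markMoves ε) := ⟨⟨0, G.zero_mem_markMoves ε hε⟩⟩
  rw [(hb.regular hG).U_eq hε hx hz'] at hτ
  obtain ⟨d, hd⟩ := exists_of_supInf_lt
    (fun c d => (hb.regular hG).abs_stage_U_le hε hx hz' _ _) hτ ⟨c, hc⟩
  refine ⟨d, d.2, ?_⟩
  rw [h1 x hx z hz c hc d d.2]
  exact mul_lt_mul_of_pos_left hd (Real.exp_pos _)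

theorem eventually_wellDefined : ∀ᶠ ε in 𝓝[>] (0 : ℝ), G.WellDefined ε ∧
    ∀ x ∈ closure G.Ω, |G.u ε x| ≤ G.χ x ∧ |G.v ε x| ≤ G.χ x := by
  filter_upwards [eventually_pos_lt_one, hb.eventually_U_le hG, hb.eventually_le_U hG,
    eventually_mul_rpow_le_const (a := 1 - G.α) (by linarith [hG.α_lt]) 1
      (show 0 < ρ / 2 by have := hG.balls.pos; positivity)] with ε ⟨hε, _⟩ h1 h2 h3
  have hr := hb.regular hG
  have hu : ∀ x ∈ closure G.Ω, G.χ x ∈ upperBounds {z | 0 < G.U ε x z} := by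
    intro x hx z hz
    by_contra! h
    have h4 : 0 < G.U ε x z := hz
    linarith [h1 x hx z h]
  have hv : ∀ x ∈ closure G.Ω, -G.χ x ∈ lowerBounds {z | G.U ε x z < 0} := by
    intro x hx z hz
    by_contra! h
    have h4 : G.U ε x z < 0 := hz
    linarith [h2 x hx z h]
  have hu' : ∀ x ∈ closure G.Ω, ∀ z < -G.χ x, z ∈ {z | 0 < G.U ε x z} := by
    intro x hx z hz
    have := h2 x hx z hz
    show 0 < G.U ε x z
    linarith
  have hv' : ∀ x ∈ closure G.Ω, ∀ z > G.χ x, z ∈ {z | G.U ε x z < 0} := by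
    intro x hx z hz
    have := h1 x hx z hz
    show G.U ε x z < 0
    linarith
  refine ⟨⟨fun x hx d hd => ?_, ⟨_, fun x hx z hz => hr.abs_U_le hε hx hz⟩,
    fun x hx z hz => hr.U_eq hε hx hz, fun W hWb hW => hr.U_unique hε hWb hW,
    fun x hx => ⟨_, hu' x hx _ (sub_one_lt _)⟩, fun x hx => ⟨_, hu x hx⟩,
    fun x hx => ⟨_, hv' x hx _ (lt_add_one _)⟩, fun x hx => ⟨_, hv x hx⟩⟩,
    fun x hx => ⟨abs_le.2 ⟨?_, ?_⟩, abs_le.2 ⟨?_, ?_⟩⟩⟩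
  · have h4 : ‖d‖ ≤ ε ^ (1 - G.α) := hd
    exact hG.balls.existsUnique_isNearest hx (by linarith [hG.balls.pos])
  · exact le_of_forall_lt fun z hz => lt_of_lt_of_le (by linarith : z < (z + -G.χ x) / 2)
      (le_csSup ⟨_, hu x hx⟩ (hu' x hx _ (by linarith)))
  · exact csSup_le ⟨_, hu' x hx _ (sub_one_lt _)⟩ (hu x hx)
  · exact le_csInf ⟨_, hv' x hx _ (lt_add_one _)⟩ (hv x hx)
  · exact le_of_forall_gt fun z hz => lt_of_le_of_lt
      (csInf_le ⟨_, hv x hx⟩ (hv' x hx _ (by show G.χ x < (z + G.χ x) / 2; linarith)))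
      (by linarith : (z + G.χ x) / 2 < z)

end Barrier

end NeumannGame

/-! ### The relaxed limits of the game values -/

section Filters

variable {N : ℕ} {S : Set (Euc N)}

theorem map_snd_prodMap {ι : Type*} (l : Filter ι) (x : Euc N) :
    map (Prod.map Prod.snd id) (((atTop : Filter ℝ) ×ˢ l) ×ˢ 𝓝[S] x) = l ×ˢ 𝓝[S] x := by
  rw [← prod_map_map_eq', map_snd_prod, map_id]

/-- No boundedness is needed: in the reals the infimum of a set is by definition minus the supremum
of its negative. -/
theorem neg_liminf_eq {ι : Type*} (l : Filter ι) (g : ι → ℝ) :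
    -liminf g l = limsup (fun i => -g i) l := by
  rw [limsup_eq, liminf_eq, Real.sInf_def]
  congr 2
  ext a
  simp

/-- The upper limit as `ε → 0⁺` and `y → x`, seen as a relaxed limit. -/
theorem isRelaxedUpper_limsup_prod {T : ℝ → Euc N → ℝ} {B : ℝ}
    (hB : ∀ᶠ ε in 𝓝[>] (0 : ℝ), ∀ y ∈ S, |T ε y| ≤ B) :
    IsRelaxedUpper S (fun _ => T) fun x =>
      limsup (fun e : ℝ × Euc N => T e.1 e.2) (𝓝[>] (0 : ℝ) ×ˢ 𝓝[S] x) := by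
  have h := isRelaxedUpper_limsup (S := S) (T := fun _ => T) (s₀ := 0)
    (hB.mono fun ε h _ _ y hy => h y hy)
  convert h using 2 with x
  rw [← map_snd_prodMap]
  rfl

theorem tendstoLocallyUniformlyOn_of_eventually {T : ℝ → Euc N → ℝ} {w : Euc N → ℝ}
    (hw : ContinuousOn w S) (h : ∀ x ∈ S, ∀ η : ℝ, 0 < η →
      ∀ᶠ e in ((atTop : Filter ℝ) ×ˢ 𝓝[>] (0 : ℝ)) ×ˢ 𝓝[S] x, |T e.1.2 e.2 - w x| < η) :
    TendstoLocallyUniformlyOn T w (𝓝[>] 0) S := by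
  rw [Metric.tendstoLocallyUniformlyOn_iff]
  intro η hη x hx
  have h1 : ∀ᶠ e in 𝓝[>] (0 : ℝ) ×ˢ 𝓝[S] x, |T e.1 e.2 - w x| < η / 2 := by
    rw [← map_snd_prodMap, eventually_map]
    exact h x hx (η / 2) (by positivity)
  obtain ⟨pa, ha, pb, hb, hab⟩ := eventually_prod_iff.1 h1
  have h2 := Metric.tendsto_nhds.1 (hw x hx) (η / 2) (by positivity)
  refine ⟨_, hb.and h2, ha.mono fun ε hε y hy => ?_⟩
  have h3 := hab hε hy.1
  have h4 : dist (w y) (w x) < η / 2 := hy.2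
  rw [Real.dist_eq] at h4 ⊢
  rw [abs_lt] at h3 h4 ⊢
  simp only at h3
  constructor <;> linarith [h3.1, h3.2, h4.1, h4.2]

/-- The two semi-limits will be known to agree only on the closure, although they are functions on
the whole space. -/
theorem IsViscSuper.congr {Ω : Set (Euc N)} {f : Euc N → ℝ → Euc N → Op N → ℝ} {lam : ℝ}
    {h u v : Euc N → ℝ} (hu : IsViscSuper Ω f lam h u) (huv : EqOn v u (closure Ω)) :
    IsViscSuper Ω f lam h v := by
  have key : ∀ x ∈ closure Ω, ∀ φ : Euc N → ℝ, IsLocalMinOn (fun y => v y - φ y) (closure Ω) x →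
      IsLocalMinOn (fun y => u y - φ y) (closure Ω) x := by
    intro x hx φ hmin
    filter_upwards [hmin, self_mem_nhdsWithin] with y hy hyΩ
    rwa [huv hyΩ, huv hx] at hy
  refine ⟨fun x hx y hy => ?_, fun x hx φ hφ hmin => ?_, fun x hx φ hφ hmin => ?_⟩
  · have hy' : y < u x := by rw [← huv hx]; exact hy
    filter_upwards [hu.lsc x hx y hy', self_mem_nhdsWithin] with x' hx' hxΩ
    show y < v x'
    rw [huv hxΩ]
    exact hx'
  · rw [huv (subset_closure hx)]
    exact hu.interior x hx φ hφ (key x (subset_closure hx) φ hmin)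
  · rw [huv (frontier_subset_closure hx)]
    exact hu.boundary x hx φ hφ (key x (frontier_subset_closure hx) φ hmin)

theorem exp_neg_le_half {s : ℝ} (hs : 1 ≤ s) : Real.exp (-s) ≤ 1 / 2 := by
  have h1 := Real.add_one_le_exp s
  rw [Real.exp_neg, ← one_div]
  exact one_div_le_one_div_of_le two_pos (by linarith)

end Filters

/-! ### Debts at exponentially small levels, and convergence. -/

namespace NeumannGame

variable {N : ℕ}

/-- The largest debt for which the value of the game is at least `-e^{-s}`. -/
def upperDebt (G : NeumannGame N) (s ε : ℝ) (x : Euc N) : ℝ := sSup {z | -Real.exp (-s) ≤ G.U ε x z}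

/-- The smallest debt for which the value of the game is at most `e^{-s}`. -/
def lowerDebt (G : NeumannGame N) (s ε : ℝ) (x : Euc N) : ℝ := sInf {z | G.U ε x z ≤ Real.exp (-s)}

namespace Barrier

variable {G : NeumannGame N} {q r ρ H : ℝ} {P : Euc N → Euc N} {C s₀ m K : ℝ}
  (hb : G.Barrier H P C s₀ m K) (hG : G.Setting q r ρ H)
include hb hG

/-- Common bounds for `u` and `upperDebt`. Since `χ ≤ M - 1`, a debt above `M - 1/2` has value below
`-1/2`; staying this far from the caps keeps the next round from stopping. -/
theorem eventually_sSup_bound : ∀ᶠ ε in 𝓝[>] (0 : ℝ), ∀ x ∈ closure G.Ω, ∀ A : Set ℝ,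
    {z | 0 < G.U ε x z} ⊆ A → A ⊆ {z | -(1 / 2) ≤ G.U ε x z} →
      A.Nonempty ∧ BddAbove A ∧ |sSup A| ≤ G.M - 1 / 2 := by
  filter_upwards [hb.eventually_U_le hG, hb.eventually_le_U hG] with ε h1 h2 x hx A hA hA'
  have hχ := hb.chi_le x hx
  have hm := hb.le_chi x hx
  have hm0 := hb.m_pos
  have hmem : -G.χ x - 1 / 4 ∈ A := hA (by
    have := h2 x hx (-G.χ x - 1 / 4) (by linarith)
    show 0 < G.U ε x _
    linarith)
  have hub : G.M - 1 / 2 ∈ upperBounds A := by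
    intro z hz
    by_contra! h
    have h3 : -(1 / 2) ≤ G.U ε x z := hA' hz
    linarith [h1 x hx z (by linarith)]
  refine ⟨⟨_, hmem⟩, ⟨_, hub⟩, abs_le.2 ⟨?_, csSup_le ⟨_, hmem⟩ hub⟩⟩
  linarith [le_csSup ⟨_, hub⟩ hmem]

theorem eventually_sInf_bound : ∀ᶠ ε in 𝓝[>] (0 : ℝ), ∀ x ∈ closure G.Ω, ∀ A : Set ℝ,
    {z | G.U ε x z < 0} ⊆ A → A ⊆ {z | G.U ε x z ≤ 1 / 2} →
      A.Nonempty ∧ BddBelow A ∧ |sInf A| ≤ G.M - 1 / 2 := by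
  filter_upwards [hb.eventually_U_le hG, hb.eventually_le_U hG] with ε h1 h2 x hx A hA hA'
  have hχ := hb.chi_le x hx
  have hm := hb.le_chi x hx
  have hm0 := hb.m_pos
  have hmem : G.χ x + 1 / 4 ∈ A := hA (by
    have := h1 x hx (G.χ x + 1 / 4) (by linarith)
    show G.U ε x _ < 0
    linarith)
  have hlb : -(G.M - 1 / 2) ∈ lowerBounds A := by
    intro z hz
    by_contra! h
    have h3 : G.U ε x z ≤ 1 / 2 := hA' hz
    linarith [h2 x hx z (by linarith)]
  refine ⟨⟨_, hmem⟩, ⟨_, hlb⟩, abs_le.2 ⟨le_csInf ⟨_, hmem⟩ hlb, ?_⟩⟩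
  linarith [csInf_le ⟨_, hlb⟩ hmem]

/-- The level zero is unaffected by the discount, so the family is constant in `s` and the value of
`a` is immaterial. -/
theorem isViscSub_of_u {W : Euc N → ℝ} (hW : IsRelaxedUpper (closure G.Ω) (fun _ => G.u) W) :
    IsViscSub G.Ω G.f G.lam G.h W := by
  refine hG.isViscSub_of_family (A := fun _ ε y => {z | 0 < G.U ε y z}) (B := G.M - 1 / 2)
    (s₀ := 0) (a := 1) one_pos hW ?_ ?_
  · filter_upwards [hb.eventually_sSup_bound hG] with ε h s _ y hy
    obtain ⟨h1, h2, h3⟩ := h y hy {z | 0 < G.U ε y z} subset_rfl fun z (hz : 0 < G.U ε y z) => by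
      show -(1 / 2) ≤ G.U ε y z
      linarith
    exact ⟨h1, h2, h3, fun _ _ => subset_rfl⟩
  · filter_upwards [hb.eventually_helen_keeps hG] with ε h s _ x hx z hz hzB
    obtain ⟨c, hc, h1⟩ := h x hx z (by linarith) 0 hz
    refine ⟨c, hc, fun d hd => ?_⟩
    have := h1 d hd
    rwa [mul_zero] at this

theorem isViscSuper_of_v {W : Euc N → ℝ}
    (hW : IsRelaxedUpper (closure G.Ω) (fun _ ε y => -G.v ε y) fun x => -W x) :
    IsViscSuper G.Ω G.f G.lam G.h W := by
  refine hG.isViscSuper_of_family (A := fun _ ε y => {z | G.U ε y z < 0}) (B := G.M - 1 / 2)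
    (s₀ := 0) (a := 1) one_pos hW ?_ ?_
  · filter_upwards [hb.eventually_sInf_bound hG] with ε h s _ y hy
    obtain ⟨h1, h2, h3⟩ := h y hy {z | G.U ε y z < 0} subset_rfl fun z (hz : G.U ε y z < 0) => by
      show G.U ε y z ≤ 1 / 2
      linarith
    exact ⟨h1, h2, h3, fun _ _ => subset_rfl⟩
  · filter_upwards [hb.eventually_mark_keeps hG] with ε h s _ x hx z hz hzB c hc
    obtain ⟨d, hd, h1⟩ := h x hx z (by linarith) 0 hz c hc
    refine ⟨d, hd, ?_⟩
    rwa [mul_zero] at h1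

theorem eventually_upperDebt_bound : ∀ᶠ ε in 𝓝[>] (0 : ℝ), ∀ s ≥ (1 : ℝ), ∀ y ∈ closure G.Ω,
    {z | -Real.exp (-s) ≤ G.U ε y z}.Nonempty ∧ BddAbove {z | -Real.exp (-s) ≤ G.U ε y z} ∧
      |G.upperDebt s ε y| ≤ G.M - 1 / 2 := by
  filter_upwards [hb.eventually_sSup_bound hG] with ε h s hs y hy
  have h1 := exp_neg_le_half hs
  have h2 := Real.exp_pos (-s)
  refine h y hy _ (fun z (hz : 0 < G.U ε y z) => ?_) fun z (hz : -Real.exp (-s) ≤ G.U ε y z) => ?_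
  · show -Real.exp (-s) ≤ G.U ε y z
    linarith
  · show -(1 / 2) ≤ G.U ε y z
    linarith

theorem eventually_lowerDebt_bound : ∀ᶠ ε in 𝓝[>] (0 : ℝ), ∀ s ≥ (1 : ℝ), ∀ y ∈ closure G.Ω,
    {z | G.U ε y z ≤ Real.exp (-s)}.Nonempty ∧ BddBelow {z | G.U ε y z ≤ Real.exp (-s)} ∧
      |G.lowerDebt s ε y| ≤ G.M - 1 / 2 := by
  filter_upwards [hb.eventually_sInf_bound hG] with ε h s hs y hy
  have h1 := exp_neg_le_half hs
  have h2 := Real.exp_pos (-s)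
  refine h y hy _ (fun z (hz : G.U ε y z < 0) => ?_) fun z (hz : G.U ε y z ≤ Real.exp (-s)) => ?_
  · show G.U ε y z ≤ Real.exp (-s)
    linarith
  · show G.U ε y z ≤ 1 / 2
    linarith

/-- Removing the discount multiplies the level by `e^{λε²}`; a second such factor supplies the
strict inequality needed to select Helen's move. Hence the shift `2λε²` of `s`. -/
theorem isViscSub_of_upperDebt {W : Euc N → ℝ}
    (hW : IsRelaxedUpper (closure G.Ω) G.upperDebt W) : IsViscSub G.Ω G.f G.lam G.h W := by
  have hl := hG.lam_pos
  refine hG.isViscSub_of_family (A := fun s ε y => {z | -Real.exp (-s) ≤ G.U ε y z})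
    (B := G.M - 1 / 2) (s₀ := 1) (a := 2 * G.lam) (by positivity) hW ?_ ?_
  · filter_upwards [hb.eventually_upperDebt_bound hG] with ε h s hs y hy
    obtain ⟨h1, h2, h3⟩ := h s hs y hy
    refine ⟨h1, h2, h3, fun s' hs' z (hz : -Real.exp (-s') ≤ _) => ?_⟩
    have := Real.exp_le_exp.2 (neg_le_neg hs')
    show -Real.exp (-s) ≤ G.U ε y z
    linarith
  · filter_upwards [eventually_pos_lt_one, hb.eventually_helen_keeps hG]
      with ε ⟨hε, _⟩ h s _ x hx z (hz : -Real.exp (-s) ≤ _) hzB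
    have h0 : 0 < G.lam * ε ^ 2 := by positivity
    obtain ⟨c, hc, h1⟩ := h x hx z (by linarith) (-Real.exp (G.lam * ε ^ 2 - s)) (by
      have : Real.exp (-s) < Real.exp (G.lam * ε ^ 2 - s) := Real.exp_lt_exp.2 (by linarith)
      linarith)
    refine ⟨c, hc, fun d hd => ?_⟩
    have h2 := h1 d hd
    rw [mul_neg, ← Real.exp_add,
      show G.lam * ε ^ 2 + (G.lam * ε ^ 2 - s) = -(s - 2 * G.lam * ε ^ 2) by ring] at h2
    exact h2.le

theorem isViscSuper_of_lowerDebt {W : Euc N → ℝ}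
    (hW : IsRelaxedUpper (closure G.Ω) (fun s ε y => -G.lowerDebt s ε y) fun x => -W x) :
    IsViscSuper G.Ω G.f G.lam G.h W := by
  have hl := hG.lam_pos
  refine hG.isViscSuper_of_family (A := fun s ε y => {z | G.U ε y z ≤ Real.exp (-s)})
    (B := G.M - 1 / 2) (s₀ := 1) (a := 2 * G.lam) (by positivity) hW ?_ ?_
  · filter_upwards [hb.eventually_lowerDebt_bound hG] with ε h s hs y hy
    obtain ⟨h1, h2, h3⟩ := h s hs y hy
    refine ⟨h1, h2, h3, fun s' hs' z (hz : _ ≤ Real.exp (-s')) => ?_⟩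
    have := Real.exp_le_exp.2 (neg_le_neg hs')
    show G.U ε y z ≤ Real.exp (-s)
    linarith
  · filter_upwards [eventually_pos_lt_one, hb.eventually_mark_keeps hG]
      with ε ⟨hε, _⟩ h s _ x hx z (hz : _ ≤ Real.exp (-s)) hzB c hc
    have h0 : 0 < G.lam * ε ^ 2 := by positivity
    obtain ⟨d, hd, h1⟩ := h x hx z (by linarith) (Real.exp (G.lam * ε ^ 2 - s))
      (hz.trans_lt (Real.exp_lt_exp.2 (by linarith))) c hc
    refine ⟨d, hd, ?_⟩
    rw [← Real.exp_add,
      show G.lam * ε ^ 2 + (G.lam * ε ^ 2 - s) = -(s - 2 * G.lam * ε ^ 2) by ring] at h1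
    exact h1.le

/-- Every debt above `upperDebt` has negative value, and every debt below `lowerDebt` has positive
value. Monotonicity of `U` in `z` is not needed. -/
theorem eventually_debts_compare : ∀ᶠ ε in 𝓝[>] (0 : ℝ), ∀ s ≥ (1 : ℝ), ∀ y ∈ closure G.Ω,
    G.v ε y ≤ G.upperDebt s ε y ∧ G.lowerDebt s ε y ≤ G.u ε y := by
  filter_upwards [hb.eventually_wellDefined hG, hb.eventually_upperDebt_bound hG,
    hb.eventually_lowerDebt_bound hG] with ε hwd h1 h2 s hs y hy
  have h0 := Real.exp_pos (-s)
  constructor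
  · refine le_of_forall_gt_imp_ge_of_dense fun z hz => csInf_le (hwd.1.v_bddBelow y hy) ?_
    have h3 := notMem_of_csSup_lt hz (h1 s hs y hy).2.1
    have h4 : G.U ε y z < -Real.exp (-s) := not_le.1 h3
    show G.U ε y z < 0
    linarith
  · refine le_of_forall_lt_imp_le_of_dense fun z hz => le_csSup (hwd.1.u_bddAbove y hy) ?_
    have h3 := notMem_of_lt_csInf hz (h2 s hs y hy).2.1
    have h4 : Real.exp (-s) < G.U ε y z := not_le.1 h3
    show 0 < G.U ε y z
    linarith

theorem eventually_abs_u_le : ∀ᶠ ε in 𝓝[>] (0 : ℝ), ∀ y ∈ closure G.Ω, |G.u ε y| ≤ G.M :=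
  (hb.eventually_wellDefined hG).mono fun ε h y hy => by
    linarith [(h.2 y hy).1, hb.chi_le y hy]

theorem eventually_abs_neg_v_le : ∀ᶠ ε in 𝓝[>] (0 : ℝ), ∀ y ∈ closure G.Ω, |-G.v ε y| ≤ G.M :=
  (hb.eventually_wellDefined hG).mono fun ε h y hy => by
    rw [abs_neg]; linarith [(h.2 y hy).2, hb.chi_le y hy]

theorem isRelaxedUpper_ubar : IsRelaxedUpper (closure G.Ω) (fun _ => G.u) G.ubar :=
  isRelaxedUpper_limsup_prod (hb.eventually_abs_u_le hG)

theorem isRelaxedUpper_neg_vbar :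
    IsRelaxedUpper (closure G.Ω) (fun _ ε y => -G.v ε y) fun x => -G.vbar x := by
  have h := isRelaxedUpper_limsup_prod (hb.eventually_abs_neg_v_le hG)
  convert h using 2 with x
  exact neg_liminf_eq _ _

theorem isViscSub_ubar : IsViscSub G.Ω G.f G.lam G.h G.ubar :=
  hb.isViscSub_of_u hG (hb.isRelaxedUpper_ubar hG)

theorem isViscSuper_vbar : IsViscSuper G.Ω G.f G.lam G.h G.vbar :=
  hb.isViscSuper_of_v hG (hb.isRelaxedUpper_neg_vbar hG)

/-- Under comparison, the relaxed limits coincide with the unique viscosity solution, to which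
`u^ε` and `v^ε` converge. -/
theorem exists_solution {𝒞 : Set (Euc N → ℝ)} (h𝒞 : {w | BoundedOn (closure G.Ω) w} ⊆ 𝒞)
    (hle : ∀ x ∈ closure G.Ω, G.vbar x ≤ G.ubar x)
    (hcomp : ComparisonPrinciple G.Ω G.f G.lam G.h 𝒞) :
    ∃ w ∈ 𝒞, IsViscSol G.Ω G.f G.lam G.h w ∧
      (∀ w' ∈ 𝒞, IsViscSol G.Ω G.f G.lam G.h w' → EqOn w' w (closure G.Ω)) ∧
      TendstoLocallyUniformlyOn (fun ε => G.u ε) w (𝓝[>] 0) (closure G.Ω) ∧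
      TendstoLocallyUniformlyOn (fun ε => G.v ε) w (𝓝[>] 0) (closure G.Ω) := by
  have hu := hb.isRelaxedUpper_ubar hG
  have hv := hb.isRelaxedUpper_neg_vbar hG
  have hubd : ∀ᶠ ε in 𝓝[>] (0 : ℝ), ∀ s ≥ (1 : ℝ), ∀ y ∈ closure G.Ω,
      |G.upperDebt s ε y| ≤ G.M - 1 / 2 :=
    (hb.eventually_upperDebt_bound hG).mono fun ε h s hs y hy => (h s hs y hy).2.2
  have hlbd : ∀ᶠ ε in 𝓝[>] (0 : ℝ), ∀ s ≥ (1 : ℝ), ∀ y ∈ closure G.Ω,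
      |-G.lowerDebt s ε y| ≤ G.M - 1 / 2 :=
    (hb.eventually_lowerDebt_bound hG).mono fun ε h s hs y hy => by
      rw [abs_neg]; exact (h s hs y hy).2.2
  obtain ⟨W₁, hW₁⟩ : ∃ W, IsRelaxedUpper (closure G.Ω) G.upperDebt W :=
    ⟨_, isRelaxedUpper_limsup hubd⟩
  obtain ⟨W₂, hW₂⟩ : ∃ W : Euc N → ℝ,
      IsRelaxedUpper (closure G.Ω) (fun s ε y => -G.lowerDebt s ε y) fun x => -W x :=
    ⟨fun x => -_, by simpa only [neg_neg] using isRelaxedUpper_limsup hlbd⟩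
  have hu𝒞 : G.ubar ∈ 𝒞 := h𝒞 ⟨G.M, fun x hx => hu.abs_le (s₀ := 0)
    ((hb.eventually_abs_u_le hG).mono fun ε h _ _ => h) hx⟩
  have hv𝒞 : G.vbar ∈ 𝒞 := h𝒞 ⟨G.M, fun x hx => by
    rw [← abs_neg]
    exact hv.abs_le (s₀ := 0) ((hb.eventually_abs_neg_v_le hG).mono fun ε h _ _ => h) hx⟩
  have hW₁𝒞 : W₁ ∈ 𝒞 := h𝒞 ⟨_, fun x hx => hW₁.abs_le hubd hx⟩
  have hW₂𝒞 : W₂ ∈ 𝒞 := h𝒞 ⟨_, fun x hx => by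
    rw [← abs_neg]
    exact hW₂.abs_le hlbd hx⟩
  have husub := hb.isViscSub_ubar hG
  have hvsup := hb.isViscSuper_vbar hG
  -- Comparison caps the relaxed limit of `upperDebt`, hence the upper limit of `v`, by `vbar`; the
  -- next line is the mirror bound for `u`.
  have hle₁ := hcomp _ hW₁𝒞 _ hv𝒞 (hb.isViscSub_of_upperDebt hG hW₁) hvsup
  have hle₂ := hcomp _ hu𝒞 _ hW₂𝒞 husub (hb.isViscSuper_of_lowerDebt hG hW₂)
  have heq : EqOn G.ubar G.vbar (closure G.Ω) := fun x hx =>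
    le_antisymm (hcomp _ hu𝒞 _ hv𝒞 husub hvsup x hx) (hle x hx)
  have husup : IsViscSuper G.Ω G.f G.lam G.h G.ubar := hvsup.congr heq
  have hcont : ContinuousOn G.ubar (closure G.Ω) :=
    continuousOn_iff_lower_upperSemicontinuousOn.2 ⟨husup.lsc, husub.usc⟩
  have hcmp : ∀ x, ∀ᶠ e in ((atTop : Filter ℝ) ×ˢ 𝓝[>] (0 : ℝ)) ×ˢ 𝓝[closure G.Ω] x,
      G.v e.1.2 e.2 ≤ G.upperDebt e.1.1 e.1.2 e.2 ∧ G.lowerDebt e.1.1 e.1.2 e.2 ≤ G.u e.1.2 e.2 := by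
    intro x
    filter_upwards [(eventually_ge_atTop 1).prod_mk (hb.eventually_debts_compare hG) |>.prod_mk
      self_mem_nhdsWithin] with e he
    exact he.1.2 _ he.1.1 _ he.2
  refine ⟨G.ubar, hu𝒞, ⟨hcont, husub, husup⟩, fun w' hw' hsol x hx => le_antisymm
    (hcomp _ hw' _ hu𝒞 hsol.sub husup x hx) (hcomp _ hu𝒞 _ hw' husub hsol.super x hx),
    tendstoLocallyUniformlyOn_of_eventually hcont fun x hx η hη => ?_,
    tendstoLocallyUniformlyOn_of_eventually hcont fun x hx η hη => ?_⟩
  -- The upper bound on `u` is the definition of `ubar`; the lower bound passes through `lowerDebt`,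
  -- whose relaxed limit is at least `ubar`.
  · filter_upwards [hcmp x, (hu x hx η hη).1, (hW₂ x hx η hη).1] with e h1 h2 h3
    rw [abs_lt]
    constructor <;> linarith [h1.2, hle₂ x hx]
  · filter_upwards [hcmp x, (hv x hx η hη).1, (hW₁ x hx η hη).1] with e h1 h2 h3
    have h4 := heq hx
    rw [abs_lt]
    constructor <;> linarith [h1.1, hle₁ x hx]

end Barrier

end NeumannGame

/-! ### The game of the theorem -/

section SupNorm

variable {N : ℕ} {S : Set (Euc N)} {g : Euc N → ℝ}

theorem le_supNormOn (hb : BoundedOn S g) {x : Euc N} (hx : x ∈ S) : |g x| ≤ supNormOn S g := by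
  obtain ⟨C, hC⟩ := hb
  exact le_ciSup (f := fun y : S => |g y|) ⟨C, by rintro _ ⟨y, rfl⟩; exact hC y y.2⟩ ⟨x, hx⟩

theorem supNormOn_nonneg : 0 ≤ supNormOn S g := Real.iSup_nonneg fun _ => abs_nonneg _

end SupNorm

/-- For a large debt cap `M`, the function `χ` is a barrier. -/
theorem exists_barrier {N : ℕ} {Ω : Set (Euc N)} {f : Euc N → ℝ → Euc N → Op N → ℝ} {h : Euc N → ℝ}
    {lam q r ρ H : ℝ} (α β γ : ℝ) {ψ : Euc N → ℝ} (hT : TangentBalls Ω ρ) (hlam : 0 < lam)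
    (hf : NonlinearityHyp Ω f lam q r) (hψ : IsCb2 Ω ψ)
    (hψn : ∀ x ∈ frontier Ω, inner ℝ (gradient ψ x) (outwardNormal Ω x) = H + 1) :
    ∃ M₀ : ℝ, 0 < M₀ ∧ ∀ M > M₀, ∃ C s₀ K : ℝ,
      (neumannGame Ω f h lam α β γ ψ M).Barrier H (gradient ψ) C s₀
        (M - 1 - 2 * supNormOn (closure Ω) ψ) K := by
  obtain ⟨C, s₀, hC, hs₀, hinc⟩ := hT.exists_increment_le hψ hψn
  obtain ⟨η, hη, hgrow⟩ := hf.growth_z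
  obtain ⟨D, hD, hfD⟩ := hgrow (2 * C + 1) (by positivity)
  have hΨ : ∀ x ∈ closure Ω, |ψ x| ≤ supNormOn (closure Ω) ψ := fun x hx =>
    le_supNormOn ⟨C, fun y hy => (hinc y hy).1⟩ hx
  have hΨ0 : 0 ≤ supNormOn (closure Ω) ψ := supNormOn_nonneg
  generalize hΨdef : supNormOn (closure Ω) ψ = Ψ at hΨ hΨ0 ⊢
  have hμ : 0 < min η lam := lt_min hη hlam
  -- The slope `λ - η` may be negative; with its positive part as slope, the margin left by the
  -- discount rate is `min η λ`.
  have hμ' : lam - max (lam - η) 0 = min η lam := by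
    rcases le_total η lam with h | h
    · rw [max_eq_left (by linarith), min_eq_left h]; ring
    · rw [max_eq_right (by linarith), min_eq_right h]; ring
  -- Chosen so that `λm = λ(M - 1 - 2Ψ)` exceeds the bound `max (λ - η) 0 * M + D` on `f` by at
  -- least `1`, and so that `m > 0`.
  refine ⟨2 + 2 * Ψ + (lam * (1 + 2 * Ψ) + D + 1) / min η lam, by positivity, fun M hM => ?_⟩
  have hM1 : 2 + 2 * Ψ < M := by
    have : 0 ≤ (lam * (1 + 2 * Ψ) + D + 1) / min η lam := by positivity
    linarith
  have hM2 : lam * (1 + 2 * Ψ) + D + 1 ≤ M * min η lam := by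
    rw [← div_le_iff₀ hμ]; linarith
  have hχ : ∀ x, (neumannGame Ω f h lam α β γ ψ M).χ x = M - 1 - 2 * Ψ + Ψ + ψ x := fun x => by
    simp only [neumannGame, chi, hΨdef]
  refine ⟨C, s₀, max (lam - η) 0 * M + D, hC, hs₀, by linarith, fun x hx => (hinc x hx).2.1,
    fun x hx d hd => ?_, fun x hx z hz p Γ hΓ hp hΓ' => ?_, ?_, fun x hx => ?_, fun x hx => ?_⟩
  · have := (hinc x hx).2.2 d hd
    rw [hχ, hχ]
    change _ ≤ inner ℝ (gradient ψ x) d + C * ‖d‖ ^ 2 - ‖x + d - projClosure Ω (x + d)‖ * H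
    change M - 1 - 2 * Ψ + Ψ + ψ (projClosure Ω (x + d)) - _ ≤ _
    linarith
  · refine (hfD x hx z p Γ hΓ (max_le hp hΓ')).trans (add_le_add_left ?_ D)
    exact (mul_le_mul_of_nonneg_right (le_max_left _ _) (abs_nonneg z)).trans
      (mul_le_mul_of_nonneg_left hz (le_max_right _ _))
  · change max (lam - η) 0 * M + D + 1 ≤ lam * (M - 1 - 2 * Ψ)
    rw [← hμ'] at hM2
    linarith
  · rw [hχ]; linarith [neg_le_of_abs_le (hΨ x hx)]
  · rw [hχ]
    change _ ≤ M - 1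
    linarith [le_of_abs_le (hΨ x hx)]

end
theorem theorem2p2 (N : ℕ) (hN : 0 < N)
    (Ω : Set (Euc N)) (hΩ : IsC2Domain Ω)
    (hint : UniformInteriorBall Ω) (hext : UniformExteriorBall Ω)
    (f : Euc N → ℝ → Euc N → Op N → ℝ) (h : Euc N → ℝ) (lam q r : ℝ)
    (hlam : 0 < lam) (hq : 1 ≤ q) (hr : 1 ≤ r)
    (hf : NonlinearityHyp Ω f lam q r)
    (hh : ContinuousOn h (frontier Ω)) (hhb : BoundedOn (frontier Ω) h)
    (α β γ : ℝ) (hα : 0 < α) (hβ : 0 < β) (hγ : 0 < γ)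
    (hα3 : α < 1 / 3)
    (hαβ : α + β < 1) (hαγ : 2 * α + γ < 2) (hβγ : max (β * q) (γ * r) < 2)
    (hγα : γ < 1 - α) (hβq : β * (q - 1) < α + 1)
    (hγr₁ : γ * (r - 1) < 2 * α) (hγr₂ : γ * r < 1 + α)
    (ψ : Euc N → ℝ) (hψ : IsCb2 Ω ψ)
    (hψn : ∀ x ∈ frontier Ω,
      inner ℝ (gradient ψ x) (outwardNormal Ω x) = supNormOn (frontier Ω) h + 1) :
    ∃ M₀ : ℝ, 0 < M₀ ∧ ∀ M > M₀,
      0 < M - 1 - 2 * supNormOn (closure Ω) ψ ∧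
      (∃ ε₀ : ℝ, 0 < ε₀ ∧ ∀ ε : ℝ, 0 < ε → ε < ε₀ →
        (neumannGame Ω f h lam α β γ ψ M).WellDefined ε ∧
        ∀ x ∈ closure Ω,
          |(neumannGame Ω f h lam α β γ ψ M).u ε x| ≤
            chi Ω ψ (M - 1 - 2 * supNormOn (closure Ω) ψ) x ∧
          |(neumannGame Ω f h lam α β γ ψ M).v ε x| ≤
            chi Ω ψ (M - 1 - 2 * supNormOn (closure Ω) ψ) x) ∧
      IsViscSub Ω f lam h (neumannGame Ω f h lam α β γ ψ M).ubar ∧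
      IsViscSuper Ω f lam h (neumannGame Ω f h lam α β γ ψ M).vbar ∧
      ∀ 𝒞 : Set (Euc N → ℝ), {w | BoundedOn (closure Ω) w} ⊆ 𝒞 →
        (∀ x ∈ closure Ω, (neumannGame Ω f h lam α β γ ψ M).vbar x ≤
          (neumannGame Ω f h lam α β γ ψ M).ubar x) →
        ComparisonPrinciple Ω f lam h 𝒞 →
        ∃ w ∈ 𝒞, IsViscSol Ω f lam h w ∧
          (∀ w' ∈ 𝒞, IsViscSol Ω f lam h w' → EqOn w' w (closure Ω)) ∧
          TendstoLocallyUniformlyOn (fun ε => (neumannGame Ω f h lam α β γ ψ M).u ε) w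
            (𝓝[>] 0) (closure Ω) ∧
          TendstoLocallyUniformlyOn (fun ε => (neumannGame Ω f h lam α β γ ψ M).v ε) w
            (𝓝[>] 0) (closure Ω) := by
  obtain ⟨ρ, hT⟩ := exists_tangentBalls hΩ hint hext
  obtain ⟨M₀, hM₀, hbar⟩ := exists_barrier (h := h) α β γ hT hlam hf hψ hψn
  refine ⟨M₀, hM₀, fun M hM => ?_⟩
  obtain ⟨C, s₀, K, hb⟩ := hbar M hM
  have hG : (neumannGame Ω f h lam α β γ ψ M).Setting q r ρ (supNormOn (frontier Ω) h) :=
    ⟨hN, hT, hf, hlam, hq, hr, hh, fun x hx => le_supNormOn hhb hx, supNormOn_nonneg, hα, hβ, hγ,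
      hα3, hαβ, hαγ, (max_lt_iff.1 hβγ).1, (max_lt_iff.1 hβγ).2, hγα, hβq, hγr₁, hγr₂⟩
  obtain ⟨ε₀, hε₀, hsub⟩ := mem_nhdsGT_iff_exists_Ioo_subset.1 (hb.eventually_wellDefined hG)
  exact ⟨hb.m_pos, ⟨ε₀, hε₀, fun ε h0 h1 => hsub ⟨h0, h1⟩⟩, hb.isViscSub_ubar hG,
    hb.isViscSuper_vbar hG, fun 𝒞 h𝒞 hle hcomp => hb.exists_solution hG h𝒞 hle hcomp⟩
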